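/- **Setting.** There are $S$ contexts, $K\ge 1$ actions and unknown mean rewards $A(i,j)$, $i\in[S]$, $j\in[K]$, that are $r$-lumpable: for some $g:[S]\to[r]$, $A(i,j)=A(i',j)$ for all $j$ whenever $g(i)=g(i')$. Moreover $A(i,j)-A(i,j')\le 1$ for all $i,j,j'$ (e.g. $A\in[0,1]$). In each round the learner observes a context $i_t$ drawn, independently of the past, from an arbitrary unknown distribution $\nu$ on $[S]$, plays an action $j_t$ (possibly using private randomness), and receives $y_t=A(i_t,j_t)+\eta_t$, where $\eta_t$ is $1$-subgaussian given the past (contexts, actions, rewards and private randomness), $i_t$ and $j_t$: $\mathbb E[e^{\lambda\eta_t}\mid\cdot]\le e^{\lambda^2/2}$ a.s. for all $\lambda\in\mathbb R$. A policy $\pi:[S]\to[K]$ is $\epsilon'$-optimal if $\sum_i\nu(i)A(i,\pi(i))\ge\max_{\pi'}\sum_i\nu(i)A(i,\pi'(i))-\epsilon'$. Sample counts given below as real numbers are rounded up. **Data collection** with input $(T,n,\mathcal K)$, $\mathcal K\subseteq[K]$: every context is assigned an arm drawn from $\mathrm{Unif}(\mathcal K)$; for $T$ rounds the arm $\psi(i_t)$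 assigned to the current context is played; whenever the number of visits of $i_t$ during this run reaches a multiple of $2^n$, the pair $(i_t,\psi(i_t))$ is added to the data set $\mathcal D$, the estimate $\widehat A(i_t,\psi(i_t))$ is set to the mean reward of that pair in this run, and $i_t$ is assigned a fresh uniform arm. **Algorithm 1** with input $(s,r,\epsilon,\delta)$: let $n_{\max}=\lceil\log_2(1/\epsilon^2)\rceil$ (or $0$ if this is negative) and $\mathrm{lg}=16\log(rsK/\delta)$. (1) For $n=1,\dots,n_{\max}$ run data collection with $(r(s+K)\,\mathrm{lg}/\epsilon^2,n,[K])$, giving $\mathcal D_n,\widehat A_n$. (2) Start with $\mathcal W=\emptyset$. For each $n$, while $\mathcal D_n\ne\emptyset$: let $(i^\star,j^\star)$ maximize $\widehat A_n$ on $\mathcal D_n$, add $j^\star$ to $\mathcal W$, run data collection with $(8\,\mathrm{lg}\,2^n s,n,\{j^\star\})$ to get $\widetilde A_n$, and keep in $\mathcal D_n$ only the pairs $(i,j)$ with $|\widetilde A_n(i,j^\star)-\widehat A_n(i^\star,j^\star)|\ge\sqrt{\mathrm{lg}/2^n}$. (3) For $\frac{4s|\mathcal W|}{\epsilon^2}\log\frac{sK}{\delta}$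 rounds play the actions of $\mathcal W$ in round robin at each context, and output at each context the empirically best action of $\mathcal W$ (any policy if $\mathcal W=\emptyset$). **Algorithm 3** with input $(S,K,r,\epsilon,\delta)$: let $J=\frac{4S}{\epsilon}\log\frac S\delta$, $L=\lceil\log_2(S/\epsilon)\rceil$, $N=524\log\frac{rSK}{\delta}\,(1+2\log_2\frac1\epsilon)^2\,\frac{r(S+K)}{\epsilon^2}$. Estimate $\nu$ by the empirical distribution $\hat\nu$ of $J$ contexts. For $l=0,\dots,L-1$ let $\mathcal X_l=\{i:\hat\nu(i)\in(2^{-l-1},2^{-l}]\}$ and, in a window of $N$ rounds, run Algorithm 1 with input $(|\mathcal X_l|,r,\epsilon\sqrt{2/\hat\nu(\mathcal X_l)},\delta)$ on the rounds of the window whose context lies in $\mathcal X_l$, ignoring the others, to get $\pi_l$ (arbitrary if the run is not finished). Output the policy equal to $\pi_l$ on $\mathcal X_l$ for $0\le l<L$ and arbitrary elsewhere. **Theorem.** There are universal constants $c\ge1$, $C>0$ and $q,p\in\mathbb N$ such that for all $S,K,r$, every such bandit problem, every context distribution $\nu$, all $\epsilon\in(0,1]$ and $\delta\in(0,1)$: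 Algorithm 3, run with accuracy $\epsilon$ and with confidence parameter $\delta'=\delta\big/\big(c\,(1+\log\frac{rSK}{\epsilon})^{q}\big)$, with probability at least $1-\delta$ outputs a policy that is $$C\Big(1+\log\frac{rSK}{\epsilon\delta}\Big)^{p}\,\epsilon\text{-optimal}$$ and uses at most $$C\Big(1+\log\frac{rSK}{\epsilon}\Big)^{p}\;\frac{r(S+K)\,(1+\log(1/\delta))}{\epsilon^2}$$ samples. -/

import Mathlib

open MeasureTheory ProbabilityTheory

noncomputable section

namespace LumpableBandit

/-! ### Learners as interactive programs -/

/-- What happens in one round: the private random arm of the learner, the context, the reward. -/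
structure Obs (S K : ℕ) where
  seed : Fin K
  ctx : Fin S
  reward : ℝ

/-- An interactive program of a learner, facing `S` contexts and `K` actions, that eventually
returns a value of type `α`.  In a round the program has access to a fresh random arm `u` (uniform
on the set of actions), receives the context `i`, plays the action `act u i`, receives the reward
`y`, and continues with `next u i y`.  One `round` is one sample. -/
inductive Prog (S K : ℕ) (α : Type) : Type where
  | done (a : α) : Prog S K α
  | round (act : Fin K → Fin S → Fin K) (next : Fin K → Fin S → ℝ → Prog S K α) : Prog S K α

namespace Prog

variable {S K : ℕ} {α β : Type}

/-- Sequential composition. -/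
def bind : Prog S K α → (α → Prog S K β) → Prog S K β
  | done a, f => f a
  | round act next, f => round act fun u i y => (next u i y).bind f

instance : Monad (Prog S K) where
  pure := done
  bind := bind

/-- The value returned along the sequence `w` of observations. -/
def result : Prog S K α → (ℕ → Obs S K) → α
  | done a, _ => a
  | round _ next, w =>
      (next (w 0).seed (w 0).ctx (w 0).reward).result fun t => w (t + 1)

/-- The number of rounds (samples) used along the sequence `w` of observations. -/
def samples : Prog S K α → (ℕ → Obs S K) → ℕ
  | done _, _ => 0
  | round _ next, w =>
      (next (w 0).seed (w 0).ctx (w 0).reward).samples (fun t => w (t + 1)) + 1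

/-- The action played in round `t` (counted from `0`) along the sequence `w` of observations;
`none` if the program has stopped before.  It depends on the observations of the rounds before `t`
and on the random arm and the context of round `t` only. -/
def actionAt : Prog S K α → (ℕ → Obs S K) → ℕ → Option (Fin K)
  | done _, _, _ => none
  | round act _, w, 0 => some (act (w 0).seed (w 0).ctx)
  | round _ next, w, t + 1 =>
      (next (w 0).seed (w 0).ctx (w 0).reward).actionAt (fun s => w (s + 1)) t

/-- Run `p` inside a window of exactly `N` rounds, on the rounds whose context lies in `X`; the
other rounds of the window are ignored (an arbitrary action is played and `p` does not see them).
The result is `none` if `p` has not stopped at the end of the window. -/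
def restrict [NeZero K] (X : Finset (Fin S)) : ℕ → Prog S K α → Prog S K (Option α)
  | 0, done a => done (some a)
  | 0, round _ _ => done none
  | N + 1, done a => round (fun _ _ => 0) fun _ _ _ => restrict X N (done a)
  | N + 1, round act next =>
      round (fun u i => if i ∈ X then act u i else 0) fun u i y =>
        if i ∈ X then restrict X N (next u i y) else restrict X N (round act next)

end Prog

/-! ### The stochastic environment -/

section Environment

variable {S K : ℕ} {α Ω : Type*}

/-- The sequence of observations at the sample point `x`. -/
def path (u : ℕ → Ω → Fin K) (i : ℕ → Ω → Fin S) (y : ℕ → Ω → ℝ) (x : Ω) : ℕ → Obs S K :=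
  fun t => ⟨u t x, i t x, y t x⟩

/-- The noise of round `t`, i.e. the reward minus the mean reward of the context and the action of
that round (zero when the learner has already stopped, so that nothing is required then). -/
def noise {α : Type} (A : Fin S → Fin K → ℝ) (p : Prog S K α)
    (u : ℕ → Ω → Fin K) (i : ℕ → Ω → Fin S) (y : ℕ → Ω → ℝ) (t : ℕ) (x : Ω) : ℝ :=
  match p.actionAt (path u i y x) t with
  | some j => y t x - A (i t x) j
  | none => 0

/-- The information available before round `t`: all contexts, rewards and random arms (hence all
actions) of the rounds before `t`. -/
@[reducible] def past (u : ℕ → Ω → Fin K) (i : ℕ → Ω → Fin S) (y : ℕ → Ω → ℝ) (t : ℕ) : MeasurableSpace Ω :=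
  ⨆ s : Fin t, MeasurableSpace.comap (fun x => (u s x, i s x, y s x)) inferInstance

/-- The information available when the reward of round `t` is drawn: the past, the context and the
random arm (hence the action) of round `t`. -/
@[reducible] def present (u : ℕ → Ω → Fin K) (i : ℕ → Ω → Fin S) (y : ℕ → Ω → ℝ) (t : ℕ) :
    MeasurableSpace Ω :=
  past u i y t ⊔ MeasurableSpace.comap (fun x => (i t x, u t x)) inferInstance

/-- `(u, i, y)` are the random arms, contexts and rewards of an interaction of the learner `p` with
a contextual bandit with mean rewards `A` and context distribution `ν`:
in every round the context has law `ν`, the random arm of the learner is uniform and independent of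
the context, both are independent of the past, and the noise is `1`-subgaussian given the past, the
context and the action. -/
structure IsInteraction {α : Type} [NeZero K] [MeasurableSpace Ω] (P : Measure Ω)
    (A : Fin S → Fin K → ℝ) (ν : PMF (Fin S)) (p : Prog S K α)
    (u : ℕ → Ω → Fin K) (i : ℕ → Ω → Fin S) (y : ℕ → Ω → ℝ) : Prop where
  measurable_seed : ∀ t, Measurable (u t)
  measurable_ctx : ∀ t, Measurable (i t)
  measurable_reward : ∀ t, Measurable (y t)
  law : ∀ t, P.map (fun x => (i t x, u t x)) =
    ν.toMeasure.prod (PMF.uniformOfFintype (Fin K)).toMeasure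
  indep : ∀ t, Indep (MeasurableSpace.comap (fun x => (i t x, u t x)) inferInstance)
    (past u i y t) P
  integrable_exp : ∀ t (c : ℝ), Integrable (fun x => Real.exp (c * noise A p u i y t x)) P
  subgaussian : ∀ t (c : ℝ),
    P[fun x => Real.exp (c * noise A p u i y t x) | present u i y t]
      ≤ᵐ[P] fun _ => Real.exp (c ^ 2 / 2)

end Environment

/-! ### Lumpability and optimality of policies -/

/-- `A` is `r`-lumpable: the contexts can be lumped into `r` groups such that the mean reward
depends on the group of the context and on the action only. -/
def Lumpable {S K : ℕ} (r : ℕ) (A : Fin S → Fin K → ℝ) : Prop :=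
  ∃ g : Fin S → Fin r, ∀ i i', g i = g i' → ∀ j, A i j = A i' j

/-- The expected reward of a policy. -/
def value {S K : ℕ} (A : Fin S → Fin K → ℝ) (ν : PMF (Fin S)) (π : Fin S → Fin K) : ℝ :=
  ∑ i, (ν i).toReal * A i (π i)

/-- `π` is `ε`-optimal. -/
def IsEpsOptimal {S K : ℕ} (A : Fin S → Fin K → ℝ) (ν : PMF (Fin S)) (ε : ℝ)
    (π : Fin S → Fin K) : Prop :=
  ∀ π' : Fin S → Fin K, value A ν π' - ε ≤ value A ν π

/-! ### The algorithms -/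

/-- A maximizer of `f` over `D`. -/
def argmaxOn {β : Type} (D : Finset β) (hD : D.Nonempty) (f : β → ℝ) : β :=
  Classical.choose (p := fun x => x ∈ D ∧ ∀ z ∈ D, f z ≤ f x) (D.exists_max_image f hD)

section Algorithms

variable {S K : ℕ}

/-! #### Data collection -/

/-- State of the data collection routine. -/
structure CollectState (S K : ℕ) where
  /-- the arm currently assigned to a context; `none` if a new one has to be drawn -/
  psi : Fin S → Option (Fin K)
  /-- number of visits of a context -/
  visits : Fin S → ℕ
  /-- number of plays of a context-action pair -/
  num : Fin S × Fin K → ℕ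
  /-- sum of the rewards of a context-action pair -/
  sum : Fin S × Fin K → ℝ
  /-- the data set -/
  pairs : Finset (Fin S × Fin K)
  /-- the reward estimates -/
  est : Fin S × Fin K → ℝ

def CollectState.init : CollectState S K where
  psi := fun _ => none
  visits := fun _ => 0
  num := fun _ => 0
  sum := fun _ => 0
  pairs := ∅
  est := fun _ => 0

/-- A uniform draw from the exploration set, which is the set of all actions (`none`) or a
singleton (`some j`), from a uniformly drawn action `u`. -/
def drawFrom (𝒦 : Option (Fin K)) (u : Fin K) : Fin K := 𝒦.getD u

/-- The arm played at context `i`: the assigned one, or a newly drawn one if there is none.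
(Arms are drawn when they are needed for the first time, with the random arm of that round.) -/
def CollectState.arm (st : CollectState S K) (𝒦 : Option (Fin K)) (u : Fin K) (i : Fin S) :
    Fin K :=
  (st.psi i).getD (drawFrom 𝒦 u)

/-- Update after playing `j` at context `i` and receiving the reward `y`.  Whenever the number of
visits of `i` reaches a multiple of `2 ^ n`, the pair `(i, j)` enters the data set, its estimate
becomes its empirical mean, and the context `i` loses its arm. -/
def CollectState.update (st : CollectState S K) (n : ℕ) (i : Fin S) (j : Fin K) (y : ℝ) :
    CollectState S K :=
  let visits := Function.update st.visits i (st.visits i + 1)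
  let num := Function.update st.num (i, j) (st.num (i, j) + 1)
  let sum := Function.update st.sum (i, j) (st.sum (i, j) + y)
  if visits i % 2 ^ n = 0 then
    { psi := Function.update st.psi i none
      visits := visits
      num := num
      sum := sum
      pairs := insert (i, j) st.pairs
      est := Function.update st.est (i, j) (sum (i, j) / num (i, j)) }
  else
    { psi := Function.update st.psi i (some j)
      visits := visits
      num := num
      sum := sum
      pairs := st.pairs
      est := st.est }

/-- `T` rounds of data collection at accuracy level `n`, from the state `st`. -/
def collectFrom (n : ℕ) (𝒦 : Option (Fin K)) :
    ℕ → CollectState S K → Prog S K (CollectState S K)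
  | 0, st => .done st
  | T + 1, st => .round (fun u i => st.arm 𝒦 u i) fun u i y =>
      collectFrom n 𝒦 T (st.update n i (st.arm 𝒦 u i) y)

/-- Data collection: `T` rounds at accuracy level `n` with exploration set `𝒦`. -/
def collect (T n : ℕ) (𝒦 : Option (Fin K)) : Prog S K (CollectState S K) :=
  collectFrom n 𝒦 T CollectState.init

/-! #### Almost-uniform context distributions -/

/-- The data collection step: levels `1, …, n`, with `T` rounds each. -/
def collectLevels (T : ℕ) : ℕ → Prog S K (ℕ → CollectState S K)
  | 0 => pure fun _ => CollectState.init
  | n + 1 => do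
      let f ← collectLevels T n
      let d ← collect T (n + 1) none
      pure (Function.update f (n + 1) d)

open Classical in
/-- The screening loop at level `n`: while the data set `D` is nonempty, the action `j` of its best
pair enters the candidate set `W`, new data for `j` are collected in `T` rounds, and all pairs of
contexts whose new estimate is closer than `thr` to the best one are removed from `D`.
The first argument bounds the number of iterations. -/
def screen (T n : ℕ) (thr : ℝ) (est : Fin S × Fin K → ℝ) :
    ℕ → Finset (Fin S × Fin K) → Finset (Fin K) → Prog S K (Finset (Fin K))
  | 0, _, W => pure W
  | m + 1, D, W =>
      if hD : D.Nonempty then do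
        let b := argmaxOn D hD est
        let d ← collect T n (some b.2)
        screen T n thr est m (D.filter fun q => thr ≤ |d.est (q.1, b.2) - est b|) (insert b.2 W)
      else pure W

/-- Screening of the levels `1, …, n`. -/
def screenLevels (T : ℕ → ℕ) (thr : ℕ → ℝ) (fuel : ℕ) (f : ℕ → CollectState S K) :
    ℕ → Prog S K (Finset (Fin K))
  | 0 => pure ∅
  | n + 1 => do
      let W ← screenLevels T thr fuel f n
      screen (T (n + 1)) (n + 1) (thr (n + 1)) (f (n + 1)).est fuel (f (n + 1)).pairs W

/-- Round robin over the nonempty set `W`, separately at each context, for `T` rounds, followed by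
the choice of the empirically best action of `W` at each context. -/
def roundRobin (W : Finset (Fin K)) (hW : W.Nonempty) :
    ℕ → (Fin S × Fin K → ℕ) → (Fin S × Fin K → ℝ) → Prog S K (Fin S → Fin K)
  | 0, num, sum => .done fun i => argmaxOn W hW fun j => sum (i, j) / num (i, j)
  | T + 1, num, sum =>
      let act : Fin S → Fin K := fun i => argmaxOn W hW fun j => -(num (i, j) : ℝ)
      .round (fun _ i => act i) fun _ i y =>
        roundRobin W hW T (Function.update num (i, act i) (num (i, act i) + 1))
          (Function.update sum (i, act i) (sum (i, act i) + y))

/-- The algorithm for `s` contexts (out of the `S` contexts) with almost uniform distribution, with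
`r` blocks, accuracy `ε` and confidence `δ`.  (`fuel` bounds the number of iterations of each
screening loop; each iteration takes at least one round.) -/
def almostUniform [NeZero K] (s r : ℕ) (ε δ : ℝ) (fuel : ℕ) : Prog S K (Fin S → Fin K) :=
  let levels := ⌈Real.logb 2 (1 / ε ^ 2)⌉₊
  let lg := 16 * Real.log (r * s * K / δ)
  let T := ⌈r * (s + K) * lg / ε ^ 2⌉₊
  do
    let f ← collectLevels T levels
    let W ← screenLevels (fun n => ⌈8 * lg * 2 ^ n * s⌉₊) (fun n => √(lg / 2 ^ n)) fuel f levels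
    if hW : W.Nonempty then
      roundRobin W hW ⌈4 * s * (W.card : ℝ) / ε ^ 2 * Real.log (s * K / δ)⌉₊
        (fun _ => 0) (fun _ => 0)
    else pure fun _ => 0

/-! #### General context distributions -/

/-- Observe `J` contexts (the actions are irrelevant) and count them. -/
def observe [NeZero K] : ℕ → (Fin S → ℕ) → Prog S K (Fin S → ℕ)
  | 0, cnt => .done cnt
  | J + 1, cnt => .round (fun _ _ => 0) fun _ i _ =>
      observe J (Function.update cnt i (cnt i + 1))

open Classical in
/-- The contexts with estimated probability in `(2 ^ (-l-1), 2 ^ (-l)]`. -/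
def bucket (νhat : Fin S → ℝ) (l : ℕ) : Finset (Fin S) :=
  Finset.univ.filter fun i => (1 / 2) ^ (l + 1) < νhat i ∧ νhat i ≤ (1 / 2) ^ l

/-- Learn a policy on each of the buckets `0, …, l - 1`, in a window of `N` rounds each, and glue
these policies; the result is arbitrary elsewhere.  The accuracy on the bucket `X` is
`ε * √(2 / νhat X)`. -/
def learnBuckets [NeZero K] (r : ℕ) (ε δ : ℝ) (N : ℕ) (νhat : Fin S → ℝ) :
    ℕ → Prog S K (Fin S → Fin K)
  | 0 => pure fun _ => 0
  | l + 1 => do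
      let π ← learnBuckets r ε δ N νhat l
      let X := bucket νhat l
      let ρ ← (almostUniform X.card r (ε * √(2 / ∑ i ∈ X, νhat i)) δ N).restrict X N
      pure fun i => if i ∈ X then ρ.getD (fun _ => 0) i else π i

/-- The algorithm for general context distributions, with `S` contexts, `K` actions, `r` blocks,
accuracy `ε` and confidence `δ`. -/
def generalAlgorithm (S K : ℕ) [NeZero K] (r : ℕ) (ε δ : ℝ) : Prog S K (Fin S → Fin K) :=
  let J := ⌈4 * S / ε * Real.log (S / δ)⌉₊
  let L := ⌈Real.logb 2 (S / ε)⌉₊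
  let N := ⌈524 * Real.log (r * S * K / δ) * (1 + 2 * Real.logb 2 (1 / ε)) ^ 2
    * (r * (S + K) / ε ^ 2)⌉₊
  do
    let cnt ← observe J fun _ => 0
    learnBuckets r ε δ N (fun i => cnt i / J) L

end Algorithms

end LumpableBandit

end

/-! Failure probabilities are bounded by exponential potentials. `Cert A ρ Post M Q p v` attaches to
a family of programs a value function `v`: its expectation after a round is at most its value
before, for every `1`-subgaussian reward law, and where the program ends badly it is at least `1`.
By Markov's inequality the value at the start bounds the probability of a bad result (`Cert.sound`).
Certificates compose: values add up under `Cert.bind`, and `Cert.restrict` passes to the rounds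
whose context lies in a set `X`. The context weights `ρ` are not normalized, so the restricted
distribution needs no conditioning. A union bound is a sum of potentials.

Almost uniform contexts (`cert_almostUniform`). At level `n` a context spends blocks of `2 ^ n`
visits on uniformly drawn arms, so every pair in the data set is known up to half of `√(lg / 2 ^
n)`. If each of the `c` contexts of a lump goes through `m` blocks, the lump draws `m * c` arms, and
its optimal arm is among them except with probability `(1 - 1 / K) ^ (m * c)`. Hence large lumps
meet their optimal arm at high levels, small lumps only at coarse ones. One iteration of screening
removes all pairs of the lump of the current best pair, since lumped contexts have the same mean for
the new arm. So at most `r` arms per level are kept (`cert_screen`), and every removed pair loses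
less than two thresholds against a kept arm. The round robin over these few arms is cheap. At a
context in a lump of `c` out of `s` contexts the loss is at most `ε * √lg * (6 + 16 * s / (r * c))`;
as the sum of `1 / c` over the contexts is at most the number `r` of lumps, the average loss is at
most `22 * ε * √lg` (`sum_blockLoss_le`).

General distributions (`cert_generalAlgorithm`). On a bucket, `ν` is uniform up to a factor `32`. A
bucket of estimated weight `h` is learned with accuracy `ε * √(2 / h)`: this costs of order `h * r *
(S + K) / ε ^ 2` rounds up to logarithms, which a window of `N` rounds provides, and the weighted
loss is of order `h * ε * √(2 / h)`, hence of order `ε` up to logarithms. If this accuracy exceeds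
`1 / 8`, the bucket has weight of order `ε ^ 2` and any policy will do. There are logarithmically
many buckets, and the contexts outside of them have probability at most `4 * ε` in total. The number
of samples is deterministic. -/

namespace LumpableBandit

open scoped ENNReal NNReal

/-! ### Certificates for the failure probability of a program -/

section Certificates

variable {S K : ℕ}

/-- For all choices of `1`-subgaussian reward distributions with means `A`, the expectation of `G`
after one round with context weights `ρ` is at most `v` times the total weight. -/
def StepLE (A : Fin S → Fin K → ℝ) (ρ : Fin S → ℝ≥0) (act : Fin K → Fin S → Fin K)
    (G : Fin K → Fin S → ℝ → ℝ≥0∞) (v : ℝ≥0∞) : Prop :=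
  ∀ μ : Fin K → Fin S → Measure ℝ, (∀ u i, IsProbabilityMeasure (μ u i)) →
    (∀ u i (c : ℝ), ∫⁻ y, ENNReal.ofReal (Real.exp (c * (y - A i (act u i)))) ∂μ u i ≤
      ENNReal.ofReal (Real.exp (c ^ 2 / 2))) →
    ∑ i, (ρ i : ℝ≥0∞) * ((∑ u, ∫⁻ y, G u i y ∂μ u i) / K) ≤ (∑ i, (ρ i : ℝ≥0∞)) * v

/-- A certificate that, from every parameter `b ∈ Q`, the program `p b` stops within `M` rounds with
a result satisfying `Post b`, except with probability at most `v b`. -/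
inductive Cert {α : Type} [MeasurableSpace α] (A : Fin S → Fin K → ℝ) (ρ : Fin S → ℝ≥0) :
    {β : Type} → [MeasurableSpace β] → (Post : β → α → Prop) → (M : ℕ) → (Q : Set β) →
    (p : β → Prog S K α) → (v : β → ℝ≥0∞) → Prop
  | done {β : Type} [MeasurableSpace β] {Post : β → α → Prop} {M : ℕ} {Q : Set β}
      {p : β → Prog S K α} {v : β → ℝ≥0∞} (hv : Measurable v) (a : β → α) (ha : Measurable a)
      (hp : ∀ b ∈ Q, p b = .done (a b)) (hF : ∀ b ∈ Q, Post b (a b) ∨ 1 ≤ v b) :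
      Cert A ρ Post M Q p v
  -- A value of at least `1` claims nothing, so the program may be anything here.
  | fail {β : Type} [MeasurableSpace β] {Post : β → α → Prop} {M : ℕ} {Q : Set β}
      {p : β → Prog S K α} {v : β → ℝ≥0∞} (hv : Measurable v) (hF : ∀ b ∈ Q, 1 ≤ v b) :
      Cert A ρ Post M Q p v
  | round {β : Type} [MeasurableSpace β] {Post : β → α → Prop} {M : ℕ} {Q : Set β}
      {p : β → Prog S K α} {v : β → ℝ≥0∞} (hv : Measurable v)
      (act : β → Fin K → Fin S → Fin K) (hact : Measurable act)
      (next : β × Fin K × Fin S × ℝ → Prog S K α) (G : β × Fin K × Fin S × ℝ → ℝ≥0∞)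
      (hp : ∀ b ∈ Q, p b = .round (act b) fun u i y => next (b, u, i, y))
      (hn : Cert A ρ (fun z a => Post z.1 a) M {z | z.1 ∈ Q} next G)
      (hs : ∀ b ∈ Q, StepLE A ρ (act b) (fun u i y => G (b, u, i, y)) (v b)) :
      Cert A ρ Post (M + 1) Q p v
  -- Distinguishing the values of a countable statistic costs nothing: in `Cert.sound` the pieces
  -- are disjoint events, over which the integrals of `v` add up.
  | cases {β : Type} [MeasurableSpace β] {Post : β → α → Prop} {M : ℕ} {Q : Set β}
      {p : β → Prog S K α} {v : β → ℝ≥0∞} {D : Type} [Countable D] [MeasurableSpace D]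
      [DiscreteMeasurableSpace D] (hv : Measurable v) (g : β → D) (hg : Measurable g)
      (hc : ∀ d, Cert A ρ Post M {b | b ∈ Q ∧ g b = d} p v) :
      Cert A ρ Post M Q p v

variable {A : Fin S → Fin K → ℝ} {ρ : Fin S → ℝ≥0}

theorem StepLE.mono {act : Fin K → Fin S → Fin K} {G G' : Fin K → Fin S → ℝ → ℝ≥0∞}
    {v v' : ℝ≥0∞} (h : StepLE A ρ act G v) (hG : ∀ u i y, ρ i ≠ 0 → G' u i y ≤ G u i y)
    (hv : v ≤ v') : StepLE A ρ act G' v' := by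
  intro μ hμ hs
  refine le_trans (Finset.sum_le_sum fun i _ => ?_) ((h μ hμ hs).trans (by gcongr))
  rcases eq_or_ne (ρ i) 0 with h0 | h0
  · simp [h0]
  · gcongr with u _ y
    exact hG _ _ _ h0

theorem StepLE.add {act : Fin K → Fin S → Fin K} {G G' : Fin K → Fin S → ℝ → ℝ≥0∞}
    {v v' : ℝ≥0∞} (h : StepLE A ρ act G v) (h' : StepLE A ρ act G' v')
    (hG : ∀ u i, Measurable (G u i)) :
    StepLE A ρ act (fun u i y => G u i y + G' u i y) (v + v') := by
  intro μ hμ hs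
  have := add_le_add (h μ hμ hs) (h' μ hμ hs)
  rw [← mul_add, ← Finset.sum_add_distrib] at this
  refine le_trans (le_of_eq (Finset.sum_congr rfl fun i _ => ?_)) this
  rw [← mul_add, ← ENNReal.add_div, ← Finset.sum_add_distrib]
  congr 3 with u
  rw [lintegral_add_left (hG u i)]

theorem StepLE.sum {ι : Type*} (s : Finset ι) {act : Fin K → Fin S → Fin K}
    {G : ι → Fin K → Fin S → ℝ → ℝ≥0∞} {v : ι → ℝ≥0∞} (h : ∀ e ∈ s, StepLE A ρ act (G e) (v e))
    (hG : ∀ e ∈ s, ∀ u i, Measurable (G e u i)) :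
    StepLE A ρ act (fun u i y => ∑ e ∈ s, G e u i y) (∑ e ∈ s, v e) := by
  classical
  induction s using Finset.induction_on with
  | empty => intro μ _ _; simp
  | insert e s he ih =>
    simp only [Finset.sum_insert he]
    refine StepLE.add (h _ (by simp)) (ih (fun e' h' => h e' (by simp [h']))
      (fun e' h' => hG e' (by simp [h']))) (hG e (by simp))

/-- A bound on the one-step expectation, context by context. -/
theorem StepLE.of_forall_ctx {act : Fin K → Fin S → Fin K}
    {G : Fin K → Fin S → ℝ → ℝ≥0∞} {v : ℝ≥0∞}
    (h : ∀ i, ρ i ≠ 0 → ∀ μ : Fin K → Measure ℝ, (∀ u, IsProbabilityMeasure (μ u)) →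
      (∀ u (c : ℝ), ∫⁻ y, ENNReal.ofReal (Real.exp (c * (y - A i (act u i)))) ∂μ u ≤
        ENNReal.ofReal (Real.exp (c ^ 2 / 2))) → ∑ u, ∫⁻ y, G u i y ∂μ u ≤ K * v) :
    StepLE A ρ act G v := by
  intro μ hμ hs
  rw [Finset.sum_mul]
  refine Finset.sum_le_sum fun i _ => ?_
  rcases eq_or_ne (ρ i) 0 with h0 | h0
  · simp [h0]
  · gcongr
    refine ENNReal.div_le_of_le_mul' (h i h0 (fun u => μ u i) (fun u => hμ u i) (fun u => hs u i))

theorem StepLE.of_forall {act : Fin K → Fin S → Fin K}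
    {G : Fin K → Fin S → ℝ → ℝ≥0∞} {v : ℝ≥0∞}
    (h : ∀ u i, ρ i ≠ 0 → ∀ μ : Measure ℝ, IsProbabilityMeasure μ →
      (∀ (c : ℝ), ∫⁻ y, ENNReal.ofReal (Real.exp (c * (y - A i (act u i)))) ∂μ ≤
        ENNReal.ofReal (Real.exp (c ^ 2 / 2))) → ∫⁻ y, G u i y ∂μ ≤ v) :
    StepLE A ρ act G v := by
  refine StepLE.of_forall_ctx fun i h0 μ hμ hs => ?_
  refine (Finset.sum_le_sum fun u _ => h u i h0 (μ u) (hμ u) (hs u)).trans ?_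
  simp

/-- One-step expectations of functions of the context. -/
theorem StepLE.of_ctx [NeZero K] {act : Fin K → Fin S → Fin K} {G : Fin S → ℝ≥0∞} {v : ℝ≥0∞}
    (h : ∑ i, (ρ i : ℝ≥0∞) * G i ≤ (∑ i, (ρ i : ℝ≥0∞)) * v) :
    StepLE A ρ act (fun _ i _ => G i) v := by
  intro μ hμ hs
  refine le_trans (le_of_eq (Finset.sum_congr rfl fun i _ => ?_)) h
  congr 1
  simp only [lintegral_const, measure_univ, mul_one, Finset.sum_const, Finset.card_univ,
    Fintype.card_fin, nsmul_eq_mul]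
  rw [mul_comm, ENNReal.mul_div_cancel_right (by simp [NeZero.ne K]) (by simp)]

theorem StepLE.const [NeZero K] (act : Fin K → Fin S → Fin K) (v : ℝ≥0∞) :
    StepLE A ρ act (fun _ _ _ => v) v :=
  StepLE.of_ctx (by rw [Finset.sum_mul])

namespace Cert

variable {α : Type} [MeasurableSpace α] {β γ : Type} [MeasurableSpace β] [MeasurableSpace γ]

theorem measurable {Post : β → α → Prop} {M : ℕ} {Q : Set β} {p : β → Prog S K α}
    {v : β → ℝ≥0∞} (h : Cert A ρ Post M Q p v) : Measurable v := by
  cases h <;> assumption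

/-- Parameters of value at least `1` are covered by `Cert.fail`, and they form a measurable set, so
only the remaining ones need an argument. -/
theorem split {Post : β → α → Prop} {M : ℕ} {Q : Set β} {p : β → Prog S K α}
    {v : β → ℝ≥0∞} (h : Cert A ρ Post M {b | b ∈ Q ∧ v b < 1} p v) : Cert A ρ Post M Q p v := by
  have hv := h.measurable
  refine Cert.cases (D := Prop) hv (fun b => v b < 1) ?_ fun d => ?_
  · exact measurableSet_setOfPred.1 (measurableSet_lt hv measurable_const)
  by_cases hd : d
  · simpa [hd] using h
  · refine Cert.fail hv ?_
    rintro b ⟨-, rfl⟩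
    exact not_lt.1 hd

/-- Reindexing and weakening. -/
theorem comp {Post : β → α → Prop} {M : ℕ} {Q : Set β} {p : β → Prog S K α}
    {v : β → ℝ≥0∞} (h : Cert A ρ Post M Q p v) :
    ∀ {γ : Type} [MeasurableSpace γ] {Post' : γ → α → Prop} {M' : ℕ} {Q' : Set γ}
      {p' : γ → Prog S K α} {v' : γ → ℝ≥0∞} (f : γ → β), Measurable f → Measurable v' → M ≤ M' →
      (∀ c ∈ Q', f c ∈ Q ∨ 1 ≤ v' c) → (∀ c ∈ Q', p' c = p (f c)) →
      (∀ c ∈ Q', ∀ a, Post (f c) a → Post' c a) → (∀ c ∈ Q', v (f c) ≤ v' c) →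
      Cert A ρ Post' M' Q' p' v' := by
  induction h with
  | done hv a ha hp hF =>
    intro γ _ Post' M' Q' p' v' f hf hv' hM hQ hp' hPost hvv
    -- After `split` only values below `1` remain, which removes the second alternative of `hQ`.
    refine split (Cert.done hv' (fun c => a (f c)) (ha.comp hf) ?_ ?_)
    · rintro c ⟨hc, hlt⟩
      rw [hp' c hc, hp _ ((hQ c hc).resolve_right (not_le.2 hlt))]
    · rintro c ⟨hc, hlt⟩
      rcases hF _ ((hQ c hc).resolve_right (not_le.2 hlt)) with h | h
      · exact Or.inl (hPost c hc _ h)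
      · exact Or.inr (h.trans (hvv c hc))
  | fail hv hF =>
    intro γ _ Post' M' Q' p' v' f hf hv' hM hQ hp' hPost hvv
    refine split (Cert.fail hv' ?_)
    rintro c ⟨hc, hlt⟩
    exact (hF _ ((hQ c hc).resolve_right (not_le.2 hlt))).trans (hvv c hc)
  | round hv act hact next G hp hn hs ih =>
    intro γ _ Post' M' Q' p' v' f hf hv' hM hQ hp' hPost hvv
    obtain ⟨M', rfl⟩ : ∃ m, M' = m + 1 := ⟨M' - 1, by omega⟩
    have hG := hn.measurable
    have hm : Measurable fun z : γ × Fin K × Fin S × ℝ => (f z.1, z.2) := by fun_prop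
    refine split (Cert.round hv' (fun c => act (f c)) (hact.comp hf)
      (fun z => next (f z.1, z.2)) (fun z => G (f z.1, z.2)) ?_ ?_ ?_)
    · rintro c ⟨hc, hlt⟩
      rw [hp' c hc, hp _ ((hQ c hc).resolve_right (not_le.2 hlt))]
    · refine ih (fun z => (f z.1, z.2)) hm (hG.comp hm) (by omega) ?_ (fun _ _ => rfl) ?_
        (fun _ _ => le_rfl)
      · rintro c ⟨hc, hlt⟩
        exact Or.inl ((hQ _ hc).resolve_right (not_le.2 hlt))
      · rintro c ⟨hc, hlt⟩ a ha
        exact hPost _ hc _ ha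
    · rintro c ⟨hc, hlt⟩
      exact (hs _ ((hQ c hc).resolve_right (not_le.2 hlt))).mono (fun _ _ _ _ => le_rfl) (hvv c hc)
  | cases hv g hg hc ih =>
    intro γ _ Post' M' Q' p' v' f hf hv' hM hQ hp' hPost hvv
    refine Cert.cases hv' (fun c => g (f c)) (hg.comp hf) fun d => ?_
    refine ih d f hf hv' hM ?_ ?_ ?_ ?_
    · rintro c ⟨h1, h2⟩
      rcases hQ c h1 with h | h
      · exact Or.inl ⟨h, h2⟩
      · exact Or.inr h
    · exact fun c h => hp' c h.1
    · exact fun c h => hPost c h.1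
    · exact fun c h => hvv c h.1

theorem mono {Post Post' : β → α → Prop} {M M' : ℕ} {Q Q' : Set β} {p p' : β → Prog S K α}
    {v v' : β → ℝ≥0∞} (h : Cert A ρ Post M Q p v) (hv' : Measurable v') (hM : M ≤ M')
    (hQ : ∀ b ∈ Q', b ∈ Q) (hp : ∀ b ∈ Q', p' b = p b)
    (hPost : ∀ b ∈ Q', ∀ a, Post b a → Post' b a)
    (hv : ∀ b ∈ Q', v b ≤ v' b) : Cert A ρ Post' M' Q' p' v' :=
  h.comp id measurable_id hv' hM (fun b hb => Or.inl (hQ b hb)) hp hPost hv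

/-- A round, where nothing has to be shown for contexts of weight zero. -/
theorem round_of_support {Post : β → α → Prop} {M : ℕ} {Q : Set β}
    {p : β → Prog S K α} {v : β → ℝ≥0∞} (hv : Measurable v)
    (act : β → Fin K → Fin S → Fin K) (hact : Measurable act)
    (next : β × Fin K × Fin S × ℝ → Prog S K α) (G : β × Fin K × Fin S × ℝ → ℝ≥0∞)
    (hp : ∀ b ∈ Q, p b = .round (act b) fun u i y => next (b, u, i, y))
    (hn : Cert A ρ (fun z a => Post z.1 a) M {z | z.1 ∈ Q ∧ ρ z.2.2.1 ≠ 0} next G)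
    (hs : ∀ b ∈ Q, StepLE A ρ (act b) (fun u i y => G (b, u, i, y)) (v b)) :
    Cert A ρ Post (M + 1) Q p v := by
  classical
  have hG := hn.measurable
  have hset : MeasurableSet {z : β × Fin K × Fin S × ℝ | ρ z.2.2.1 = 0} := by
    have : Measurable fun z : β × Fin K × Fin S × ℝ => z.2.2.1 := by fun_prop
    exact this (MeasurableSet.of_discrete (s := {i : Fin S | ρ i = 0}))
  have hG' : Measurable fun z : β × Fin K × Fin S × ℝ => if ρ z.2.2.1 = 0 then (⊤ : ℝ≥0∞) else G z :=
    Measurable.ite hset measurable_const hG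
  -- The value `⊤` at contexts of weight zero makes the continuation trivial there, and it is free
  -- because `0 * ⊤ = 0`.
  refine Cert.round hv act hact next _ hp (?_ : Cert A ρ _ _ _ _
    (fun z => if ρ z.2.2.1 = 0 then (⊤ : ℝ≥0∞) else G z)) ?_
  · refine hn.comp id measurable_id hG' le_rfl ?_ (fun _ _ => rfl) (fun _ _ _ h => h) ?_
    · intro z hz
      by_cases h0 : ρ z.2.2.1 = 0
      · right; simp [h0]
      · exact Or.inl ⟨hz, h0⟩
    · intro z hz
      by_cases h0 : ρ z.2.2.1 = 0 <;> simp [h0]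
  · intro b hb
    refine (hs b hb).mono (fun u i y h0 => ?_) le_rfl
    simp [h0]

/-- Sequential composition. -/
theorem bind_aux [NeZero K] {δ : Type} [MeasurableSpace δ] {Post : β → α → Prop} {M : ℕ} {Q : Set β}
    {p : β → Prog S K α} {v : β → ℝ≥0∞} (h : Cert A ρ Post M Q p v) :
    ∀ {γ : Type} [MeasurableSpace γ] {Post' : γ → δ → Prop} {M' : ℕ} {Q' : Set γ}
      {w : ℝ≥0∞} (f : γ → β) (k : γ × α → Prog S K δ), Measurable f → (∀ c ∈ Q', f c ∈ Q) →
      Cert A ρ (fun z d => Post' z.1 d) M' {z | z.1 ∈ Q' ∧ Post (f z.1) z.2} k (fun _ => w) →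
      Cert A ρ Post' (M + M') Q' (fun c => (p (f c)).bind fun a => k (c, a))
        (fun c => v (f c) + w) := by
  induction h with
  | done hv a ha hp hF =>
    intro γ _ Post' M' Q' w f k hf hQ hk
    refine hk.comp (fun c => (c, a (f c))) (by fun_prop) (by fun_prop) (by omega) ?_ ?_ ?_ ?_
    · intro c hc
      rcases hF _ (hQ c hc) with h | h
      · exact Or.inl ⟨hc, h⟩
      · exact Or.inr (h.trans le_self_add)
    · intro c hc
      simp [hp _ (hQ c hc), Prog.bind]
    · exact fun c hc _ h => h
    · exact fun c hc => le_add_self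
  | fail hv hF =>
    intro γ _ Post' M' Q' w f k hf hQ hk
    exact Cert.fail (by fun_prop) fun c hc => (hF _ (hQ c hc)).trans le_self_add
  | @round β _ Post M Q p v hv act hact next G hp hn hs ih =>
    intro γ _ Post' M' Q' w f k hf hQ hk
    have hG := hn.measurable
    have hm : Measurable fun z : γ × Fin K × Fin S × ℝ => (f z.1, z.2) := by fun_prop
    -- After a round the parameter of `p` contains the new observation, while `k` still uses the old
    -- parameter only. This is why the statement carries the reindexing map `f`.
    have := ih (Post' := fun z => Post' z.1) (Q' := {z : γ × Fin K × Fin S × ℝ | z.1 ∈ Q'})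
      (fun z : γ × Fin K × Fin S × ℝ => (f z.1, z.2)) (fun z => k (z.1.1, z.2)) hm
      (fun z hz => hQ _ hz) (hk.comp (fun z => (z.1.1, z.2)) (by fun_prop) (by fun_prop) le_rfl
        (fun z hz => Or.inl hz) (fun _ _ => rfl) (fun _ _ _ h => h) fun _ _ => le_rfl)
    rw [add_right_comm]
    refine Cert.round (by fun_prop) (fun c => act (f c)) (hact.comp hf) _ _ ?_ this ?_
    · intro c hc
      simp [hp _ (hQ c hc), Prog.bind]
    · intro c hc
      exact StepLE.add (hs _ (hQ c hc)) (StepLE.const _ w) fun u i => by fun_prop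
  | cases hv g hg hc ih =>
    intro γ _ Post' M' Q' w f k hf hQ hk
    refine Cert.cases (by fun_prop) (fun c => g (f c)) (hg.comp hf) fun d => ?_
    refine ih d f k hf (fun c hc => ⟨hQ c hc.1, hc.2⟩) ?_
    exact hk.mono (by fun_prop) le_rfl (fun z hz => ⟨hz.1.1, hz.2⟩) (fun _ _ => rfl)
      (fun _ _ _ h => h) fun _ _ => le_rfl

theorem bind [NeZero K] {δ : Type} [MeasurableSpace δ] {Post : β → α → Prop} {M : ℕ} {Q : Set β}
    {p : β → Prog S K α} {v : β → ℝ≥0∞} (h : Cert A ρ Post M Q p v)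
    {Post' : β → δ → Prop} {M' : ℕ} {w : ℝ≥0∞} {k : β × α → Prog S K δ}
    (hk : Cert A ρ (fun z d => Post' z.1 d) M' {z | z.1 ∈ Q ∧ Post z.1 z.2} k (fun _ => w)) :
    Cert A ρ Post' (M + M') Q (fun c => (p c).bind fun a => k (c, a)) (fun c => v c + w) :=
  h.bind_aux id k measurable_id (fun _ h => h) hk

/-- Programs that iterate one kind of round on a state. -/
theorem loop {σ : Type} [MeasurableSpace σ] (p : ℕ → σ → Prog S K α) (out : σ → α)
    (hout : Measurable out) (act : σ → Fin K → Fin S → Fin K) (hact : Measurable act)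
    (upd : σ × Fin K × Fin S × ℝ → σ) (hupd : Measurable upd)
    (hp0 : ∀ s, p 0 s = .done (out s))
    (hp : ∀ T s, p (T + 1) s = .round (act s) fun u i y => p T (upd (s, u, i, y)))
    (Inv : Set σ) (V : ℕ → σ → ℝ≥0∞) (hV : ∀ T, Measurable (V T)) (Post : α → Prop)
    (hend : ∀ s ∈ Inv, Post (out s) ∨ 1 ≤ V 0 s)
    (hinv : ∀ T, ∀ s ∈ Inv, ∀ u i y, ρ i ≠ 0 →
      upd (s, u, i, y) ∈ Inv ∨ 1 ≤ V T (upd (s, u, i, y)))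
    (hstep : ∀ T, ∀ s ∈ Inv, StepLE A ρ (act s) (fun u i y => V T (upd (s, u, i, y))) (V (T + 1) s))
    (T : ℕ) : Cert A ρ (fun _ => Post) T Inv (p T) (V T) := by
  induction T with
  | zero => exact Cert.done (hV 0) out hout (fun s _ => hp0 s) hend
  | succ T ih =>
    refine Cert.round_of_support (hV _) act hact (fun z => p T (upd z)) (fun z => V T (upd z))
      (fun s _ => hp T s) ?_ (hstep T)
    refine ih.comp upd hupd ((hV T).comp hupd) le_rfl ?_ (fun _ _ => rfl) (fun _ _ _ h => h)
      fun _ _ => le_rfl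
    rintro ⟨s, u, i, y⟩ ⟨hs, h0⟩
    exact hinv T s hs u i y h0

/-- Passing to the rounds of a window whose context lies in `X`; `c` tells whether a program that is
not finished at the end of the window is acceptable. -/
theorem restrict [NeZero K] [MeasurableSpace (Option α)] (hsome : Measurable (some : α → Option α))
    {ν : Fin S → ℝ≥0} (X : Finset (Fin S)) (w : ℕ → ℕ → ℝ≥0∞) {c : Prop}
    (hw0 : c ∨ ∀ M, 1 ≤ w 0 (M + 1)) (hν : ∑ i, (ν i : ℝ≥0∞) = 1)
    (hw : ∀ N M, (∑ i ∈ X, (ν i : ℝ≥0∞)) * w N M + (∑ i ∈ Xᶜ, (ν i : ℝ≥0∞)) * w N (M + 1)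
      ≤ w (N + 1) (M + 1))
    {Post : β → α → Prop} {M : ℕ} {Q : Set β}
    {p : β → Prog S K α} {v : β → ℝ≥0∞}
    (h : Cert A (fun i => if i ∈ X then ν i else 0) Post M Q p v) :
    ∀ N, Cert A ν (fun b o => (o = none ∧ c) ∨ ∃ a, o = some a ∧ Post b a) N Q
      (fun b => (p b).restrict X N) (fun b => v b + w N M) := by
  induction h with
  | @done β _ Post M Q p v hv a ha hp hF =>
    intro N
    have : ∀ N, Cert A ν (fun b o => (o = none ∧ c) ∨ ∃ a, o = some a ∧ Post b a) N Q
        (fun b => (p b).restrict X N) v := by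
      intro N
      induction N with
      | zero =>
        refine Cert.done hv (fun b => some (a b)) (hsome.comp ha) ?_ ?_
        · intro b hb
          simp [hp b hb, Prog.restrict]
        · intro b hb
          simpa using hF b hb
      | succ N ih =>
        refine Cert.round hv (fun _ _ _ => 0) (by fun_prop) (fun z => (p z.1).restrict X N)
          (fun z => v z.1) ?_ ?_ (fun b _ => StepLE.const _ _)
        · intro b hb
          simp [hp b hb, Prog.restrict]
        · exact ih.comp Prod.fst measurable_fst (by fun_prop) le_rfl (fun _ h => Or.inl h)
            (fun _ _ => rfl) (fun _ _ _ h => h) fun _ _ => le_rfl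
    exact (this N).mono (by fun_prop) le_rfl (fun _ h => h) (fun _ _ => rfl) (fun _ _ _ h => h)
      fun _ _ => le_self_add
  | fail hv hF => exact fun N => Cert.fail (by fun_prop) fun b hb => (hF b hb).trans le_self_add
  | @round β _ Post M Q p v hv act hact next G hp hn hs ih =>
    intro N
    induction N with
    | zero =>
      rcases hw0 with hc | hw0
      · exact Cert.done (by fun_prop) (fun _ => none) measurable_const
          (fun b hb => by simp [hp b hb, Prog.restrict]) fun _ _ => Or.inl (Or.inl ⟨rfl, hc⟩)
      · exact Cert.fail (by fun_prop) fun b hb => (hw0 M).trans le_add_self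
    | succ N ihN =>
      have hG := hn.measurable
      have hi : Measurable fun z : β × Fin K × Fin S × ℝ => z.2.2.1 := by fun_prop
      have hset : MeasurableSet {z : β × Fin K × Fin S × ℝ | z.2.2.1 ∈ X} :=
        hi (MeasurableSet.of_discrete (s := {i : Fin S | i ∈ X}))
      have hGm : Measurable fun z : β × Fin K × Fin S × ℝ =>
          if z.2.2.1 ∈ X then G z + w N M else v z.1 + w N (M + 1) :=
        Measurable.ite hset (by fun_prop) (by fun_prop)
      refine Cert.round (by fun_prop) (fun b u i => if i ∈ X then act b u i else 0) ?_
        (fun z => if z.2.2.1 ∈ X then (next z).restrict X N else (p z.1).restrict X N)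
        (fun z => if z.2.2.1 ∈ X then G z + w N M else v z.1 + w N (M + 1)) ?_ ?_ ?_
      · refine measurable_pi_lambda _ fun u => measurable_pi_lambda _ fun i => ?_
        by_cases h : i ∈ X
        · simp only [h, if_true]; fun_prop
        · simp only [h, if_false]; fun_prop
      · intro b hb
        simp only [hp b hb, Prog.restrict]
      · refine Cert.cases (D := Fin S) hGm (fun z => z.2.2.1) hi fun i => ?_
        by_cases h : i ∈ X
        · refine (ih N).mono hGm le_rfl (fun z hz => hz.1) ?_ (fun _ _ _ h => h) ?_
          · rintro z ⟨-, rfl⟩; simp [h]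
          · rintro z ⟨-, rfl⟩; simp [h]
        · refine ihN.comp Prod.fst measurable_fst hGm le_rfl (fun z hz => Or.inl hz.1) ?_
            (fun _ _ _ h => h) ?_
          · rintro z ⟨-, rfl⟩; simp [h]
          · rintro z ⟨-, rfl⟩; simp [h]
      · intro b hb μ hμ hsub
        let e : Fin K → Fin S → ℝ := fun u i => A i (act b u i)
        -- Outside `X` the window plays the action `0`, so the given laws are not centred at the
        -- means of `act`. They are replaced by Dirac masses at these means; the weights there are
        -- zero, so the sums do not change.
        let μ' : Fin K → Fin S → Measure ℝ := fun u i => if i ∈ X then μ u i else .dirac (e u i)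
        have hμ' : ∀ u i, IsProbabilityMeasure (μ' u i) := fun u i => by
          by_cases h : i ∈ X
          · simp only [μ', h, if_true]; exact hμ u i
          · simp only [μ', h, if_false]; infer_instance
        have h1 := hs b hb μ' hμ' fun u i c => by
          by_cases h : i ∈ X
          · have := hsub u i c
            simp only [h, if_true] at this
            simpa only [μ', h, if_true] using this
          · simp only [μ', h, if_false]
            rw [lintegral_dirac]
            refine ENNReal.ofReal_le_ofReal (Real.exp_le_exp.2 ?_)
            simp only [e, sub_self, mul_zero]
            positivity
        have hX : ∀ f : Fin S → ℝ≥0∞, ∑ i, ((if i ∈ X then ν i else 0 : ℝ≥0) : ℝ≥0∞) * f i =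
            ∑ i ∈ X, (ν i : ℝ≥0∞) * f i := by
          intro f
          rw [← Finset.sum_filter_add_sum_filter_not Finset.univ (· ∈ X)]
          rw [Finset.sum_eq_zero (s := Finset.univ.filter fun i => ¬ i ∈ X)]
          · rw [add_zero, Finset.filter_mem_eq_inter, Finset.univ_inter]
            exact Finset.sum_congr rfl fun i hi => by simp [hi]
          · intro i hi
            simp [(Finset.mem_filter.1 hi).2]
        have hX1 := hX fun _ => 1
        simp only [mul_one] at hX1
        rw [hX, hX1] at h1
        have hK : ∀ x : ℝ≥0∞, ((K : ℝ≥0∞) * x) / K = x := fun x => by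
          rw [mul_comm, ENNReal.mul_div_cancel_right (by simp [NeZero.ne K]) (by simp)]
        rw [hν, one_mul, ← Finset.sum_add_sum_compl X]
        have e1 : ∑ i ∈ X, (ν i : ℝ≥0∞) * ((∑ u, ∫⁻ y,
            (if i ∈ X then G (b, u, i, y) + w N M else v b + w N (M + 1)) ∂μ u i) / K) =
            ∑ i ∈ X, (ν i : ℝ≥0∞) * ((∑ u, ∫⁻ y, G (b, u, i, y) ∂μ' u i) / K) +
            (∑ i ∈ X, (ν i : ℝ≥0∞)) * w N M := by
          rw [Finset.sum_mul, ← Finset.sum_add_distrib]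
          refine Finset.sum_congr rfl fun i hi => ?_
          rw [← mul_add]
          congr 1
          have : ∀ u, ∫⁻ y, (if i ∈ X then G (b, u, i, y) + w N M else v b + w N (M + 1)) ∂μ u i
              = ∫⁻ y, G (b, u, i, y) ∂μ' u i + w N M := fun u => by
            simp only [hi, if_true, μ']
            rw [lintegral_add_right _ measurable_const]
            simp
          simp only [this, Finset.sum_add_distrib, ENNReal.add_div]
          congr 1
          simp [hK]
        have e2 : ∑ i ∈ Xᶜ, (ν i : ℝ≥0∞) * ((∑ u, ∫⁻ y,
            (if i ∈ X then G (b, u, i, y) + w N M else v b + w N (M + 1)) ∂μ u i) / K) =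
            (∑ i ∈ Xᶜ, (ν i : ℝ≥0∞)) * (v b + w N (M + 1)) := by
          rw [Finset.sum_mul]
          refine Finset.sum_congr rfl fun i hi => ?_
          congr 1
          simp [Finset.mem_compl.1 hi, ← mul_add, hK]
        refine (add_le_add e1.le e2.le).trans ?_
        calc _ ≤ ((∑ i ∈ X, (ν i : ℝ≥0∞)) * v b + (∑ i ∈ X, (ν i : ℝ≥0∞)) * w N M) +
              (∑ i ∈ Xᶜ, (ν i : ℝ≥0∞)) * (v b + w N (M + 1)) := by gcongr
          _ = ((∑ i ∈ X, (ν i : ℝ≥0∞)) + (∑ i ∈ Xᶜ, (ν i : ℝ≥0∞))) * v b +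
              ((∑ i ∈ X, (ν i : ℝ≥0∞)) * w N M + (∑ i ∈ Xᶜ, (ν i : ℝ≥0∞)) * w N (M + 1)) := by
            ring
          _ ≤ _ := by
            rw [Finset.sum_add_sum_compl, hν, one_mul]
            gcongr
            exact hw N M
  | cases hv g hg hc ih =>
    intro N
    exact Cert.cases (by fun_prop) g hg fun d => ih d N

end Cert

end Certificates

end LumpableBandit

namespace LumpableBandit

open scoped ENNReal NNReal

/-! ### Soundness of certificates -/

section Soundness

variable {S K : ℕ}

/-- Subgaussianity at rational arguments suffices. -/
theorem lintegral_exp_le_of_rat (μ : Measure ℝ) (a : ℝ)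
    (h : ∀ c : ℚ, ∫⁻ y, ENNReal.ofReal (Real.exp (c * (y - a))) ∂μ ≤
      ENNReal.ofReal (Real.exp ((c : ℝ) ^ 2 / 2))) (c : ℝ) :
    ∫⁻ y, ENNReal.ofReal (Real.exp (c * (y - a))) ∂μ ≤ ENNReal.ofReal (Real.exp (c ^ 2 / 2)) := by
  obtain ⟨q, hq⟩ := Real.exists_seq_rat_strictAnti_tendsto c
  have h1 : ∀ y, Filter.Tendsto (fun n => ENNReal.ofReal (Real.exp (q n * (y - a)))) Filter.atTop
      (nhds (ENNReal.ofReal (Real.exp (c * (y - a))))) := fun y =>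
    ENNReal.tendsto_ofReal ((Real.continuous_exp.tendsto _).comp (hq.2.2.mul_const _))
  have h2 : Filter.Tendsto (fun n => ENNReal.ofReal (Real.exp ((q n : ℝ) ^ 2 / 2))) Filter.atTop
      (nhds (ENNReal.ofReal (Real.exp (c ^ 2 / 2)))) :=
    ENNReal.tendsto_ofReal ((Real.continuous_exp.tendsto _).comp ((hq.2.2.pow 2).div_const _))
  -- Fatou's lemma along rationals decreasing to `c`.
  calc _ = ∫⁻ y, Filter.liminf (fun n => ENNReal.ofReal (Real.exp (q n * (y - a)))) Filter.atTop ∂μ := by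
        simp_rw [fun y => (h1 y).liminf_eq]
    _ ≤ Filter.liminf (fun n => ∫⁻ y, ENNReal.ofReal (Real.exp (q n * (y - a))) ∂μ) Filter.atTop :=
        lintegral_liminf_le fun n => by fun_prop
    _ ≤ Filter.liminf (fun n => ENNReal.ofReal (Real.exp ((q n : ℝ) ^ 2 / 2))) Filter.atTop :=
        Filter.liminf_le_liminf (Filter.Eventually.of_forall fun n => h (q n))
    _ = _ := h2.liminf_eq

variable {A : Fin S → Fin K → ℝ}

/-- `StepLE` holds for every subgaussian choice of reward laws, hence for the conditional law of the
reward given the parameter, context and seed, once this law is known to be subgaussian almost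
surely. Independence of the past makes the average over context and seed the one in `StepLE`. -/
theorem setLIntegral_le_of_stepLE [NeZero K] {β : Type} [MeasurableSpace β] {Ω : Type*}
    {m₀ mΩ : MeasurableSpace Ω} {P : Measure Ω} [IsProbabilityMeasure P]
    (hm₀ : m₀ ≤ mΩ) {U : Ω → Fin K} {I : Ω → Fin S} {Y : Ω → ℝ} (hU : Measurable U)
    (hI : Measurable I) (hY : Measurable Y) {ν : PMF (Fin S)}
    (hlaw : P.map (fun x => (I x, U x)) =
      ν.toMeasure.prod (PMF.uniformOfFintype (Fin K)).toMeasure)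
    (hind : Indep (MeasurableSpace.comap (fun x => (I x, U x)) inferInstance) m₀ P)
    {b : Ω → β} (hb : Measurable[m₀] b) {B : Set Ω} (hB : MeasurableSet[m₀] B)
    {act : β → Fin K → Fin S → Fin K} (hact : Measurable act)
    (hsub : ∀ (c : ℝ) (D : Set Ω),
      MeasurableSet[m₀ ⊔ MeasurableSpace.comap (fun x => (I x, U x)) inferInstance] D → D ⊆ B →
      ∫⁻ x in D, ENNReal.ofReal (Real.exp (c * (Y x - A (I x) (act (b x) (U x) (I x))))) ∂P ≤
        ENNReal.ofReal (Real.exp (c ^ 2 / 2)) * P D)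
    {G : β × Fin K × Fin S × ℝ → ℝ≥0∞} (hG : Measurable G) {v : β → ℝ≥0∞}
    (hs : ∀ x ∈ B, StepLE A (fun i => (ν i).toNNReal) (act (b x))
      (fun u i y => G (b x, u, i, y)) (v (b x))) :
    ∫⁻ x in B, G (b x, U x, I x, Y x) ∂P ≤ ∫⁻ x in B, v (b x) ∂P := by
  have hb' : Measurable b := hb.mono hm₀ le_rfl
  have hB' : MeasurableSet B := hm₀ _ hB
  set η : Measure (Fin S × Fin K) := ν.toMeasure.prod (PMF.uniformOfFintype (Fin K)).toMeasure
    with hη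
  set μB := P.restrict B
  set Z : Ω → β × (Fin S × Fin K) := fun x => (b x, (I x, U x)) with hZ
  have hZm : Measurable Z := by fun_prop
  -- The parameter and the event `B` belong to the past, so independence turns the joint law of
  -- parameter, context and seed into a product.
  have hmap : μB.map Z = (μB.map b).prod η := by
    symm
    refine Measure.prod_eq fun s t hs ht => ?_
    rw [Measure.map_apply hZm (hs.prod ht), Measure.map_apply hb' hs,
      Measure.restrict_apply (hZm (hs.prod ht)), Measure.restrict_apply (hb' hs), ← hlaw,
      Measure.map_apply (by fun_prop) ht]
    have := (Indep_iff _ _ _).1 hind ((fun x => (I x, U x)) ⁻¹' t) (b ⁻¹' s ∩ B) ⟨t, ht, rfl⟩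
      (MeasurableSet.inter (hb hs) hB)
    rw [mul_comm, ← this]
    congr 1
    ext x
    simp only [Set.mem_inter_iff, Set.mem_preimage, Set.mem_prod, hZ]
    tauto
  set κ := condDistrib Y Z μB
  have hcomp : ∀ H : (β × (Fin S × Fin K)) × ℝ → ℝ≥0∞, Measurable H →
      ∫⁻ x in B, H (Z x, Y x) ∂P = ∫⁻ z, ∫⁻ y, H (z, y) ∂κ z ∂μB.map Z := by
    intro H hH
    rw [← Measure.lintegral_compProd hH, compProd_map_condDistrib hY.aemeasurable,
      lintegral_map hH (by fun_prop)]
  have hsg : ∀ᵐ z ∂μB.map Z, ∀ c : ℝ,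
      ∫⁻ y, ENNReal.ofReal (Real.exp (c * (y - A z.2.1 (act z.1 z.2.2 z.2.1)))) ∂κ z ≤
        ENNReal.ofReal (Real.exp (c ^ 2 / 2)) := by
    have hA : Measurable fun z : β × (Fin S × Fin K) => A z.2.1 (act z.1 z.2.2 z.2.1) := by
      have h1 : Measurable fun p : (Fin K → Fin S → Fin K) × (Fin S × Fin K) =>
        A p.2.1 (p.1 p.2.2 p.2.1) := measurable_of_countable _
      exact h1.comp ((hact.comp measurable_fst).prodMk measurable_snd)
    -- Rational exponents keep the exceptional null set countable in origin. For each of them the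
    -- inequality is tested on measurable sets, where it is `hsub`.
    have hq : ∀ᵐ z ∂μB.map Z, ∀ c : ℚ,
        ∫⁻ y, ENNReal.ofReal (Real.exp (c * (y - A z.2.1 (act z.1 z.2.2 z.2.1)))) ∂κ z ≤
          ENNReal.ofReal (Real.exp ((c : ℝ) ^ 2 / 2)) := by
      refine ae_all_iff.2 fun c => ?_
      have hE : Measurable fun w : (β × (Fin S × Fin K)) × ℝ =>
          ENNReal.ofReal (Real.exp (c * (w.2 - A w.1.2.1 (act w.1.1 w.1.2.2 w.1.2.1)))) := by
        have h0 : Measurable fun w : (β × (Fin S × Fin K)) × ℝ =>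
            A w.1.2.1 (act w.1.1 w.1.2.2 w.1.2.1) := hA.comp measurable_fst
        exact ENNReal.measurable_ofReal.comp
          (Real.measurable_exp.comp ((measurable_snd.sub h0).const_mul _))
      refine ae_le_of_forall_setLIntegral_le_of_sigmaFinite ?_ fun s hs _ => ?_
      · exact Measurable.lintegral_kernel_prod_right' (κ := κ) hE
      · have h1 := hcomp (fun w => s.indicator (fun _ => 1) w.1 *
            ENNReal.ofReal (Real.exp (c * (w.2 - A w.1.2.1 (act w.1.1 w.1.2.2 w.1.2.1)))))
          (((measurable_const.indicator hs).comp measurable_fst).mul hE)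
        have h2 : ∫⁻ z, ∫⁻ y, s.indicator (fun _ => 1) z *
            ENNReal.ofReal (Real.exp (c * (y - A z.2.1 (act z.1 z.2.2 z.2.1)))) ∂κ z ∂μB.map Z =
            ∫⁻ z in s, ∫⁻ y,
              ENNReal.ofReal (Real.exp (c * (y - A z.2.1 (act z.1 z.2.2 z.2.1)))) ∂κ z ∂μB.map Z := by
          rw [← lintegral_indicator hs]
          refine lintegral_congr fun z => ?_
          by_cases hz : z ∈ s <;> simp [hz]
        rw [← h2, ← h1]
        have h3 : ∫⁻ x in B, s.indicator (fun _ => 1) (Z x) * ENNReal.ofReal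
            (Real.exp (c * (Y x - A (I x) (act (b x) (U x) (I x))))) ∂P =
            ∫⁻ x in Z ⁻¹' s ∩ B, ENNReal.ofReal
            (Real.exp (c * (Y x - A (I x) (act (b x) (U x) (I x))))) ∂P := by
          rw [← Measure.restrict_restrict (hZm hs), ← lintegral_indicator (hZm hs)]
          refine lintegral_congr fun x => ?_
          by_cases hz : Z x ∈ s
          · simp [hz]
          · simp [hz]
        refine (h3.trans_le (hsub c _ ?_ Set.inter_subset_right)).trans ?_
        · refine MeasurableSet.inter ?_ (?_ : MeasurableSet[_ ⊔ _] B)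
          · have : Measurable[m₀ ⊔ MeasurableSpace.comap (fun x => (I x, U x)) inferInstance] Z := by
              refine Measurable.prodMk (hb.mono le_sup_left le_rfl) ?_
              exact (comap_measurable _).mono le_sup_right le_rfl
            exact this hs
          · exact (le_sup_left : m₀ ≤ _) _ hB
        · simp only [setLIntegral_const]
          rw [Measure.map_apply hZm hs, Measure.restrict_apply (hZm hs)]
    filter_upwards [hq] with z hz c
    exact lintegral_exp_le_of_rat _ _ hz c
  rw [hmap] at hsg
  have hsg2 : ∀ᵐ x ∂μB, ∀ᵐ w ∂η, ∀ c : ℝ,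
      ∫⁻ y, ENNReal.ofReal (Real.exp (c * (y - A w.1 (act (b x) w.2 w.1)))) ∂κ (b x, w) ≤
        ENNReal.ofReal (Real.exp (c ^ 2 / 2)) :=
    ae_of_ae_map hb'.aemeasurable (Measure.ae_ae_of_ae_prod hsg)
  have hGm : Measurable fun w : (β × (Fin S × Fin K)) × ℝ => G (w.1.1, w.1.2.2, w.1.2.1, w.2) := by
    fun_prop
  have hin : Measurable fun z : β × (Fin S × Fin K) => ∫⁻ y, G (z.1, z.2.2, z.2.1, y) ∂κ z :=
    Measurable.lintegral_kernel_prod_right' (κ := κ) hGm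
  have hmain := hcomp _ hGm
  rw [hmap, lintegral_prod _ hin.aemeasurable, lintegral_map hin.lintegral_prod_right' hb'] at hmain
  refine hmain.le.trans ?_
  have hBae : ∀ᵐ x ∂μB, x ∈ B := ae_restrict_mem hB'
  refine lintegral_mono_ae ?_
  filter_upwards [hsg2, hBae] with x hx hxB
  classical
  let good : Fin K → Fin S → Prop := fun u i => ∀ c : ℝ,
      ∫⁻ y, ENNReal.ofReal (Real.exp (c * (y - A i (act (b x) u i)))) ∂κ (b x, (i, u)) ≤
        ENNReal.ofReal (Real.exp (c ^ 2 / 2))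
  -- `StepLE` asks for subgaussian laws at all contexts and seeds; where the conditional law fails
  -- this, a Dirac mass at the mean takes its place.
  let μ : Fin K → Fin S → Measure ℝ := fun u i =>
    if good u i then κ (b x, (i, u)) else .dirac (A i (act (b x) u i))
  have key := hs x hxB μ (fun u i => by
      by_cases h : good u i
      · simp only [μ, h, if_true]; infer_instance
      · simp only [μ, h, if_false]; infer_instance) (fun u i c => by
      by_cases h : good u i
      · simp only [μ, h, if_true]; exact h c
      · simp only [μ, h, if_false]
        rw [lintegral_dirac]
        refine ENNReal.ofReal_le_ofReal (Real.exp_le_exp.2 ?_)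
        simp only [sub_self, mul_zero]
        positivity)
  have hνsum : ∑ i, ((ν i).toNNReal : ℝ≥0∞) = 1 := by
    rw [← ν.tsum_coe, tsum_fintype]
    exact Finset.sum_congr rfl fun i _ => ENNReal.coe_toNNReal (ν.apply_ne_top i)
  rw [hνsum, one_mul] at key
  refine le_trans (le_of_eq ?_) key
  rw [lintegral_fintype, Fintype.sum_prod_type]
  refine Finset.sum_congr rfl fun i _ => ?_
  rw [ENNReal.coe_toNNReal (ν.apply_ne_top i), div_eq_mul_inv, Finset.sum_mul, Finset.mul_sum]
  refine Finset.sum_congr rfl fun u _ => ?_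
  have hηs : η {(i, u)} = ν i * (K : ℝ≥0∞)⁻¹ := by
    rw [hη, ← Set.singleton_prod_singleton, Measure.prod_prod,
      PMF.toMeasure_apply_singleton _ _ (measurableSet_singleton _),
      PMF.toMeasure_apply_singleton _ _ (measurableSet_singleton _)]
    simp
  rw [hηs]
  by_cases h0 : ν i = 0
  · simp [h0]
  -- A context of positive probability together with any seed is an atom, so an almost sure
  -- statement holds there and no replacement has taken place.
  · have hgood : good u i := by
      have h1 := (ae_iff_of_countable.1 hx) (i, u) (by
        rw [hηs]
        exact mul_ne_zero h0 (by simp))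
      exact h1
    simp only [μ, hgood, if_true]
    ring

theorem past_le {Ω : Type*} [mΩ : MeasurableSpace Ω] {u : ℕ → Ω → Fin K} {i : ℕ → Ω → Fin S}
    {y : ℕ → Ω → ℝ} (hu : ∀ t, Measurable (u t)) (hi : ∀ t, Measurable (i t))
    (hy : ∀ t, Measurable (y t)) (t : ℕ) : past u i y t ≤ mΩ :=
  iSup_le fun s => Measurable.comap_le (((hu s).prodMk ((hi s).prodMk (hy s))))

theorem past_mono {Ω : Type*} (u : ℕ → Ω → Fin K) (i : ℕ → Ω → Fin S)
    (y : ℕ → Ω → ℝ) (t : ℕ) : past u i y t ≤ past u i y (t + 1) :=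
  iSup_le fun s => le_iSup_of_le (f := fun s : Fin (t + 1) =>
    MeasurableSpace.comap (fun x => (u s x, i s x, y s x)) inferInstance) s.castSucc le_rfl

theorem measurable_obs_past {Ω : Type*} (u : ℕ → Ω → Fin K) (i : ℕ → Ω → Fin S)
    (y : ℕ → Ω → ℝ) (t : ℕ) :
    Measurable[past u i y (t + 1)] fun x => (u t x, i t x, y t x) := by
  refine Measurable.mono (comap_measurable _) ?_ le_rfl
  exact le_iSup_of_le (f := fun s : Fin (t + 1) =>
    MeasurableSpace.comap (fun x => (u s x, i s x, y s x)) inferInstance) (Fin.last t) le_rfl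

/-- Induction on the certificate, for the part of the program that starts in round `t` with a
parameter determined by the past. The event `B` of the past is there for `Cert.cases`. The agreement
of the actions with those of `alg` is needed because the noise is defined through `alg`. Bad results
need not form a measurable set, hence the covering event `E`. -/
theorem Cert.sound [NeZero K] {Ω : Type*} [mΩ : MeasurableSpace Ω] {P : Measure Ω}
    [IsProbabilityMeasure P] {ν : PMF (Fin S)} {α₀ : Type} {alg : Prog S K α₀}
    {u : ℕ → Ω → Fin K} {i : ℕ → Ω → Fin S} {y : ℕ → Ω → ℝ}
    (hI : IsInteraction P A ν alg u i y) {α β : Type} [MeasurableSpace α] [MeasurableSpace β]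
    {Post : β → α → Prop} {M : ℕ} {Q : Set β} {p : β → Prog S K α} {v : β → ℝ≥0∞}
    (h : Cert A (fun i => (ν i).toNNReal) Post M Q p v) :
    ∀ (t : ℕ) (b : Ω → β), Measurable[past u i y t] b → ∀ B : Set Ω,
      MeasurableSet[past u i y t] B → (∀ x ∈ B, b x ∈ Q) →
      (∀ x ∈ B, ∀ s j, (p (b x)).actionAt (fun k => path u i y x (t + k)) s = some j →
        alg.actionAt (path u i y x) (t + s) = some j) →
      ∃ E, MeasurableSet E ∧ (∀ x ∈ B,
        ¬ Post (b x) ((p (b x)).result fun k => path u i y x (t + k)) → x ∈ E) ∧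
        P E ≤ ∫⁻ x in B, v (b x) ∂P := by
  have hpast := past_le hI.measurable_seed hI.measurable_ctx hI.measurable_reward
  have markov : ∀ {β : Type} [MeasurableSpace β] {v : β → ℝ≥0∞} (hv : Measurable v) (t : ℕ)
      (b : Ω → β) (_ : Measurable[past u i y t] b) (B : Set Ω) (_ : MeasurableSet[past u i y t] B),
      MeasurableSet ({x | 1 ≤ v (b x)} ∩ B) ∧
        P ({x | 1 ≤ v (b x)} ∩ B) ≤ ∫⁻ x in B, v (b x) ∂P := by
    intro β _ v hv t b hb B hB
    have hb' := hb.mono (hpast t) le_rfl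
    have hms : MeasurableSet {x | 1 ≤ v (b x)} := measurableSet_le measurable_const (hv.comp hb')
    refine ⟨hms.inter (hpast t _ hB), ?_⟩
    rw [← Measure.restrict_apply hms]
    simpa using mul_meas_ge_le_lintegral (μ := P.restrict B) (hv.comp hb') 1
  induction h with
  | @done β _ Post M Q p v hv a ha hp hF =>
    intro t b hb B hB hQ hcons
    refine ⟨_, (markov hv t b hb B hB).1, fun x hx hbad => ⟨?_, hx⟩, (markov hv t b hb B hB).2⟩
    rw [hp _ (hQ x hx)] at hbad
    exact (hF _ (hQ x hx)).resolve_left hbad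
  | @fail β _ Post M Q p v hv hF =>
    intro t b hb B hB hQ hcons
    exact ⟨_, (markov hv t b hb B hB).1, fun x hx hbad => ⟨hF _ (hQ x hx), hx⟩,
      (markov hv t b hb B hB).2⟩
  | @round β _ Post M Q p v hv act hact next G hp hn hs ih =>
    intro t b hb B hB hQ hcons
    have hact' : ∀ x ∈ B, alg.actionAt (path u i y x) t = some (act (b x) (u t x) (i t x)) := by
      intro x hx
      refine hcons x hx 0 _ ?_
      rw [hp _ (hQ x hx)]
      rfl
    have hstep := setLIntegral_le_of_stepLE (hpast t) (hI.measurable_seed t) (hI.measurable_ctx t)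
      (hI.measurable_reward t) (hI.law t) (hI.indep t) hb hB hact (A := A) (v := v)
      (G := G) ?_ hn.measurable (fun x hx => hs _ (hQ x hx))
    · obtain ⟨E, hE, hbad, hPE⟩ := ih (t + 1) (fun x => (b x, u t x, i t x, y t x))
        ((hb.mono (past_mono u i y t) le_rfl).prodMk (measurable_obs_past u i y t)) B
        (past_mono u i y t _ hB) hQ (by
          intro x hx s j hj
          have := hcons x hx (s + 1) j
          rw [hp _ (hQ x hx)] at this
          rw [add_assoc, add_comm 1 s]
          refine this ?_
          rw [← hj]
          simp only [Prog.actionAt]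
          have e : (fun k => path u i y x (t + (k + 1))) = fun k => path u i y x (t + 1 + k) := by
            funext k; congr 1; omega
          rw [e]
          rfl)
      refine ⟨E, hE, fun x hx hx' => hbad x hx ?_, hPE.trans hstep⟩
      intro hgood
      refine hx' ?_
      rw [hp _ (hQ x hx)]
      simp only [Prog.result]
      have e : (fun k => path u i y x (t + (k + 1))) = fun k => path u i y x (t + 1 + k) := by
        funext k; congr 1; omega
      rw [e]
      exact hgood
    · intro c D hD hDB
      have hpres : present u i y t ≤ mΩ := sup_le (hpast t) (Measurable.comap_le
        ((hI.measurable_ctx t).prodMk (hI.measurable_seed t)))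
      have hD' : MeasurableSet D := hpres _ hD
      have hint := hI.integrable_exp t c
      have h1 : ∫ x in D, Real.exp (c * noise A alg u i y t x) ∂P ≤
          Real.exp (c ^ 2 / 2) * P.real D := by
        rw [← setIntegral_condExp hpres hint hD]
        refine (setIntegral_mono_ae integrable_condExp.integrableOn
          (integrableOn_const (by finiteness) (by simp)) (hI.subgaussian t c)).trans ?_
        simp [mul_comm]
      -- On `B` the learner plays the action of the certificate, so the noise is the reward minus
      -- the mean used in `StepLE`.
      have h2 : ∫⁻ x in D, ENNReal.ofReal (Real.exp (c * (y t x - A (i t x)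
          (act (b x) (u t x) (i t x))))) ∂P =
          ∫⁻ x in D, ENNReal.ofReal (Real.exp (c * noise A alg u i y t x)) ∂P := by
        refine setLIntegral_congr_fun hD' fun x hx => ?_
        simp only [noise, hact' x (hDB hx)]
      rw [h2, ← ofReal_integral_eq_lintegral_ofReal hint.integrableOn
        (Filter.Eventually.of_forall fun x => (Real.exp_pos _).le)]
      refine (ENNReal.ofReal_le_ofReal h1).trans ?_
      rw [ENNReal.ofReal_mul (Real.exp_pos _).le, ofReal_measureReal]
  | @cases β _ Post M Q p v D _ _ _ hv g hg hc ih =>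
    intro t b hb B hB hQ hcons
    have hgb : Measurable[past u i y t] fun x => g (b x) := hg.comp hb
    have hBd : ∀ d, MeasurableSet[past u i y t] (B ∩ (fun x => g (b x)) ⁻¹' {d}) := fun d =>
      MeasurableSet.inter hB (hgb (measurableSet_singleton d))
    choose E hE hbad hPE using fun d => ih d t b hb _ (hBd d)
      (fun x hx => ⟨hQ x hx.1, hx.2⟩) (fun x hx => hcons x hx.1)
    refine ⟨⋃ d, E d, MeasurableSet.iUnion hE, fun x hx hx' =>
      Set.mem_iUnion.2 ⟨g (b x), hbad _ x ⟨hx, rfl⟩ hx'⟩, ?_⟩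
    refine (measure_iUnion_le _).trans ((ENNReal.tsum_le_tsum hPE).trans (le_of_eq ?_))
    rw [← lintegral_iUnion (fun d => hpast t _ (hBd d))]
    · congr 2
      rw [← Set.inter_iUnion, ← Set.preimage_iUnion, Set.iUnion_of_singleton, Set.preimage_univ,
        Set.inter_univ]
    · intro d d' hdd
      rw [Function.onFun, Set.disjoint_left]
      rintro x ⟨-, h1⟩ ⟨-, h2⟩
      exact hdd (h1.symm.trans h2)

/-- A certificate for a learner without parameters bounds the probability of a bad result. -/
theorem Cert.measure_le [NeZero K] {Ω : Type*} [mΩ : MeasurableSpace Ω] {P : Measure Ω}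
    [IsProbabilityMeasure P] {ν : PMF (Fin S)} {α : Type} [MeasurableSpace α] {alg : Prog S K α}
    {u : ℕ → Ω → Fin K} {i : ℕ → Ω → Fin S} {y : ℕ → Ω → ℝ}
    (hI : IsInteraction P A ν alg u i y)
    {Post : α → Prop} {M : ℕ} {w : ℝ≥0∞}
    (h : Cert A (fun i => (ν i).toNNReal) (fun _ => Post) M Set.univ (fun _ : Unit => alg)
      fun _ => w) :
    ∃ E, MeasurableSet E ∧ (∀ x, ¬ Post (alg.result (path u i y x)) → x ∈ E) ∧ P E ≤ w := by
  obtain ⟨E, hE, hbad, hPE⟩ := h.sound hI 0 (fun _ => ()) (@measurable_const _ _ _ (_) _) Set.univ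
    (@MeasurableSet.univ _ (_)) (fun _ _ => trivial) (by simp)
  exact ⟨E, hE, fun x hx => hbad x trivial (by simpa using hx), by simpa using hPE⟩

end Soundness

end LumpableBandit

namespace LumpableBandit

open scoped ENNReal NNReal

/-! ### Measurability of the algorithms -/

section Measurability

variable {S K : ℕ}

instance : MeasurableSpace (Finset (Fin K)) := ⊤
instance : DiscreteMeasurableSpace (Finset (Fin K)) := ⟨fun _ => trivial⟩
instance : MeasurableSpace (Finset (Fin S × Fin K)) := ⊤
instance : DiscreteMeasurableSpace (Finset (Fin S × Fin K)) := ⟨fun _ => trivial⟩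
instance : MeasurableSpace (Option (Fin K)) := ⊤
instance : DiscreteMeasurableSpace (Option (Fin K)) := ⟨fun _ => trivial⟩
instance : MeasurableSpace (Option (Fin S → Fin K)) := ⊤
instance : DiscreteMeasurableSpace (Option (Fin S → Fin K)) := ⟨fun _ => trivial⟩

/-- A family of measurable functions with a countable measurable index is measurable. -/
theorem measurable_of_cases {β γ D : Type*} [MeasurableSpace β] [MeasurableSpace γ] [Countable D]
    [MeasurableSpace D] [DiscreteMeasurableSpace D] {g : β → D} (hg : Measurable g)
    {f : D → β → γ} (hf : ∀ d, Measurable (f d)) : Measurable fun b => f (g b) b := by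
  have : Measurable fun z : D × β => f z.1 z.2 := measurable_from_prod_countable_right hf
  exact this.comp (hg.prodMk measurable_id)

theorem argmaxOn_mem {β : Type} (D : Finset β) (hD : D.Nonempty) (f : β → ℝ) :
    argmaxOn D hD f ∈ D :=
  (Classical.choose_spec (p := fun x => x ∈ D ∧ ∀ z ∈ D, f z ≤ f x) (D.exists_max_image f hD)).1

theorem le_argmaxOn {β : Type} (D : Finset β) (hD : D.Nonempty) (f : β → ℝ) {z : β} (hz : z ∈ D) :
    f z ≤ f (argmaxOn D hD f) :=
  (Classical.choose_spec (p := fun x => x ∈ D ∧ ∀ z ∈ D, f z ≤ f x) (D.exists_max_image f hD)).2 z hz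

/-- The maximizer is chosen, hence has no formula. But it depends on `f` only through the predicate
of being a maximizer, which takes finitely many values and is measurable in `f`. -/
theorem measurable_argmaxOn {β : Type} [Finite β] [MeasurableSpace β] [DiscreteMeasurableSpace β]
    (D : Finset β) (hD : D.Nonempty) : Measurable (argmaxOn D hD) := by
  have : Measurable fun (f : β → ℝ) (x : β) => x ∈ D ∧ ∀ z ∈ D, f z ≤ f x := by
    refine measurable_pi_lambda _ fun x => measurableSet_setOfPred.1 ?_
    have : {f : β → ℝ | x ∈ D ∧ ∀ z ∈ D, f z ≤ f x} =
        {_f | x ∈ D} ∩ ⋂ z, ⋂ _ : z ∈ D, {f | f z ≤ f x} := by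
      ext f; simp
    rw [this]
    exact (MeasurableSet.const _).inter (MeasurableSet.iInter fun z => MeasurableSet.iInter fun _ =>
      measurableSet_le (measurable_pi_apply z) (measurable_pi_apply x))
  classical
  have hc : ∀ f : β → ℝ, ∃ x, x ∈ D ∧ ∀ z ∈ D, f z ≤ f x := fun f => by
    obtain ⟨x, hx⟩ := D.exists_max_image f hD
    exact ⟨x, hx⟩
  have h2 : argmaxOn D hD = (fun q : β → Prop => if h : ∃ x, q x then Classical.choose h else
      argmaxOn D hD fun _ => 0) ∘ fun (f : β → ℝ) (x : β) => x ∈ D ∧ ∀ z ∈ D, f z ≤ f x := by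
    funext f
    simp only [Function.comp, dif_pos (hc f)]
    rfl
  rw [h2]
  exact (measurable_of_countable _).comp this

instance : MeasurableSpace (CollectState S K) :=
  MeasurableSpace.comap (fun st => (st.psi, st.visits, st.num, st.sum, st.pairs, st.est))
    inferInstance

theorem measurable_collectState_iff {β : Type*} [MeasurableSpace β] {f : β → CollectState S K} :
    Measurable f ↔ Measurable fun b => ((f b).psi, (f b).visits, (f b).num, (f b).sum, (f b).pairs,
      (f b).est) :=
  measurable_comap_iff

theorem CollectState.measurable_tuple : Measurable fun st : CollectState S K =>
    (st.psi, st.visits, st.num, st.sum, st.pairs, st.est) := comap_measurable _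

@[fun_prop]
theorem CollectState.measurable_psi : Measurable (CollectState.psi (S := S) (K := K)) :=
  measurable_fst.comp CollectState.measurable_tuple

@[fun_prop]
theorem CollectState.measurable_visits : Measurable (CollectState.visits (S := S) (K := K)) :=
  (measurable_fst.comp measurable_snd).comp CollectState.measurable_tuple

@[fun_prop]
theorem CollectState.measurable_num : Measurable (CollectState.num (S := S) (K := K)) :=
  (measurable_fst.comp (measurable_snd.comp measurable_snd)).comp CollectState.measurable_tuple

@[fun_prop]
theorem CollectState.measurable_sum : Measurable (CollectState.sum (S := S) (K := K)) :=
  (measurable_fst.comp (measurable_snd.comp (measurable_snd.comp measurable_snd))).comp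
    CollectState.measurable_tuple

@[fun_prop]
theorem CollectState.measurable_pairs : Measurable (CollectState.pairs (S := S) (K := K)) :=
  (measurable_fst.comp (measurable_snd.comp (measurable_snd.comp
    (measurable_snd.comp measurable_snd)))).comp CollectState.measurable_tuple

@[fun_prop]
theorem CollectState.measurable_est : Measurable (CollectState.est (S := S) (K := K)) :=
  (measurable_snd.comp (measurable_snd.comp (measurable_snd.comp
    (measurable_snd.comp measurable_snd)))).comp CollectState.measurable_tuple

theorem measurable_function_update {β ι γ : Type*} [MeasurableSpace β] [MeasurableSpace γ]
    [DecidableEq ι] {f : β → ι → γ} (hf : Measurable f) (e : ι) {x : β → γ} (hx : Measurable x) :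
    Measurable fun b => Function.update (f b) e (x b) := by
  refine measurable_pi_lambda _ fun e' => ?_
  by_cases h : e' = e
  · subst h; simpa using hx
  · simp only [Function.update_of_ne h]
    exact (measurable_pi_apply e').comp hf

theorem CollectState.measurable_update (n : ℕ) (i : Fin S) (j : Fin K) :
    Measurable fun z : CollectState S K × ℝ => z.1.update n i j z.2 := by
  have hv : Measurable fun z : CollectState S K × ℝ =>
      Function.update z.1.visits i (z.1.visits i + 1) :=
    measurable_function_update (by fun_prop) _ (by fun_prop)
  have hn : Measurable fun z : CollectState S K × ℝ =>
      Function.update z.1.num (i, j) (z.1.num (i, j) + 1) :=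
    measurable_function_update (by fun_prop) _ (by fun_prop)
  have hs : Measurable fun z : CollectState S K × ℝ =>
      Function.update z.1.sum (i, j) (z.1.sum (i, j) + z.2) :=
    measurable_function_update (by fun_prop) _ (by fun_prop)
  have hset : MeasurableSet {z : CollectState S K × ℝ |
      Function.update z.1.visits i (z.1.visits i + 1) i % 2 ^ n = 0} := by
    have h1 : Measurable fun z : CollectState S K × ℝ =>
      Function.update z.1.visits i (z.1.visits i + 1) i := (measurable_pi_apply i).comp hv
    exact h1 (MeasurableSet.of_discrete (s := {k : ℕ | k % 2 ^ n = 0}))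
  refine Measurable.ite hset ?_ ?_
  · refine measurable_collectState_iff.2 (Measurable.prodMk ?_ (hv.prodMk (hn.prodMk (hs.prodMk
      (Measurable.prodMk ?_ ?_)))))
    · exact measurable_function_update (by fun_prop) _ (by fun_prop)
    · exact (measurable_of_countable fun D : Finset (Fin S × Fin K) => insert (i, j) D).comp
        ((CollectState.measurable_pairs).comp measurable_fst)
    · refine measurable_function_update (by fun_prop) _ ?_
      have h1 : Measurable fun z : CollectState S K × ℝ =>
          Function.update z.1.sum (i, j) (z.1.sum (i, j) + z.2) (i, j) :=
        (measurable_pi_apply (i, j)).comp hs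
      have h2 : Measurable fun z : CollectState S K × ℝ =>
          ((Function.update z.1.num (i, j) (z.1.num (i, j) + 1) (i, j) : ℕ) : ℝ) :=
        (measurable_of_countable (fun k : ℕ => (k : ℝ))).comp ((measurable_pi_apply (i, j)).comp hn)
      exact h1.div h2
  · refine measurable_collectState_iff.2 (Measurable.prodMk ?_ (hv.prodMk (hn.prodMk (hs.prodMk
      (Measurable.prodMk ?_ ?_)))))
    · exact measurable_function_update (by fun_prop) _ (by fun_prop)
    · fun_prop
    · fun_prop

theorem CollectState.measurable_arm (𝒦 : Option (Fin K)) (u : Fin K) (i : Fin S) :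
    Measurable fun st : CollectState S K => st.arm 𝒦 u i := by
  have h1 : Measurable fun st : CollectState S K => st.psi i := by fun_prop
  exact (measurable_of_countable fun o : Option (Fin K) => o.getD (drawFrom 𝒦 u)).comp h1

theorem CollectState.measurable_step (n : ℕ) (𝒦 : Option (Fin K)) :
    Measurable fun z : CollectState S K × Fin K × Fin S × ℝ =>
      z.1.update n z.2.2.1 (z.1.arm 𝒦 z.2.1 z.2.2.1) z.2.2.2 := by
  have hg : Measurable fun z : CollectState S K × Fin K × Fin S × ℝ =>
      (z.2.2.1, z.1.arm 𝒦 z.2.1 z.2.2.1) := by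
    refine Measurable.prodMk (by fun_prop) ?_
    refine measurable_of_cases (D := Fin K × Fin S) (g := fun z => (z.2.1, z.2.2.1)) (by fun_prop)
      (f := fun d (z : CollectState S K × Fin K × Fin S × ℝ) => z.1.arm 𝒦 d.1 d.2) fun d => ?_
    exact (CollectState.measurable_arm 𝒦 d.1 d.2).comp measurable_fst
  refine measurable_of_cases hg
    (f := fun d (z : CollectState S K × Fin K × Fin S × ℝ) => z.1.update n d.1 d.2 z.2.2.2)
    fun d => ?_
  exact (CollectState.measurable_update n d.1 d.2).comp
    (measurable_fst.prodMk (measurable_snd.comp (measurable_snd.comp measurable_snd)))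

end Measurability

end LumpableBandit

namespace LumpableBandit

open scoped ENNReal NNReal

/-! ### Potentials -/

section Potentials

variable {S K : ℕ} {A : Fin S → Fin K → ℝ} {ρ : Fin S → ℝ≥0}

/-- Counting the visits of a context exponentially. -/
theorem stepLE_visit [NeZero K] (act : Fin K → Fin S → Fin K) {i₀ : Fin S} {f p : ℝ} (hf : 0 ≤ f)
    (h : (f - 1) * ((ρ i₀ : ℝ) - p * ∑ i, (ρ i : ℝ)) ≤ 0) (x : ℝ≥0∞) :
    StepLE A ρ act (fun _ i _ => if i = i₀ then ENNReal.ofReal f * x else x)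
      (ENNReal.ofReal (1 + p * (f - 1)) * x) := by
  refine StepLE.of_ctx ?_
  have e1 : ∑ i, (ρ i : ℝ≥0∞) * (if i = i₀ then ENNReal.ofReal f * x else x) =
      (∑ i, (ρ i : ℝ≥0∞) * (ENNReal.ofReal (if i = i₀ then f else 1))) * x := by
    rw [Finset.sum_mul]
    refine Finset.sum_congr rfl fun i _ => ?_
    split_ifs
    · ring
    · simp
  have e2 : ∑ i, (ρ i : ℝ≥0∞) * (ENNReal.ofReal (if i = i₀ then f else 1)) =
      ENNReal.ofReal (∑ i, (ρ i : ℝ) * (if i = i₀ then f else 1)) := by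
    rw [ENNReal.ofReal_sum_of_nonneg fun i _ => mul_nonneg (ρ i).coe_nonneg (by split_ifs <;> simp [hf])]
    refine Finset.sum_congr rfl fun i _ => ?_
    rw [ENNReal.ofReal_mul (ρ i).coe_nonneg, ENNReal.ofReal_coe_nnreal]
  have e3 : ∑ i, (ρ i : ℝ≥0∞) = ENNReal.ofReal (∑ i, (ρ i : ℝ)) := by
    rw [ENNReal.ofReal_sum_of_nonneg fun i _ => (ρ i).coe_nonneg]
    exact Finset.sum_congr rfl fun i _ => ENNReal.ofReal_coe_nnreal.symm
  rw [e1, e2, e3, ← mul_assoc, ← ENNReal.ofReal_mul (Finset.sum_nonneg fun i _ => (ρ i).coe_nonneg)]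
  gcongr
  have : ∑ i, (ρ i : ℝ) * (if i = i₀ then f else 1) = ∑ i, (ρ i : ℝ) + ρ i₀ * (f - 1) := by
    have : ∀ i, (ρ i : ℝ) * (if i = i₀ then f else 1) =
        ρ i + if i = i₀ then (ρ i₀ : ℝ) * (f - 1) else 0 := fun i => by
      split_ifs with h
      · subst h; ring
      · ring
    simp [this, Finset.sum_add_distrib]
  rw [this]
  linarith

/-- The potential of few visits. -/
noncomputable def visitPot (M q : ℝ) (T : ℕ) (k : ℕ) : ℝ≥0∞ :=
  ENNReal.ofReal (Real.exp (M - k) * q ^ T)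

/-- The decay factor of `visitPot` for a context of relative weight at least `p`. -/
noncomputable def decay (p : ℝ) : ℝ := 1 + p * (Real.exp (-1) - 1)

theorem exp_neg_one_le : Real.exp (-1) ≤ 1 / 2 := by
  rw [Real.exp_neg, one_div]
  exact inv_anti₀ (by norm_num) (by linarith [Real.add_one_le_exp (1 : ℝ)])

theorem decay_pos {p : ℝ} (hp : p ≤ 1) : 0 < decay p := by
  have h1 := exp_neg_one_le
  have h2 := Real.exp_pos (-1)
  unfold decay
  nlinarith

/-- Since `exp (-1) ≤ 1 / 2`, the factor is at most `1 - p / 2`. -/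
theorem decay_le {p : ℝ} (hp : 0 ≤ p) : decay p ≤ Real.exp (-(p / 2)) := by
  have h1 := exp_neg_one_le
  have := Real.add_one_le_exp (-(p / 2))
  unfold decay
  nlinarith

theorem decay_pow_le {p : ℝ} (hp : 0 ≤ p) (hp1 : p ≤ 1) (T : ℕ) :
    decay p ^ T ≤ Real.exp (-(p * T / 2)) := by
  calc decay p ^ T ≤ Real.exp (-(p / 2)) ^ T := by
        gcongr
        · exact (decay_pos hp1).le
        · exact decay_le hp
    _ = _ := by rw [← Real.exp_nat_mul]; ring_nf

theorem one_le_visitPot {M q : ℝ} {k : ℕ} (h : k ≤ M) : 1 ≤ visitPot M q 0 k := by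
  unfold visitPot
  rw [pow_zero, mul_one, ENNReal.one_le_ofReal]
  exact Real.one_le_exp (by linarith)

/-- A visit of `i₀` multiplies the potential by `exp (-1)`, so a round multiplies it on average by
at most `decay p`. This is Chernoff's bound for the number of visits, one round at a time. -/
theorem stepLE_visitPot [NeZero K] (act : Fin K → Fin S → Fin K) {i₀ : Fin S} {p : ℝ}
    (hp1 : p ≤ 1) (h : p * ∑ i, (ρ i : ℝ) ≤ ρ i₀) (M : ℝ) (T k : ℕ)
    (k' : Fin K → Fin S → ℕ) (hk : ∀ u i, k' u i = if i = i₀ then k + 1 else k) :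
    StepLE A ρ act (fun u i _ => visitPot M (decay p) T (k' u i))
      (visitPot M (decay p) (T + 1) k) := by
  have hd := decay_pos hp1
  refine (stepLE_visit act (Real.exp_pos (-1)).le ?_ (visitPot M (decay p) T k) (i₀ := i₀)
    (p := p)).mono (fun u i y _ => ?_) ?_
  · have := exp_neg_one_le
    nlinarith
  · rw [hk]
    split_ifs
    · unfold visitPot
      rw [← ENNReal.ofReal_mul (Real.exp_pos _).le, ← mul_assoc, ← Real.exp_add]
      push_cast
      ring_nf
      rfl
    · rfl
  · unfold visitPot
    rw [← ENNReal.ofReal_mul]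
    · refine ENNReal.ofReal_le_ofReal (le_of_eq ?_)
      simp only [decay]
      ring
    · exact hd.le

/-- The potential of a large deviation of the rewards of the pair `e`. -/
noncomputable def noisePot (A : Fin S → Fin K → ℝ) (c κ : ℝ) (num : Fin S × Fin K → ℕ)
    (sum : Fin S × Fin K → ℝ) (e : Fin S × Fin K) : ℝ≥0∞ :=
  ENNReal.ofReal (Real.exp (c * (sum e - A e.1 e.2 * num e) - c ^ 2 / 2 * num e - κ))

/-- Only a play of the pair `e` changes the potential, and then by a factor `exp (c * η - c ^ 2 /
2)` for noise `η`, whose mean is at most `1`. -/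
theorem stepLE_noisePot (act : Fin K → Fin S → Fin K) (c κ : ℝ) (num : Fin S × Fin K → ℕ)
    (sum : Fin S × Fin K → ℝ) (e : Fin S × Fin K) :
    StepLE A ρ act (fun u i y => noisePot A c κ
      (Function.update num (i, act u i) (num (i, act u i) + 1))
      (Function.update sum (i, act u i) (sum (i, act u i) + y)) e) (noisePot A c κ num sum e) := by
  refine StepLE.of_forall fun u i _ μ hμ hs => ?_
  by_cases h : e = (i, act u i)
  · subst h
    have : ∀ y, noisePot A c κ (Function.update num (i, act u i) (num (i, act u i) + 1))
        (Function.update sum (i, act u i) (sum (i, act u i) + y)) (i, act u i) =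
        noisePot A c κ num sum (i, act u i) * ENNReal.ofReal (Real.exp (-(c ^ 2 / 2))) *
          ENNReal.ofReal (Real.exp (c * (y - A i (act u i)))) := by
      intro y
      simp only [noisePot, Function.update_self]
      rw [← ENNReal.ofReal_mul (Real.exp_pos _).le, ← Real.exp_add,
        ← ENNReal.ofReal_mul (Real.exp_pos _).le, ← Real.exp_add]
      push_cast
      ring_nf
    simp_rw [this]
    rw [lintegral_const_mul _ (by fun_prop)]
    calc _ ≤ noisePot A c κ num sum (i, act u i) * ENNReal.ofReal (Real.exp (-(c ^ 2 / 2))) *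
          ENNReal.ofReal (Real.exp (c ^ 2 / 2)) := by gcongr; exact hs c
      _ = _ := by
        rw [mul_assoc, ← ENNReal.ofReal_mul (Real.exp_pos _).le, ← Real.exp_add]
        simp
  · have : ∀ y, noisePot A c κ (Function.update num (i, act u i) (num (i, act u i) + 1))
        (Function.update sum (i, act u i) (sum (i, act u i) + y)) e = noisePot A c κ num sum e := by
      intro y
      simp only [noisePot, Function.update_of_ne h]
    simp [this]

/-- Both potentials of the deviation of the empirical mean of the pair `e` by `w`. -/
noncomputable def devPot (A : Fin S → Fin K → ℝ) (w κ : ℝ) (num : Fin S × Fin K → ℕ)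
    (sum : Fin S × Fin K → ℝ) (e : Fin S × Fin K) : ℝ≥0∞ :=
  noisePot A w κ num sum e + noisePot A (-w) κ num sum e

theorem devPot_zero (w κ : ℝ) (e : Fin S × Fin K) :
    devPot A w κ (fun _ => 0) (fun _ => 0) e = ENNReal.ofReal (2 * Real.exp (-κ)) := by
  unfold devPot noisePot
  rw [← ENNReal.ofReal_add (Real.exp_pos _).le (Real.exp_pos _).le]
  congr 1
  simp
  ring

theorem measurable_noisePot {β : Type*} [MeasurableSpace β] (c κ : ℝ)
    {num : β → Fin S × Fin K → ℕ} {sum : β → Fin S × Fin K → ℝ} (hn : Measurable num)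
    (hs : Measurable sum) (e : Fin S × Fin K) :
    Measurable fun b => noisePot A c κ (num b) (sum b) e := by
  unfold noisePot
  have h1 : Measurable fun b => ((num b e : ℕ) : ℝ) :=
    (measurable_of_countable (fun k : ℕ => (k : ℝ))).comp ((measurable_pi_apply e).comp hn)
  have h2 : Measurable fun b => sum b e := (measurable_pi_apply e).comp hs
  fun_prop

theorem measurable_devPot {β : Type*} [MeasurableSpace β] (c κ : ℝ)
    {num : β → Fin S × Fin K → ℕ} {sum : β → Fin S × Fin K → ℝ} (hn : Measurable num)
    (hs : Measurable sum) (e : Fin S × Fin K) :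
    Measurable fun b => devPot A c κ (num b) (sum b) e :=
  (measurable_noisePot c κ hn hs e).add (measurable_noisePot (-c) κ hn hs e)

theorem stepLE_devPot (act : Fin K → Fin S → Fin K) (w κ : ℝ) (num : Fin S × Fin K → ℕ)
    (sum : Fin S × Fin K → ℝ) (e : Fin S × Fin K) :
    StepLE A ρ act (fun u i y => devPot A w κ
      (Function.update num (i, act u i) (num (i, act u i) + 1))
      (Function.update sum (i, act u i) (sum (i, act u i) + y)) e) (devPot A w κ num sum e) :=
  StepLE.add (stepLE_noisePot act w κ num sum e) (stepLE_noisePot act (-w) κ num sum e) fun u i =>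
    measurable_noisePot _ _ measurable_const
      (measurable_function_update measurable_const _ (by fun_prop)) _

/-- If the empirical mean deviates by `w` from the mean after at least `n₀` plays, then the
potential is large. -/
theorem abs_sub_lt_or_one_le_devPot {w κ n₀ : ℝ} (hw : 0 < w) (hκ : κ ≤ n₀ * (w ^ 2 / 2))
    (hn₀ : 0 < n₀) {num : Fin S × Fin K → ℕ} {sum : Fin S × Fin K → ℝ} {e : Fin S × Fin K}
    (hn : n₀ ≤ num e) : |sum e / num e - A e.1 e.2| < w ∨ 1 ≤ devPot A w κ num sum e := by
  have hpos : (0 : ℝ) < num e := hn₀.trans_le hn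
  have hκ' : κ ≤ num e * (w ^ 2 / 2) := hκ.trans (by gcongr)
  have hs : sum e = sum e / num e * num e := by field_simp
  by_contra hcon
  push Not at hcon
  obtain ⟨h1, h2⟩ := hcon
  refine absurd h2 (not_lt.2 ?_)
  rcases le_abs.1 h1 with h | h
  · refine le_trans ?_ (le_self_add : _ ≤ noisePot A w κ num sum e + _)
    unfold noisePot
    rw [ENNReal.one_le_ofReal]
    refine Real.one_le_exp ?_
    -- With the tilt `c = w` the exponent is at least `num e * w ^ 2 / 2 - κ`, which is nonnegative
    -- by `hκ'`.
    have : w * num e ≤ sum e - A e.1 e.2 * num e := by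
      calc w * num e ≤ (sum e / num e - A e.1 e.2) * num e := by gcongr
        _ = _ := by rw [sub_mul, ← hs]
    nlinarith
  · refine le_trans ?_ (le_add_self : noisePot A (-w) κ num sum e ≤ _)
    unfold noisePot
    rw [ENNReal.one_le_ofReal]
    refine Real.one_le_exp ?_
    have : w * num e ≤ -(sum e - A e.1 e.2 * num e) := by
      calc w * num e ≤ (-(sum e / num e - A e.1 e.2)) * num e := by gcongr
        _ = _ := by rw [neg_mul, sub_mul, ← hs]
    nlinarith

end Potentials

end LumpableBandit

namespace LumpableBandit

open scoped ENNReal NNReal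

/-! ### Data collection -/

section Collect

variable {S K : ℕ} {A : Fin S → Fin K → ℝ} {ρ : Fin S → ℝ≥0}

namespace CollectState

variable (st : CollectState S K) (n : ℕ) (i : Fin S) (j : Fin K) (y : ℝ)

theorem update_visits : (st.update n i j y).visits = Function.update st.visits i (st.visits i + 1) := by
  unfold update; dsimp only; split_ifs <;> rfl

theorem update_num :
    (st.update n i j y).num = Function.update st.num (i, j) (st.num (i, j) + 1) := by
  unfold update; dsimp only; split_ifs <;> rfl

theorem update_sum :
    (st.update n i j y).sum = Function.update st.sum (i, j) (st.sum (i, j) + y) := by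
  unfold update; dsimp only; split_ifs <;> rfl

theorem update_psi : (st.update n i j y).psi =
    Function.update st.psi i (if (st.visits i + 1) % 2 ^ n = 0 then none else some j) := by
  unfold update; dsimp only; rw [Function.update_self]; split_ifs <;> rfl

theorem update_pairs : (st.update n i j y).pairs =
    if (st.visits i + 1) % 2 ^ n = 0 then insert (i, j) st.pairs else st.pairs := by
  unfold update; dsimp only; rw [Function.update_self]; split_ifs <;> rfl

theorem update_est : (st.update n i j y).est =
    if (st.visits i + 1) % 2 ^ n = 0 then Function.update st.est (i, j)
      ((st.update n i j y).sum (i, j) / (st.update n i j y).num (i, j)) else st.est := by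
  unfold update; dsimp only; rw [Function.update_self]; split_ifs <;> rfl

end CollectState

open Classical in
/-- The potential of the event that no context of `grp` is assigned the arm `j` in one of its first
`m` blocks. -/
noncomputable def couponPot (n m : ℕ) (grp : Finset (Fin S)) (j : Fin K) (st : CollectState S K) :
    ℝ≥0∞ :=
  -- The potential vanishes once the arm has been drawn in time, even if its block is still running.
  -- Otherwise the exponent counts the draws to come: the quotient rounds up, so it is the number of
  -- blocks already begun.
  if ∃ i ∈ grp, (i, j) ∈ st.pairs ∨ (st.psi i = some j ∧ st.visits i < m * 2 ^ n) then 0 else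
    ENNReal.ofReal ((1 - 1 / (K : ℝ)) ^ ∑ i ∈ grp, (m - (st.visits i + (2 ^ n - 1)) / 2 ^ n))

theorem measurable_couponPot (n m : ℕ) (grp : Finset (Fin S)) (j : Fin K) :
    Measurable (couponPot n m grp j) := by
  classical
  have h : Measurable fun st : CollectState S K => (st.pairs, st.psi, st.visits) := by fun_prop
  exact (measurable_of_countable fun z : Finset (Fin S × Fin K) × (Fin S → Option (Fin K)) ×
    (Fin S → ℕ) => if ∃ i ∈ grp, (i, j) ∈ z.1 ∨ (z.2.1 i = some j ∧ z.2.2 i < m * 2 ^ n) then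
      (0 : ℝ≥0∞) else ENNReal.ofReal ((1 - 1 / (K : ℝ)) ^
        ∑ i ∈ grp, (m - (z.2.2 i + (2 ^ n - 1)) / 2 ^ n))).comp h

theorem add_pred_div_of_mod_ne_zero {a B : ℕ} (hB : 0 < B) (h : a % B ≠ 0) :
    (a + (B - 1)) / B = a / B + 1 := by
  have h1 := Nat.div_add_mod a B
  have h2 := Nat.mod_lt a hB
  rw [show a + (B - 1) = (a % B - 1) + B * (a / B + 1) by
    have : B * (a / B + 1) = B * (a / B) + B := by ring
    omega]
  rw [Nat.add_mul_div_left _ _ hB, Nat.div_eq_of_lt (by omega)]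
  omega

theorem add_pred_div_of_mod_eq_zero {a B : ℕ} (hB : 0 < B) (h : a % B = 0) :
    (a + (B - 1)) / B = a / B := by
  have h1 := Nat.div_add_mod a B
  rw [show a + (B - 1) = (B - 1) + B * (a / B) by omega]
  rw [Nat.add_mul_div_left _ _ hB, Nat.div_eq_of_lt (by omega)]
  omega

theorem one_sub_inv_nonneg [NeZero K] : (0 : ℝ) ≤ 1 - 1 / (K : ℝ) := by
  have : (1 : ℝ) ≤ K := by exact_mod_cast NeZero.one_le
  rw [sub_nonneg, div_le_one (by positivity)]
  exact this

/-- While an assigned arm is kept, the coupon potential does not increase. -/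
theorem couponPot_update_le [NeZero K] {n m : ℕ} {grp : Finset (Fin S)} {j : Fin K}
    {st : CollectState S K} {i : Fin S} {a : Fin K} {y : ℝ}
    (h : i ∉ grp ∨ st.visits i % 2 ^ n ≠ 0 ∧ st.psi i = some a ∨
      st.visits i % 2 ^ n = 0 ∧ st.psi i = none ∧ m ≤ st.visits i / 2 ^ n) :
    couponPot n m grp j (st.update n i a y) ≤ couponPot n m grp j st := by
  classical
  have hB : 0 < 2 ^ n := by positivity
  unfold couponPot
  by_cases hs : ∃ i ∈ grp, (i, j) ∈ st.pairs ∨ (st.psi i = some j ∧ st.visits i < m * 2 ^ n)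
  · rw [if_pos]
    · exact zero_le
    obtain ⟨k, hk, hk'⟩ := hs
    by_cases hki : k = i
    · subst hki
      rcases hk' with hk' | ⟨h1, h2⟩
      · refine ⟨k, hk, Or.inl ?_⟩
        rw [CollectState.update_pairs]
        split_ifs <;> simp [hk']
      · rcases h with h | h | h
        · exact absurd hk h
        · obtain rfl : a = j := by simpa [h.2] using h1
          by_cases hm : (st.visits k + 1) % 2 ^ n = 0
          · refine ⟨k, hk, Or.inl ?_⟩
            rw [CollectState.update_pairs, if_pos hm]
            simp
          · refine ⟨k, hk, Or.inr ⟨?_, ?_⟩⟩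
            · rw [CollectState.update_psi, if_neg hm]
              simp
            · rw [CollectState.update_visits, Function.update_self]
              refine lt_of_le_of_ne (by omega) fun h' => hm ?_
              rw [h', Nat.mul_mod_left]
        · simp [h.2.1] at h1
    · refine ⟨k, hk, ?_⟩
      rw [CollectState.update_pairs, CollectState.update_psi, CollectState.update_visits,
        Function.update_of_ne hki, Function.update_of_ne hki]
      refine hk'.imp_left fun h' => ?_
      split_ifs <;> simp [h']
  · rw [if_neg hs]
    split_ifs
    · exact zero_le
    refine ENNReal.ofReal_le_ofReal (le_of_eq ?_)
    congr 1
    refine Finset.sum_congr rfl fun k hk => ?_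
    rw [CollectState.update_visits]
    by_cases hki : k = i
    · subst hki
      rw [Function.update_self]
      rcases h with h | h | h
      · exact absurd hk h
      · rw [add_pred_div_of_mod_ne_zero hB h.1]
        rw [show st.visits k + 1 + (2 ^ n - 1) = st.visits k + 2 ^ n by omega,
          Nat.add_div_right _ hB]
      · rw [add_pred_div_of_mod_eq_zero hB h.1,
          show st.visits k + 1 + (2 ^ n - 1) = st.visits k + 2 ^ n by omega,
          Nat.add_div_right _ hB]
        omega
    · rw [Function.update_of_ne hki]

/-- Only a fresh draw in one of the first `m` blocks of a context of the group matters. The draw `j`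
makes the potential vanish and the `K - 1` others lower the exponent by one, which balances: `(K -
1) * q ^ e = K * q ^ (e + 1)` for `q = 1 - 1 / K`. -/
theorem stepLE_couponPot [NeZero K] {n m : ℕ} {grp : Finset (Fin S)} {j : Fin K}
    {st : CollectState S K} (hpsi : ∀ i, st.psi i = none ↔ st.visits i % 2 ^ n = 0) :
    StepLE A ρ (fun u i => st.arm none u i)
      (fun u i y => couponPot n m grp j (st.update n i (st.arm none u i) y))
      (couponPot n m grp j st) := by
  classical
  have hB : 0 < 2 ^ n := by positivity
  have hK : (1 : ℝ) ≤ K := by exact_mod_cast NeZero.one_le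
  refine StepLE.of_forall_ctx fun i _ μ hμ _ => ?_
  by_cases hcase : i ∉ grp ∨ st.visits i % 2 ^ n ≠ 0 ∨ m ≤ st.visits i / 2 ^ n
  · have hle : ∀ u y, couponPot n m grp j (st.update n i (st.arm none u i) y) ≤
        couponPot n m grp j st := by
      intro u y
      refine couponPot_update_le ?_
      by_cases hi : i ∈ grp
      · right
        by_cases hv : st.visits i % 2 ^ n = 0
        · right
          refine ⟨hv, (hpsi i).2 hv, ?_⟩
          tauto
        · left
          refine ⟨hv, ?_⟩
          obtain ⟨a, ha⟩ := Option.ne_none_iff_exists'.1 (mt (hpsi i).1 hv)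
          simp [CollectState.arm, ha]
      · exact Or.inl hi
    calc ∑ u, ∫⁻ y, couponPot n m grp j (st.update n i (st.arm none u i) y) ∂μ u
        ≤ ∑ u : Fin K, ∫⁻ _, couponPot n m grp j st ∂μ u := by gcongr with u _ y; exact hle u y
      _ = _ := by simp
  push Not at hcase
  obtain ⟨hi, hv, hm⟩ := hcase
  have hnone := (hpsi i).2 hv
  have harm : ∀ u, st.arm none u i = u := fun u => by simp [CollectState.arm, hnone, drawFrom]
  simp only [harm]
  by_cases hs : ∃ i ∈ grp, (i, j) ∈ st.pairs ∨ (st.psi i = some j ∧ st.visits i < m * 2 ^ n)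
  · have h0 : ∀ u y, couponPot n m grp j (st.update n i u y) = 0 := by
      intro u y
      unfold couponPot
      rw [if_pos]
      obtain ⟨k, hk, hk'⟩ := hs
      refine ⟨k, hk, ?_⟩
      rw [CollectState.update_pairs, CollectState.update_psi, CollectState.update_visits]
      by_cases hki : k = i
      · subst hki
        left
        rcases hk' with hk' | hk'
        · split_ifs <;> simp [hk']
        · simp [hnone] at hk'
      · rw [Function.update_of_ne hki, Function.update_of_ne hki]
        refine hk'.imp_left fun h' => ?_
        split_ifs <;> simp [h']
    simp [h0]
  · have hj : ∀ y, couponPot n m grp j (st.update n i j y) = 0 := by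
      intro y
      unfold couponPot
      rw [if_pos]
      by_cases hm' : (st.visits i + 1) % 2 ^ n = 0
      · refine ⟨i, hi, Or.inl ?_⟩
        rw [CollectState.update_pairs, if_pos hm']
        simp
      · refine ⟨i, hi, Or.inr ⟨?_, ?_⟩⟩
        · rw [CollectState.update_psi, if_neg hm']
          simp
        · rw [CollectState.update_visits, Function.update_self]
          have : st.visits i < m * 2 ^ n := (Nat.div_lt_iff_lt_mul hB).1 hm
          refine lt_of_le_of_ne (by omega) fun h' => hm' ?_
          rw [h', Nat.mul_mod_left]
    set e := ∑ k ∈ grp.erase i, (m - (st.visits k + (2 ^ n - 1)) / 2 ^ n) with he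
    set d := m - st.visits i / 2 ^ n - 1 with hd
    have hV : couponPot n m grp j st = ENNReal.ofReal ((1 - 1 / (K : ℝ)) ^ (e + d + 1)) := by
      unfold couponPot
      rw [if_neg hs]
      congr 2
      rw [← Finset.sum_erase_add _ _ hi, add_pred_div_of_mod_eq_zero hB hv]
      omega
    have hu : ∀ u y, couponPot n m grp j (st.update n i u y) ≤
        ENNReal.ofReal ((1 - 1 / (K : ℝ)) ^ (e + d)) := by
      intro u y
      unfold couponPot
      split_ifs
      · exact zero_le
      refine ENNReal.ofReal_le_ofReal (le_of_eq ?_)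
      congr 1
      rw [← Finset.sum_erase_add _ _ hi, he]
      congr 1
      · refine Finset.sum_congr rfl fun k hk => ?_
        rw [CollectState.update_visits, Function.update_of_ne (Finset.ne_of_mem_erase hk)]
      · rw [CollectState.update_visits, Function.update_self,
          show st.visits i + 1 + (2 ^ n - 1) = st.visits i + 2 ^ n by omega,
          Nat.add_div_right _ hB]
        omega
    rw [hV, ← Finset.sum_erase_add _ _ (Finset.mem_univ j)]
    simp only [hj, lintegral_zero, add_zero]
    calc ∑ u ∈ Finset.univ.erase j, ∫⁻ y, couponPot n m grp j (st.update n i u y) ∂μ u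
        ≤ ∑ u ∈ Finset.univ.erase j, ∫⁻ _, ENNReal.ofReal ((1 - 1 / (K : ℝ)) ^ (e + d)) ∂μ u := by
          gcongr with u _ y; exact hu u y
      _ = ((K - 1 : ℕ) : ℝ≥0∞) * ENNReal.ofReal ((1 - 1 / (K : ℝ)) ^ (e + d)) := by simp
      _ = ENNReal.ofReal ((K - 1 : ℕ) * (1 - 1 / (K : ℝ)) ^ (e + d)) := by
          rw [ENNReal.ofReal_mul (by positivity), ENNReal.ofReal_natCast]
      _ = ENNReal.ofReal (K * (1 - 1 / (K : ℝ)) ^ (e + d + 1)) := by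
          congr 1
          have hK' : ((K - 1 : ℕ) : ℝ) = K * (1 - 1 / (K : ℝ)) := by
            rw [Nat.cast_sub NeZero.one_le]
            field_simp
            simp
          rw [hK']
          ring
      _ = _ := by rw [ENNReal.ofReal_mul (by positivity), ENNReal.ofReal_natCast]

/-- What data collection guarantees for the contexts in `X`. -/
structure CollectPost (A : Fin S → Fin K → ℝ) (X : Finset (Fin S)) (w : ℝ) (n m : ℕ)
    (𝒦 : Option (Fin K)) {ι : Type} (Γ : Finset ι) (grp : ι → Finset (Fin S)) (tgt : ι → Fin K)
    (st : CollectState S K) : Prop where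
  visits : ∀ i ∈ X, m * 2 ^ n ≤ st.visits i
  accurate : ∀ q ∈ st.pairs, q.1 ∈ X ∧ |st.est q - A q.1 q.2| < w
  coupon : ∀ b ∈ Γ, ∃ i ∈ grp b, (i, tgt b) ∈ st.pairs
  single : ∀ j, 𝒦 = some j → ∀ i, 2 ^ n ≤ st.visits i → (i, j) ∈ st.pairs

/-- The invariants of data collection. -/
structure CollectInv (A : Fin S → Fin K → ℝ) (X : Finset (Fin S)) (w : ℝ) (n : ℕ)
    (𝒦 : Option (Fin K)) (st : CollectState S K) : Prop where
  psi : ∀ i, st.psi i = none ↔ st.visits i % 2 ^ n = 0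
  num : ∀ i j, st.psi i = some j → st.visits i % 2 ^ n ≤ st.num (i, j)
  accurate : ∀ q ∈ st.pairs, q.1 ∈ X ∧ |st.est q - A q.1 q.2| < w
  single : ∀ j, 𝒦 = some j → ∀ i, (st.psi i = none ∨ st.psi i = some j) ∧
    (2 ^ n ≤ st.visits i → (i, j) ∈ st.pairs)

/-- The potential of data collection. -/
noncomputable def collectPot (A : Fin S → Fin K → ℝ) (X : Finset (Fin S)) (p w : ℝ) (n m : ℕ)
    {ι : Type} (Γ : Finset ι) (grp : ι → Finset (Fin S)) (tgt : ι → Fin K) (T : ℕ)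
    (st : CollectState S K) : ℝ≥0∞ :=
  ∑ i ∈ X, visitPot (m * 2 ^ n) (decay p) T (st.visits i) +
    (∑ e ∈ X ×ˢ Finset.univ, devPot A w (2 ^ n * (w ^ 2 / 2)) st.num st.sum e +
      ∑ b ∈ Γ, couponPot n m (grp b) (tgt b) st)

theorem collectInv_init (X : Finset (Fin S)) (w : ℝ) (n : ℕ) (𝒦 : Option (Fin K)) :
    CollectInv A X w n 𝒦 CollectState.init where
  psi := by simp [CollectState.init]
  num := by simp [CollectState.init]
  accurate := by simp [CollectState.init]
  single := by simp [CollectState.init]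

/-- Only the accuracy of the estimates can break, and only when a block ends. By the invariant `num`
the pair has then been played at least `2 ^ n` times, so a deviation by `w` makes `devPot` at least
`1`. -/
theorem CollectInv.update {X : Finset (Fin S)} {w : ℝ} {n : ℕ} {𝒦 : Option (Fin K)}
    {st : CollectState S K} (h : CollectInv A X w n 𝒦 st) (hw : 0 < w) {i : Fin S} (hi : i ∈ X)
    (u : Fin K) (y : ℝ) :
    CollectInv A X w n 𝒦 (st.update n i (st.arm 𝒦 u i) y) ∨
      1 ≤ devPot A w (2 ^ n * (w ^ 2 / 2)) (st.update n i (st.arm 𝒦 u i) y).num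
        (st.update n i (st.arm 𝒦 u i) y).sum (i, st.arm 𝒦 u i) := by
  have hB : 0 < 2 ^ n := by positivity
  set a := st.arm 𝒦 u i with ha
  have hpsi : st.psi i = none ∨ st.psi i = some a := by
    rcases hp : st.psi i with _ | a'
    · exact Or.inl rfl
    · right; simp [ha, CollectState.arm, hp]
  have hnum : (st.visits i + 1) % 2 ^ n = 0 ∨
      (st.visits i + 1) % 2 ^ n = st.visits i % 2 ^ n + 1 := by
    rcases Nat.lt_or_ge (st.visits i % 2 ^ n + 1) (2 ^ n) with hlt | hge
    · right
      rw [Nat.add_mod, Nat.mod_eq_of_lt (a := 1) (by omega), Nat.mod_eq_of_lt hlt]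
    · left
      have := Nat.mod_lt (st.visits i) hB
      rw [← Nat.mod_add_mod, show st.visits i % 2 ^ n + 1 = 2 ^ n by omega, Nat.mod_self]
  have hmod : st.visits i % 2 ^ n ≤ st.num (i, a) := by
    rcases hpsi with hp | hp
    · rw [(h.psi i).1 hp]; exact Nat.zero_le _
    · exact h.num i a hp
  have single : ∀ j, 𝒦 = some j → ∀ i', ((st.update n i a y).psi i' = none ∨
      (st.update n i a y).psi i' = some j) ∧ (2 ^ n ≤ (st.update n i a y).visits i' →
      (i', j) ∈ (st.update n i a y).pairs) := by
    intro j hj i'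
    have haj : a = j := by
      rcases (h.single j hj i).1 with hp | hp
      · simp [ha, CollectState.arm, hp, hj, drawFrom]
      · simp [ha, CollectState.arm, hp]
    rw [CollectState.update_psi, CollectState.update_pairs, CollectState.update_visits]
    by_cases hi' : i' = i
    · subst hi'
      simp only [Function.update_self]
      constructor
      · split_ifs
        · exact Or.inl rfl
        · right; rw [haj]
      · intro hvis
        by_cases hm : (st.visits i' + 1) % 2 ^ n = 0
        · simp [hm, haj]
        · rw [if_neg hm]
          refine (h.single j hj i').2 ?_
          by_contra hlt
          exact hm (by rw [show st.visits i' + 1 = 2 ^ n by omega, Nat.mod_self])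
    · rw [Function.update_of_ne hi', Function.update_of_ne hi']
      refine ⟨(h.single j hj i').1, fun hvis => ?_⟩
      have := (h.single j hj i').2 hvis
      split_ifs <;> simp [this]
  have psi : ∀ i', (st.update n i a y).psi i' = none ↔
      (st.update n i a y).visits i' % 2 ^ n = 0 := by
    intro i'
    rw [CollectState.update_psi, CollectState.update_visits]
    by_cases hi' : i' = i
    · subst hi'; simp
    · rw [Function.update_of_ne hi', Function.update_of_ne hi', h.psi]
  have num : ∀ i' j, (st.update n i a y).psi i' = some j →
      (st.update n i a y).visits i' % 2 ^ n ≤ (st.update n i a y).num (i', j) := by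
    intro i' j
    rw [CollectState.update_psi, CollectState.update_visits, CollectState.update_num]
    by_cases hi' : i' = i
    · subst hi'
      simp only [Function.update_self]
      split_ifs with hm
      · simp
      · intro hj
        obtain rfl : a = j := by simpa using hj
        rw [Function.update_self]
        omega
    · rw [Function.update_of_ne hi', Function.update_of_ne hi', Function.update_of_ne (by
        simp [hi'])]
      exact h.num i' j
  by_cases hm : (st.visits i + 1) % 2 ^ n = 0
  · have hge : 2 ^ n ≤ st.visits i % 2 ^ n + 1 := by
      by_contra hlt
      have h1 : st.visits i % 2 ^ n + 1 < 2 ^ n := by omega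
      rw [Nat.add_mod, Nat.mod_eq_of_lt (a := 1) (by omega), Nat.mod_eq_of_lt h1] at hm
      omega
    have hn' : ((2 : ℝ) ^ n) ≤ ((st.update n i a y).num (i, a) : ℕ) := by
      rw [CollectState.update_num, Function.update_self]
      exact_mod_cast (by omega : 2 ^ n ≤ st.num (i, a) + 1)
    rcases abs_sub_lt_or_one_le_devPot (A := A) hw (le_refl _) (by positivity) hn' with hacc | hacc
    · refine Or.inl ⟨psi, num, ?_, single⟩
      intro q hq
      rw [CollectState.update_pairs, if_pos hm, Finset.mem_insert] at hq
      rw [CollectState.update_est, if_pos hm]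
      by_cases hqi : q = (i, a)
      · rw [hqi, Function.update_self]
        exact ⟨hi, hacc⟩
      · rw [Function.update_of_ne hqi]
        exact h.accurate q (hq.resolve_left hqi)
    · exact Or.inr hacc
  · refine Or.inl ⟨psi, num, ?_, single⟩
    rw [CollectState.update_pairs, CollectState.update_est, if_neg hm, if_neg hm]
    exact h.accurate

theorem measurable_collectPot (X : Finset (Fin S)) (p w : ℝ) (n m : ℕ)
    {ι : Type} (Γ : Finset ι) (grp : ι → Finset (Fin S)) (tgt : ι → Fin K) (T : ℕ) :
    Measurable (collectPot A X p w n m Γ grp tgt T) := by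
  refine Measurable.add ?_ (Measurable.add ?_ ?_)
  · refine Finset.measurable_fun_sum _ fun i _ => ?_
    have h : Measurable fun st : CollectState S K => st.visits i := by fun_prop
    exact (measurable_of_countable (visitPot (m * 2 ^ n) (decay p) T)).comp h
  · exact Finset.measurable_fun_sum _ fun e _ => measurable_devPot _ _ (by fun_prop) (by fun_prop) e
  · exact Finset.measurable_fun_sum _ fun b _ => measurable_couponPot _ _ _ _

/-- A context with too few visits has `visitPot` at least `1`. If there is none, all contexts have
finished `m` blocks, so for a group without the desired pair no draw is left and its coupon
potential is `q ^ 0 = 1`. -/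
theorem CollectInv.post_or {X : Finset (Fin S)} {p w : ℝ} {n m : ℕ} {𝒦 : Option (Fin K)}
    {ι : Type} {Γ : Finset ι} {grp : ι → Finset (Fin S)} {tgt : ι → Fin K}
    (hgrp : ∀ b ∈ Γ, grp b ⊆ X) {st : CollectState S K} (h : CollectInv A X w n 𝒦 st) :
    CollectPost A X w n m 𝒦 Γ grp tgt st ∨ 1 ≤ collectPot A X p w n m Γ grp tgt 0 st := by
  have hB : 0 < 2 ^ n := by positivity
  by_cases hv : ∀ i ∈ X, m * 2 ^ n ≤ st.visits i
  swap
  · push Not at hv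
    obtain ⟨i, hi, hlt⟩ := hv
    right
    refine le_trans ?_ (le_self_add : _ ≤ collectPot A X p w n m Γ grp tgt 0 st)
    refine le_trans ?_ (Finset.single_le_sum (f := fun i => visitPot (m * 2 ^ n) (decay p) 0
      (st.visits i)) (fun _ _ => zero_le) hi)
    exact one_le_visitPot (by exact_mod_cast hlt.le)
  by_cases hc : ∀ b ∈ Γ, ∃ i ∈ grp b, (i, tgt b) ∈ st.pairs
  swap
  · push Not at hc
    obtain ⟨b, hb, hc⟩ := hc
    right
    refine le_trans ?_ (le_add_self : _ ≤ collectPot A X p w n m Γ grp tgt 0 st)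
    refine le_trans ?_ (le_add_self (a := ∑ b ∈ Γ, couponPot n m (grp b) (tgt b) st))
    refine le_trans ?_ (Finset.single_le_sum (f := fun b => couponPot n m (grp b) (tgt b) st)
      (fun _ _ => zero_le) hb)
    unfold couponPot
    rw [if_neg]
    · rw [Finset.sum_eq_zero, pow_zero, ENNReal.ofReal_one]
      intro i hi
      have h1 := hv i (hgrp b hb hi)
      have : m ≤ (st.visits i + (2 ^ n - 1)) / 2 ^ n :=
        (Nat.le_div_iff_mul_le hB).2 (by omega)
      omega
    · rintro ⟨i, hi, h1 | h1⟩
      · exact hc i hi h1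
      · exact absurd h1.2 (not_lt.2 (hv i (hgrp b hb hi)))
  exact Or.inl ⟨hv, h.accurate, hc, fun j hj i => (h.single j hj i).2⟩

/-- The bound is the value of `collectPot` at the initial state, a union bound over missing visits,
deviations and missed arms. Coupons need uniform draws, hence `hΓ`. -/
theorem cert_collect [NeZero K] {X : Finset (Fin S)} (hρ : ∀ i, ρ i ≠ 0 → i ∈ X) {p w : ℝ}
    (hp1 : p ≤ 1) (hp : ∀ i ∈ X, p * ∑ i, (ρ i : ℝ) ≤ ρ i) (hw : 0 < w) (T n m : ℕ)
    (𝒦 : Option (Fin K)) {ι : Type} (Γ : Finset ι) (grp : ι → Finset (Fin S)) (tgt : ι → Fin K)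
    (hgrp : ∀ b ∈ Γ, grp b ⊆ X) (hΓ : 𝒦 = none ∨ Γ = ∅) :
    Cert A ρ (fun _ => CollectPost A X w n m 𝒦 Γ grp tgt) T Set.univ (fun _ : Unit => collect T n 𝒦)
      fun _ => ENNReal.ofReal (X.card * (Real.exp (m * 2 ^ n) * decay p ^ T) +
        (X.card * K * (2 * Real.exp (-(2 ^ n * (w ^ 2 / 2)))) +
        ∑ b ∈ Γ, (1 - 1 / (K : ℝ)) ^ (m * (grp b).card))) := by
  have hact : Measurable fun (st : CollectState S K) (u : Fin K) (i : Fin S) => st.arm 𝒦 u i :=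
    measurable_pi_lambda _ fun u => measurable_pi_lambda _ fun i =>
      CollectState.measurable_arm 𝒦 u i
  have key := Cert.loop (A := A) (ρ := ρ) (collectFrom n 𝒦) id measurable_id
    (fun (st : CollectState S K) u i => st.arm 𝒦 u i) hact
    (fun z => z.1.update n z.2.2.1 (z.1.arm 𝒦 z.2.1 z.2.2.1) z.2.2.2)
    (CollectState.measurable_step n 𝒦) (fun _ => rfl) (fun _ _ => rfl)
    {st | CollectInv A X w n 𝒦 st} (collectPot A X p w n m Γ grp tgt)
    (measurable_collectPot X p w n m Γ grp tgt) (CollectPost A X w n m 𝒦 Γ grp tgt)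
    (fun st hst => CollectInv.post_or hgrp hst) ?_ ?_ T
  · refine key.comp (fun _ => CollectState.init) measurable_const measurable_const le_rfl
      (fun _ _ => Or.inl (collectInv_init X w n 𝒦)) (fun _ _ => rfl) (fun _ _ _ h => h) fun _ _ => ?_
    have hK := one_sub_inv_nonneg (K := K)
    rw [ENNReal.ofReal_add, ENNReal.ofReal_add]
    · refine add_le_add ?_ (add_le_add ?_ ?_)
      · rw [ENNReal.ofReal_mul (by positivity), ENNReal.ofReal_natCast]
        simp [CollectState.init, visitPot]
      · rw [ENNReal.ofReal_mul (by positivity), ENNReal.ofReal_mul (by positivity),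
          ENNReal.ofReal_natCast, ENNReal.ofReal_natCast]
        simp [CollectState.init, devPot_zero]
      · rw [ENNReal.ofReal_sum_of_nonneg fun b _ => by positivity]
        refine Finset.sum_le_sum fun b _ => ?_
        unfold couponPot
        split_ifs
        · exact zero_le
        · refine ENNReal.ofReal_le_ofReal (le_of_eq ?_)
          congr 1
          have : (2 ^ n - 1) / 2 ^ n = 0 := Nat.div_eq_of_lt (by
            have : 0 < 2 ^ n := by positivity
            omega)
          simp [CollectState.init, this, mul_comm]
    · positivity
    · exact Finset.sum_nonneg fun b _ => by positivity
    · have := (decay_pos hp1).le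
      positivity
    · exact add_nonneg (by positivity) (Finset.sum_nonneg fun b _ => by positivity)
  · intro T st hst u i y h0
    refine (CollectInv.update hst hw (hρ i h0) u y).imp_right fun h => ?_
    refine le_trans ?_ (le_add_self : _ ≤ collectPot A X p w n m Γ grp tgt T _)
    refine le_trans ?_ (le_self_add : _ ≤ _ + _)
    exact h.trans (Finset.single_le_sum (f := fun e => devPot A w (2 ^ n * (w ^ 2 / 2))
      (st.update n i (st.arm 𝒦 u i) y).num (st.update n i (st.arm 𝒦 u i) y).sum e)
      (fun _ _ => zero_le) (Finset.mk_mem_product (hρ i h0) (Finset.mem_univ _)))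
  · intro T st hst
    have hm : ∀ u i, Measurable fun y : ℝ => st.update n i (st.arm 𝒦 u i) y := fun u i =>
      (CollectState.measurable_update n i (st.arm 𝒦 u i)).comp measurable_prodMk_left
    refine StepLE.add (StepLE.sum _ (fun i₀ hi₀ => ?_) ?_) (StepLE.add (StepLE.sum _ ?_ ?_)
      (StepLE.sum _ ?_ ?_) ?_) ?_
    · refine stepLE_visitPot _ hp1 (hp i₀ hi₀) _ _ _ (fun u i =>
        (Function.update st.visits i (st.visits i + 1)) i₀) ?_ |>.mono (fun u i y _ => ?_) le_rfl
      · intro u i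
        by_cases h : i = i₀
        · subst h; simp
        · simp [h, Function.update_of_ne (Ne.symm h)]
      · rw [CollectState.update_visits]
    · intro i₀ _ u i
      have : Measurable fun st : CollectState S K => st.visits i₀ := by fun_prop
      exact (measurable_of_countable (visitPot (m * 2 ^ n) (decay p) T)).comp (this.comp (hm u i))
    · intro e _
      refine (stepLE_devPot _ _ _ _ _ _).mono (fun u i y _ => ?_) le_rfl
      rw [CollectState.update_num, CollectState.update_sum]
    · intro e _ u i
      exact measurable_devPot _ _ (CollectState.measurable_num.comp (hm u i))
        (CollectState.measurable_sum.comp (hm u i)) e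
    · intro b hb
      rcases hΓ with rfl | rfl
      · exact stepLE_couponPot hst.psi
      · simp at hb
    · intro b _ u i
      exact (measurable_couponPot _ _ _ _).comp (hm u i)
    · intro u i
      exact Finset.measurable_fun_sum _ fun e _ =>
        measurable_devPot _ _ (CollectState.measurable_num.comp (hm u i))
        (CollectState.measurable_sum.comp (hm u i)) e
    · intro u i
      refine Finset.measurable_fun_sum _ fun i₀ _ => ?_
      have : Measurable fun st : CollectState S K => st.visits i₀ := by fun_prop
      exact (measurable_of_countable (visitPot (m * 2 ^ n) (decay p) T)).comp (this.comp (hm u i))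

end Collect

end LumpableBandit

namespace LumpableBandit

open scoped ENNReal NNReal

/-! ### The phases for almost uniform context distributions -/

section Phases

variable {S K : ℕ} [NeZero K] {A : Fin S → Fin K → ℝ} {ρ : Fin S → ℝ≥0}

theorem cert_collectLevels (T n : ℕ) (Good : ℕ → CollectState S K → Prop) (φ : ℝ≥0∞)
    (h : ∀ k, 1 ≤ k → k ≤ n → Cert A ρ (fun _ => Good k) T Set.univ
      (fun _ : Unit => collect T k none) fun _ => φ) :
    Cert A ρ (fun _ f => ∀ k, 1 ≤ k → k ≤ n → Good k (f k)) (n * T) Set.univ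
      (fun _ : Unit => collectLevels T n) fun _ => n * φ := by
  induction n with
  | zero =>
    refine Cert.done measurable_const (fun _ _ => CollectState.init) measurable_const
      (fun _ _ => rfl) fun _ _ => Or.inl fun k h1 h2 => by omega
  | succ n ih =>
    have h1 := ih fun k hk hk' => h k hk (by omega)
    have h2 := (h (n + 1) (by omega) le_rfl).comp
      (fun _ : Unit × (ℕ → CollectState S K) => ()) measurable_const (measurable_const (a := φ))
      le_rfl (Q' := {z | z.1 ∈ Set.univ ∧ ∀ k, 1 ≤ k → k ≤ n → Good k (z.2 k)})
      (Post' := fun _ => Good (n + 1)) (fun _ _ => Or.inl trivial) (fun _ _ => rfl)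
      (fun _ _ _ h => h) (fun _ _ => le_rfl)
    have h3 := h2.bind (Post' := fun _ f => ∀ k, 1 ≤ k → k ≤ n + 1 → Good k (f k)) (M' := 0)
      (w := 0) (k := fun z => .done (Function.update z.1.2 (n + 1) z.2))
      (Cert.done measurable_const (fun z => Function.update z.1.2 (n + 1) z.2)
        (measurable_function_update (measurable_snd.comp measurable_fst) _ measurable_snd)
        (fun _ _ => rfl) (by
          rintro z ⟨⟨-, hz⟩, hz'⟩
          refine Or.inl fun k hk hk' => ?_
          by_cases hkn : k = n + 1
          · subst hkn; simpa using hz'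
          · simpa [Function.update_of_ne hkn] using hz k hk (by omega)))
    simp only [add_zero] at h3
    refine (h1.bind h3).mono measurable_const (by rw [add_mul, one_mul]) (fun _ h => h)
      (fun _ _ => rfl) (fun _ _ _ h => h) fun _ _ => ?_
    push_cast
    rw [add_mul, one_mul]

/-! ### Screening -/

omit [NeZero K] in
open Classical in
theorem measurable_filter_finset {β : Type*} [MeasurableSpace β] (D : Finset (Fin S × Fin K))
    {q : β → Fin S × Fin K → Prop} (hq : Measurable q) : Measurable fun b => D.filter (q b) :=
  (measurable_of_countable fun r : Fin S × Fin K → Prop => D.filter r).comp hq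

/-- Two contexts in one lump have the same mean for the arm of the best pair, so all pairs of the
lump of the best pair have new estimates within `thr` of the best estimate and leave `D`. Thus `k`,
a bound on the number of lumps met by `D`, decreases in each iteration. A pair that leaves `D` had
an estimate no larger than the best one, which is within `thr` of the new estimate at its context;
the two estimation errors of `thr / 2` bring its loss to less than `2 * thr`. -/
theorem cert_screen {X : Finset (Fin S)} {r : ℕ} {g : Fin S → Fin r}
    (hg : ∀ i i', g i = g i' → ∀ j, A i j = A i' j) (T n : ℕ) {thr : ℝ} (φ : ℝ≥0∞)
    (hcol : ∀ j, Cert A ρ (fun _ st => ∀ i ∈ X, |st.est (i, j) - A i j| < thr / 2) T Set.univ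
      (fun _ : Unit => collect T n (some j)) fun _ => φ) (fuel : ℕ) :
    ∀ (k : ℕ) (D : Finset (Fin S × Fin K)) (W : Finset (Fin K)),
      (D.image fun q => g q.1).card ≤ k → k ≤ fuel → (∀ q ∈ D, q.1 ∈ X) →
      Cert A ρ (fun _ W' => W ⊆ W' ∧ W'.card ≤ W.card + k ∧
        ∀ q ∈ D, ∃ j ∈ W', A q.1 q.2 - A q.1 j < 2 * thr) (k * T)
        {est : Fin S × Fin K → ℝ | ∀ q ∈ D, |est q - A q.1 q.2| < thr / 2}
        (fun est => screen T n thr est fuel D W) fun _ => k * φ := by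
  classical
  induction fuel with
  | zero =>
    intro k D W hD hk hX
    obtain rfl : k = 0 := by omega
    have hD0 : D = ∅ := by simpa using hD
    subst hD0
    exact Cert.done measurable_const (fun _ => W) measurable_const (fun _ _ => rfl)
      fun _ _ => Or.inl (by simp)
  | succ fuel ih =>
    intro k D W hcard hk hX
    by_cases hD : D.Nonempty
    swap
    · have hD0 : D = ∅ := by simpa using hD
      subst hD0
      exact Cert.done measurable_const (fun _ => W) measurable_const
        (fun _ _ => by simp [screen]; rfl) fun _ _ => Or.inl (by simp)
    obtain ⟨k, rfl⟩ : ∃ k', k = k' + 1 := by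
      have : 0 < (D.image fun q => g q.1).card := Finset.card_pos.2 (hD.image _)
      exact ⟨k - 1, by omega⟩
    -- The loop branches on the estimates only through the best pair and, below, through the
    -- surviving data set. Both are fixed here by case distinctions.
    refine Cert.cases measurable_const (argmaxOn D hD) (measurable_argmaxOn D hD) fun b => ?_
    have h1 := (hcol b.2).comp (fun _ : Fin S × Fin K → ℝ => ()) measurable_const
      (measurable_const (a := φ)) le_rfl
      (Q' := {est | (∀ q ∈ D, |est q - A q.1 q.2| < thr / 2) ∧ argmaxOn D hD est = b})
      (Post' := fun _ st => ∀ i ∈ X, |st.est (i, b.2) - A i b.2| < thr / 2)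
      (fun _ _ => Or.inl trivial) (fun _ _ => rfl) (fun _ _ _ h => h) (fun _ _ => le_rfl)
    have h2 := h1.bind (Post' := fun _ W' => W ⊆ W' ∧ W'.card ≤ W.card + (k + 1) ∧
        ∀ q ∈ D, ∃ j ∈ W', A q.1 q.2 - A q.1 j < 2 * thr) (M' := k * T) (w := k * φ)
      (k := fun z => screen T n thr z.1 fuel
        (D.filter fun q => thr ≤ |z.2.est (q.1, b.2) - z.1 b|) (insert b.2 W)) ?_
    · refine h2.mono measurable_const (by rw [add_mul, one_mul, add_comm]) (fun _ h => h) ?_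
        (fun _ _ _ h => h) fun _ _ => ?_
      · rintro est ⟨-, hb⟩
        rw [screen, dif_pos hD]
        subst hb
        congr!
      · push_cast
        rw [add_mul, one_mul, add_comm]
    · have hm : Measurable fun z : (Fin S × Fin K → ℝ) × CollectState S K =>
          D.filter fun q => thr ≤ |z.2.est (q.1, b.2) - z.1 b| := by
        refine measurable_filter_finset D (measurable_pi_lambda _ fun q =>
          measurableSet_setOfPred.1 (measurableSet_le measurable_const ?_))
        have e1 : Measurable fun z : (Fin S × Fin K → ℝ) × CollectState S K =>
          z.2.est (q.1, b.2) := by fun_prop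
        have e2 : Measurable fun z : (Fin S × Fin K → ℝ) × CollectState S K => z.1 b := by fun_prop
        exact measurable_norm.comp (e1.sub e2)
      refine Cert.cases measurable_const _ hm fun D' => ?_
      -- Values of `b` and `D'` that no parameter attains are void. Otherwise one attaining
      -- parameter yields the facts about `b` and `D'`, which do not mention parameters.
      rcases Set.eq_empty_or_nonempty {z : (Fin S × Fin K → ℝ) × CollectState S K |
        z ∈ {z : (Fin S × Fin K → ℝ) × CollectState S K |
          z.1 ∈ {est | (∀ q ∈ D, |est q - A q.1 q.2| < thr / 2) ∧ argmaxOn D hD est = b} ∧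
          ∀ i ∈ X, |z.2.est (i, b.2) - A i b.2| < thr / 2} ∧
        (D.filter fun q => thr ≤ |z.2.est (q.1, b.2) - z.1 b|) = D'} with hempty | hne
      · refine Cert.fail measurable_const fun z hz => ?_
        exact absurd hz (by rw [hempty]; simp)
      have hbD : b ∈ D := by
        obtain ⟨z, ⟨⟨-, hb⟩, -⟩, -⟩ := hne
        rw [← hb]
        exact argmaxOn_mem D hD z.1
      have hsub : D' ⊆ D := by
        obtain ⟨z, -, rfl⟩ := hne
        exact Finset.filter_subset _ _
      have hgone : ∀ q ∈ D', g q.1 ≠ g b.1 := by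
        obtain ⟨z, ⟨⟨hacc, -⟩, hest⟩, rfl⟩ := hne
        intro q hq hgq
        obtain ⟨hqD, hthr⟩ := Finset.mem_filter.1 hq
        have h3 := hest _ (hX q hqD)
        have h4 := hacc b hbD
        rw [hg _ _ hgq] at h3
        have : |z.2.est (q.1, b.2) - z.1 b| < thr := by
          calc |z.2.est (q.1, b.2) - z.1 b| = |(z.2.est (q.1, b.2) - A b.1 b.2) -
                (z.1 b - A b.1 b.2)| := by ring_nf
            _ ≤ |z.2.est (q.1, b.2) - A b.1 b.2| + |z.1 b - A b.1 b.2| := abs_sub _ _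
            _ < thr := by linarith
        exact absurd hthr (not_le.2 this)
      have hcard' : (D'.image fun q => g q.1).card ≤ k := by
        have h3 : (D'.image fun q => g q.1) ⊆ (D.image fun q => g q.1).erase (g b.1) := by
          intro x hx
          obtain ⟨q, hq, rfl⟩ := Finset.mem_image.1 hx
          exact Finset.mem_erase.2 ⟨hgone q hq, Finset.mem_image_of_mem _ (hsub hq)⟩
        have h4 := Finset.card_le_card h3
        rw [Finset.card_erase_of_mem (Finset.mem_image_of_mem _ hbD)] at h4
        omega
      refine (ih k D' (insert b.2 W) hcard' (by omega) fun q hq => hX q (hsub hq)).comp Prod.fst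
        measurable_fst measurable_const le_rfl ?_ ?_ ?_ fun _ _ => le_rfl
      · rintro z ⟨⟨⟨hacc, -⟩, -⟩, -⟩
        exact Or.inl fun q hq => hacc q (hsub hq)
      · rintro z ⟨-, rfl⟩
        rfl
      · rintro z ⟨⟨⟨hacc, hb⟩, hest⟩, rfl⟩ W' ⟨hW, hWc, hW'⟩
        refine ⟨(Finset.subset_insert _ _).trans hW, ?_, fun q hq => ?_⟩
        · have := Finset.card_insert_le b.2 W
          omega
        by_cases hthr : thr ≤ |z.2.est (q.1, b.2) - z.1 b|
        · exact hW' q (Finset.mem_filter.2 ⟨hq, hthr⟩)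
        · refine ⟨b.2, hW (Finset.mem_insert_self _ _), ?_⟩
          have h3 := abs_lt.1 (hest _ (hX q hq))
          have h4 := abs_lt.1 (hacc q hq)
          have h5 := abs_lt.1 (not_le.1 hthr)
          have h6 := le_argmaxOn D hD z.1 hq
          rw [hb] at h6
          linarith [h3.1, h3.2, h4.1, h4.2, h5.1, h5.2]

theorem cert_screenLevels {X : Finset (Fin S)} {r : ℕ} {g : Fin S → Fin r}
    (hg : ∀ i i', g i = g i' → ∀ j, A i j = A i' j) (T : ℕ → ℕ) {thr : ℕ → ℝ} (φ : ℝ≥0∞) (n : ℕ)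
    (hcol : ∀ k, 1 ≤ k → k ≤ n → ∀ j, Cert A ρ
      (fun _ st => ∀ i ∈ X, |st.est (i, j) - A i j| < thr k / 2) (T k) Set.univ
      (fun _ : Unit => collect (T k) k (some j)) fun _ => φ) {fuel : ℕ} (hfuel : r ≤ fuel) :
    Cert A ρ (fun f W => W.card ≤ n * r ∧ ∀ k, 1 ≤ k → k ≤ n → ∀ q ∈ (f k).pairs, ∃ j ∈ W,
        A q.1 q.2 - A q.1 j < 2 * thr k) (∑ k ∈ Finset.Icc 1 n, r * T k)
      {f : ℕ → CollectState S K | ∀ k, 1 ≤ k → k ≤ n → ∀ q ∈ (f k).pairs,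
        q.1 ∈ X ∧ |(f k).est q - A q.1 q.2| < thr k / 2}
      (fun f => screenLevels T thr fuel f n) fun _ => n * (r * φ) := by
  classical
  induction n with
  | zero =>
    exact Cert.done measurable_const (fun _ => ∅) measurable_const (fun _ _ => rfl)
      fun _ _ => Or.inl ⟨by simp, fun k h1 h2 => by omega⟩
  | succ n ih =>
    have h1 := (ih fun k hk hk' => hcol k hk (by omega)).mono (measurable_const (a := n * (r * φ)))
      le_rfl (Q' := {f : ℕ → CollectState S K | ∀ k, 1 ≤ k → k ≤ n + 1 → ∀ q ∈ (f k).pairs,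
        q.1 ∈ X ∧ |(f k).est q - A q.1 q.2| < thr k / 2})
      (fun f hf k hk hk' => hf k hk (by omega)) (fun _ _ => rfl) (fun _ _ _ h => h)
      (fun _ _ => le_rfl)
    have h2 := h1.bind (Post' := fun f W => W.card ≤ (n + 1) * r ∧ ∀ k, 1 ≤ k → k ≤ n + 1 →
        ∀ q ∈ (f k).pairs, ∃ j ∈ W, A q.1 q.2 - A q.1 j < 2 * thr k) (M' := r * T (n + 1))
      (w := r * φ) (k := fun z => screen (T (n + 1)) (n + 1) (thr (n + 1)) (z.1 (n + 1)).est fuel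
        (z.1 (n + 1)).pairs z.2) ?_
    · refine h2.mono measurable_const ?_ (fun _ h => h) (fun _ _ => rfl) (fun _ _ _ h => h)
        fun _ _ => ?_
      · rw [Finset.sum_Icc_succ_top (by omega)]
      · push_cast
        rw [add_mul, one_mul]
    · have hm : Measurable fun z : (ℕ → CollectState S K) × Finset (Fin K) =>
          ((z.1 (n + 1)).pairs, z.2) := by fun_prop
      refine Cert.cases measurable_const _ hm ?_
      rintro ⟨D, W⟩
      by_cases hX : ∀ q ∈ D, q.1 ∈ X
      swap
      · refine Cert.fail measurable_const ?_
        rintro z ⟨⟨h3, -⟩, h4⟩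
        refine absurd (fun q hq => ?_) hX
        simp only [Prod.mk.injEq] at h4
        exact (h3 (n + 1) (by omega) le_rfl q (h4.1 ▸ hq)).1
      have hcard : (D.image fun q => g q.1).card ≤ r := by
        simpa using Finset.card_le_univ (D.image fun q => g q.1)
      refine (cert_screen hg (T (n + 1)) (n + 1) φ (hcol (n + 1) (by omega) le_rfl) fuel r D W hcard
        hfuel hX).comp (fun z : (ℕ → CollectState S K) × Finset (Fin K) => (z.1 (n + 1)).est)
        (by fun_prop) measurable_const le_rfl ?_ ?_ ?_ (fun _ _ => le_rfl)
      · rintro z ⟨⟨h3, -⟩, h4⟩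
        simp only [Prod.mk.injEq] at h4
        exact Or.inl fun q hq => (h3 (n + 1) (by omega) le_rfl q (h4.1 ▸ hq)).2
      · rintro z ⟨-, h4⟩
        simp only [Prod.mk.injEq] at h4
        rw [h4.1, h4.2]
      · rintro z ⟨⟨-, h3, h5⟩, h4⟩ W' ⟨hW, hWc, hW'⟩
        simp only [Prod.mk.injEq] at h4
        obtain ⟨h41, rfl⟩ := h4
        refine ⟨by rw [add_mul]; omega, fun k hk hk' q hq => ?_⟩
        by_cases hkn : k = n + 1
        · subst hkn
          exact hW' q (h41 ▸ hq)
        · obtain ⟨j, hj, hj'⟩ := h5 k hk (by omega) q hq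
          exact ⟨j, hW hj, hj'⟩

/-! ### Round robin -/

omit [NeZero K] in
/-- Playing a least played arm keeps the numbers of plays balanced. -/
theorem update_balanced {num : Fin S × Fin K → ℕ} {W : Finset (Fin K)}
    (hs : ∀ i, ∀ j ∈ W, ∀ j' ∈ W, num (i, j) ≤ num (i, j') + 1) {i : Fin S} {a : Fin K}
    (hmin : ∀ k ∈ W, num (i, a) ≤ num (i, k)) : ∀ i', ∀ j ∈ W, ∀ j' ∈ W,
      Function.update num (i, a) (num (i, a) + 1) (i', j) ≤
        Function.update num (i, a) (num (i, a) + 1) (i', j') + 1 := by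
  intro i' j hj j' hj'
  have h0 := hs i' j hj j' hj'
  have h1 := hmin j' hj'
  simp only [Function.update_apply, Prod.mk.injEq]
  split_ifs with h2 h3 h3
  · omega
  · rw [h2.1]; omega
  · rw [h3.1] at h0 ⊢
    rw [h3.2] at h0
    omega
  · exact h0

/-- The arm of the round robin at the context `i`. -/
noncomputable def leastPlayed (W : Finset (Fin K)) (hW : W.Nonempty) (num : Fin S × Fin K → ℕ)
    (i : Fin S) : Fin K :=
  argmaxOn W hW fun j => -(num (i, j) : ℝ)

/-- The update of the numbers of plays and the sums of rewards in a round of the round robin. -/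
noncomputable def roundRobinStep (W : Finset (Fin K)) (hW : W.Nonempty)
    (z : ((Fin S × Fin K → ℕ) × (Fin S × Fin K → ℝ)) × Fin K × Fin S × ℝ) :
    (Fin S × Fin K → ℕ) × (Fin S × Fin K → ℝ) :=
  (Function.update z.1.1 (z.2.2.1, leastPlayed W hW z.1.1 z.2.2.1)
      (z.1.1 (z.2.2.1, leastPlayed W hW z.1.1 z.2.2.1) + 1),
    Function.update z.1.2 (z.2.2.1, leastPlayed W hW z.1.1 z.2.2.1)
      (z.1.2 (z.2.2.1, leastPlayed W hW z.1.1 z.2.2.1) + z.2.2.2))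

omit [NeZero K] in
theorem measurable_roundRobinStep (W : Finset (Fin K)) (hW : W.Nonempty) :
    Measurable (roundRobinStep (S := S) W hW) := by
  refine measurable_of_cases (D := (Fin S × Fin K → ℕ) × Fin S)
    (g := fun z : ((Fin S × Fin K → ℕ) × (Fin S × Fin K → ℝ)) × Fin K × Fin S × ℝ =>
      (z.1.1, z.2.2.1)) (by fun_prop)
    (f := fun d z => (Function.update d.1 (d.2, leastPlayed W hW d.1 d.2)
      (d.1 (d.2, leastPlayed W hW d.1 d.2) + 1), Function.update z.1.2
      (d.2, leastPlayed W hW d.1 d.2) (z.1.2 (d.2, leastPlayed W hW d.1 d.2) + z.2.2.2)))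
    fun d => ?_
  exact measurable_const.prodMk (measurable_function_update (by fun_prop) _ (by fun_prop))

omit [NeZero K] in
theorem Cert.loop_roundRobin (W : Finset (Fin K)) (hW : W.Nonempty)
    (Inv : Set ((Fin S × Fin K → ℕ) × (Fin S × Fin K → ℝ)))
    (V : ℕ → (Fin S × Fin K → ℕ) × (Fin S × Fin K → ℝ) → ℝ≥0∞) (hV : ∀ T, Measurable (V T))
    (Post : (Fin S → Fin K) → Prop)
    (hend : ∀ s ∈ Inv, Post (fun i => argmaxOn W hW fun j => s.2 (i, j) / s.1 (i, j)) ∨ 1 ≤ V 0 s)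
    (hinv : ∀ T, ∀ s ∈ Inv, ∀ u i y, ρ i ≠ 0 →
      roundRobinStep W hW (s, u, i, y) ∈ Inv ∨ 1 ≤ V T (roundRobinStep W hW (s, u, i, y)))
    (hstep : ∀ T, ∀ s ∈ Inv, StepLE A ρ (fun _ i => leastPlayed W hW s.1 i)
      (fun u i y => V T (roundRobinStep W hW (s, u, i, y))) (V (T + 1) s)) (T : ℕ) :
    Cert A ρ (fun _ => Post) T Inv (fun s => roundRobin W hW T s.1 s.2) (V T) := by
  refine Cert.loop (A := A) (ρ := ρ)
    (fun T (s : (Fin S × Fin K → ℕ) × (Fin S × Fin K → ℝ)) => roundRobin W hW T s.1 s.2)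
    (fun s i => argmaxOn W hW fun j => s.2 (i, j) / s.1 (i, j)) ?_
    (fun s _ i => leastPlayed W hW s.1 i) ?_ (roundRobinStep W hW) (measurable_roundRobinStep W hW)
    (fun _ => rfl) (fun _ _ => rfl) Inv V hV Post hend hinv hstep T
  · refine measurable_pi_lambda _ fun i => (measurable_argmaxOn W hW).comp ?_
    refine measurable_pi_lambda _ fun j => Measurable.div (by fun_prop) ?_
    exact (measurable_of_countable fun num : Fin S × Fin K → ℕ => (num (i, j) : ℝ)).comp
      measurable_fst
  · refine measurable_pi_lambda _ fun u => measurable_pi_lambda _ fun i => ?_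
    exact (measurable_of_countable fun num => leastPlayed W hW num i).comp measurable_fst

/-- The numbers of plays of the arms of `W` at a context differ by at most one, so `(n₀ + 1) *
W.card` visits contain `n₀` plays of each arm. If all empirical means are then within `w`, the
empirically best arm loses at most `2 * w`. -/
theorem cert_roundRobin {X : Finset (Fin S)} {p w M n₀ : ℝ}
    (hp1 : p ≤ 1) (hp : ∀ i ∈ X, p * ∑ i, (ρ i : ℝ) ≤ ρ i) (hw : 0 < w) (hn₀ : 0 < n₀)
    (W : Finset (Fin K)) (hW : W.Nonempty) (hM : (n₀ + 1) * W.card ≤ M) (T : ℕ) :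
    Cert A ρ (fun _ π => ∀ i ∈ X, ∀ j ∈ W, A i j - A i (π i) ≤ 2 * w) T Set.univ
      (fun _ : Unit => roundRobin W hW T (fun _ => 0) fun _ => 0)
      fun _ => ENNReal.ofReal (X.card * (Real.exp M * decay p ^ T) +
        X.card * K * (2 * Real.exp (-(n₀ * (w ^ 2 / 2))))) := by
  classical
  set V : ℕ → (Fin S × Fin K → ℕ) × (Fin S × Fin K → ℝ) → ℝ≥0∞ := fun T s =>
    ∑ i ∈ X, visitPot M (decay p) T (∑ j ∈ W, s.1 (i, j)) +
      ∑ e ∈ X ×ˢ Finset.univ, devPot A w (n₀ * (w ^ 2 / 2)) s.1 s.2 e with hV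
  have hVm : ∀ T, Measurable (V T) := by
    intro T
    refine Measurable.add ?_ ?_
    · exact (measurable_of_countable fun num : Fin S × Fin K → ℕ =>
        ∑ i ∈ X, visitPot M (decay p) T (∑ j ∈ W, num (i, j))).comp measurable_fst
    · exact Finset.measurable_fun_sum _ fun e _ => measurable_devPot _ _ measurable_fst measurable_snd e
  have hvis : ∀ (num : Fin S × Fin K → ℕ) (i i' : Fin S), ∑ j ∈ W, Function.update num
      (i, leastPlayed W hW num i) (num (i, leastPlayed W hW num i) + 1) (i', j) =
      if i = i' then ∑ j ∈ W, num (i', j) + 1 else ∑ j ∈ W, num (i', j) := by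
    intro num i i'
    split_ifs with h
    · subst h
      have hmem : leastPlayed W hW num i ∈ W := argmaxOn_mem _ _ _
      rw [← Finset.add_sum_erase _ _ hmem, ← Finset.add_sum_erase _ (fun j => num (i, j)) hmem,
        Function.update_self]
      rw [Finset.sum_congr rfl fun j hj => Function.update_of_ne (a := (i, j)) (by
        have := Finset.ne_of_mem_erase hj
        simp [this]) _ _]
      ring
    · refine Finset.sum_congr rfl fun j _ => Function.update_of_ne ?_ _ _
      simp [Ne.symm h]
  have key := Cert.loop_roundRobin (A := A) (ρ := ρ) W hW
    {s | ∀ i, ∀ j ∈ W, ∀ j' ∈ W, s.1 (i, j) ≤ s.1 (i, j') + 1} V hVm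
    (fun π => ∀ i ∈ X, ∀ j ∈ W, A i j - A i (π i) ≤ 2 * w) ?_ ?_ ?_ T
  · refine key.comp (fun _ => (fun _ => 0, fun _ => 0)) measurable_const measurable_const le_rfl
      (fun _ _ => Or.inl (by simp)) (fun _ _ => rfl) (fun _ _ _ h => h) fun _ _ => ?_
    have := (decay_pos hp1).le
    rw [ENNReal.ofReal_add (by positivity) (by positivity)]
    refine add_le_add ?_ ?_
    · rw [ENNReal.ofReal_mul (by positivity), ENNReal.ofReal_natCast]
      simp [visitPot]
    · rw [ENNReal.ofReal_mul (by positivity), ENNReal.ofReal_mul (by positivity),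
        ENNReal.ofReal_natCast, ENNReal.ofReal_natCast]
      simp [devPot_zero]
  · intro s hs
    by_cases hv : ∀ i ∈ X, M ≤ (∑ j ∈ W, s.1 (i, j) : ℕ)
    swap
    · push Not at hv
      obtain ⟨i, hi, hlt⟩ := hv
      right
      refine le_trans ?_ (le_self_add : _ ≤ _ + _)
      refine le_trans ?_ (Finset.single_le_sum (f := fun i => visitPot M (decay p) 0
        (∑ j ∈ W, s.1 (i, j))) (fun _ _ => zero_le) hi)
      exact one_le_visitPot hlt.le
    have hnum : ∀ i ∈ X, ∀ j ∈ W, n₀ ≤ s.1 (i, j) := by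
      intro i hi j hj
      have h1 : ∑ j' ∈ W, s.1 (i, j') ≤ W.card * (s.1 (i, j) + 1) := by
        rw [← smul_eq_mul]
        exact Finset.sum_le_card_nsmul _ _ _ fun j' hj' => hs i j' hj' j hj
      have h2 : ((∑ j' ∈ W, s.1 (i, j') : ℕ) : ℝ) ≤ W.card * (s.1 (i, j) + 1) := by
        exact_mod_cast h1
      have h3 : (0 : ℝ) < W.card := by exact_mod_cast hW.card_pos
      have h4 := hM.trans ((hv i hi).trans h2)
      nlinarith
    by_cases hdev : ∀ i ∈ X, ∀ j ∈ W, |s.2 (i, j) / s.1 (i, j) - A i j| < w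
    · left
      intro i hi j hj
      have h1 := abs_lt.1 (hdev i hi j hj)
      have h2 := abs_lt.1 (hdev i hi _ (argmaxOn_mem W hW fun j => s.2 (i, j) / s.1 (i, j)))
      have h3 := le_argmaxOn W hW (fun j => s.2 (i, j) / s.1 (i, j)) hj
      simp only at h3 ⊢
      linarith [h1.1, h1.2, h2.1, h2.2]
    · push Not at hdev
      obtain ⟨i, hi, j, hj, hge⟩ := hdev
      right
      refine le_trans ?_ (le_add_self : _ ≤ V 0 s)
      refine le_trans ?_ (Finset.single_le_sum (f := fun e => devPot A w (n₀ * (w ^ 2 / 2)) s.1 s.2 e)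
        (fun _ _ => zero_le) (Finset.mk_mem_product hi (Finset.mem_univ j)))
      exact (abs_sub_lt_or_one_le_devPot hw le_rfl hn₀ (hnum i hi j hj)).resolve_left
        (not_lt.2 hge)
  · intro T s hs u i y _
    left
    refine update_balanced hs fun k hk => ?_
    have := le_argmaxOn W hW (fun j => -(s.1 (i, j) : ℝ)) hk
    have h2 : ((s.1 (i, leastPlayed W hW s.1 i) : ℕ) : ℝ) ≤ s.1 (i, k) := by
      simp only [leastPlayed]
      linarith
    exact_mod_cast h2
  · intro T s hs
    have hm : ∀ u i, Measurable fun y : ℝ => roundRobinStep W hW (s, u, i, y) := fun u i =>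
      (measurable_roundRobinStep W hW).comp (by fun_prop)
    refine StepLE.add (StepLE.sum _ (fun i₀ hi₀ => ?_) ?_) (StepLE.sum _ ?_ ?_) ?_
    · exact stepLE_visitPot (fun _ i => leastPlayed W hW s.1 i) hp1 (hp i₀ hi₀) M T (∑ j ∈ W, s.1 (i₀, j))
        (fun u i => ∑ j ∈ W, Function.update s.1 (i, leastPlayed W hW s.1 i) (s.1 (i, leastPlayed W hW s.1 i) + 1) (i₀, j))
        fun u i => hvis s.1 i i₀
    · intro i₀ _ u i
      exact ((measurable_of_countable fun num : Fin S × Fin K → ℕ =>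
        visitPot M (decay p) T (∑ j ∈ W, num (i₀, j))).comp measurable_fst).comp (hm u i)
    · intro e _
      have := stepLE_devPot (A := A) (ρ := ρ) (fun _ i => leastPlayed W hW s.1 i) w (n₀ * (w ^ 2 / 2)) s.1 s.2 e
      simpa only [roundRobinStep] using this
    · intro e _ u i
      exact (measurable_devPot w (n₀ * (w ^ 2 / 2)) measurable_fst measurable_snd e).comp (hm u i)
    · intro u i
      exact (Finset.measurable_fun_sum _ fun i₀ _ => ((measurable_of_countable
        fun num : Fin S × Fin K → ℕ => visitPot M (decay p) T (∑ j ∈ W, num (i₀, j))).comp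
          measurable_fst)).comp (hm u i)

end Phases

end LumpableBandit

namespace LumpableBandit

open scoped ENNReal NNReal

/-! ### Almost uniform context distributions -/

section AlmostUniform

/-- The parameters of the algorithm for almost uniform context distributions, with `s` contexts,
`k` actions, `r` blocks, accuracy `ε` and confidence `δ`. -/
structure Params (s k r ε δ : ℝ) : Prop where
  one_le_s : 1 ≤ s
  one_le_k : 1 ≤ k
  one_le_r : 1 ≤ r
  eps_pos : 0 < ε
  eps_le : ε ≤ 1 / 8
  delta_pos : 0 < δ
  delta_le : δ ≤ Real.exp (-16)

namespace Params

variable {s k r ε δ : ℝ} (h : Params s k r ε δ)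

include h

theorem delta_le_one : δ ≤ 1 := h.delta_le.trans (Real.exp_le_one_iff.2 (by norm_num))

theorem eps_sq_le : ε ^ 2 ≤ 1 / 64 := by
  have := h.eps_pos
  have := h.eps_le
  nlinarith

/-- The purpose of `delta_le`: logarithms of size at least `16` absorb the roundings and the
numerical constants of all later estimates. -/
theorem le_log {N : ℝ} (hN : 1 ≤ N) : 16 ≤ Real.log (N / δ) := by
  have hδ := h.delta_pos
  rw [Real.le_log_iff_exp_le (by positivity), le_div_iff₀ hδ]
  calc Real.exp 16 * δ ≤ Real.exp 16 * Real.exp (-16) := by gcongr; exact h.delta_le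
    _ = 1 := by rw [← Real.exp_add]; simp
    _ ≤ N := hN

theorem exp_neg_log {N : ℝ} (hN : 1 ≤ N) : Real.exp (-Real.log (N / δ)) = δ / N := by
  have hδ := h.delta_pos
  rw [Real.exp_neg, Real.exp_log (by positivity), inv_div]

theorem one_le_mul : 1 ≤ r * s * k := by
  have h1 := h.one_le_s
  have h2 := h.one_le_k
  have h3 := h.one_le_r
  calc (1 : ℝ) = 1 * 1 * 1 := by norm_num
    _ ≤ r * s * k := by gcongr

theorem one_le_mul' : 1 ≤ s * k := by
  have h1 := h.one_le_s
  have h2 := h.one_le_k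
  calc (1 : ℝ) = 1 * 1 := by norm_num
    _ ≤ s * k := by gcongr

/-- One of the two factors `δ / (r * s * k)` pays for the union over all `s * k` pairs. What remains
is the share of one of the `r` iterations of screening at a level. -/
theorem exp_two_log_le : s * k * (2 * Real.exp (-(2 * Real.log (r * s * k / δ)))) ≤ 2 * δ / r := by
  have h1 := h.one_le_s
  have h2 := h.one_le_k
  have h3 := h.one_le_r
  have hδ := h.delta_pos
  have hδ1 := h.delta_le_one
  have hN := h.one_le_mul
  have e : Real.exp (-(2 * Real.log (r * s * k / δ))) = (δ / (r * s * k)) ^ 2 := by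
    rw [← h.exp_neg_log hN, ← Real.exp_nat_mul]
    push_cast
    ring_nf
  rw [e]
  have : s * k * (2 * (δ / (r * s * k)) ^ 2) = 2 * δ / r * (δ / (r * s * k)) := by
    field_simp
  rw [this]
  have h4 : δ / (r * s * k) ≤ 1 := by
    rw [div_le_one (by positivity)]
    linarith
  have h5 : 0 ≤ 2 * δ / r := by positivity
  nlinarith

theorem mul_exp_two_log_le : s * Real.exp (-(2 * Real.log (r * s * k / δ))) ≤ δ / r := by
  have h1 := h.one_le_s
  have h2 := h.one_le_k
  have h0 := Real.exp_pos (-(2 * Real.log (r * s * k / δ)))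
  have := h.exp_two_log_le
  have h3 : s * Real.exp (-(2 * Real.log (r * s * k / δ))) ≤
      s * k * Real.exp (-(2 * Real.log (r * s * k / δ))) := by
    gcongr
    nlinarith
  have h4 : 2 * δ / r = 2 * (δ / r) := by ring
  linarith

/-- Few visits in the data collection for all actions are unlikely. -/
theorem collect_visits {T : ℕ} (hT : r * (s + k) * (16 * Real.log (r * s * k / δ)) / ε ^ 2 ≤ T)
    {x : ℝ} (hx : x ≤ r * (s + k) * (16 * Real.log (r * s * k / δ)) / (128 * s * ε ^ 2)) :
    s * (Real.exp x * decay (1 / (32 * s)) ^ T) ≤ δ := by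
  have h1 := h.one_le_s
  have h2 := h.one_le_k
  have h3 := h.one_le_r
  have hε := h.eps_pos
  have hδ := h.delta_pos
  have hN := h.one_le_mul
  have hL := h.le_log hN
  set L := Real.log (r * s * k / δ)
  have hp1 : 1 / (32 * s) ≤ 1 := by
    rw [div_le_one (by positivity)]
    linarith
  have hd := decay_pow_le (p := 1 / (32 * s)) (by positivity) hp1 T
  -- The exponent won from `T` rounds is twice the bound on `x`: one half pays for `exp x`, the
  -- other is at least `L`.
  have h4 : r * (s + k) * (16 * L) / (64 * s * ε ^ 2) ≤ 1 / (32 * s) * T / 2 := by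
    calc r * (s + k) * (16 * L) / (64 * s * ε ^ 2) =
        1 / (32 * s) * (r * (s + k) * (16 * L) / ε ^ 2) / 2 := by field_simp; norm_num
      _ ≤ _ := by gcongr
  have h5 : L ≤ r * (s + k) * (16 * L) / (128 * s * ε ^ 2) := by
    rw [le_div_iff₀ (by positivity)]
    have h6 := h.eps_sq_le
    calc L * (128 * s * ε ^ 2) ≤ L * (128 * s * (1 / 64)) := by gcongr
      _ = 1 * (s + 0) * (2 * L) := by ring
      _ ≤ r * (s + k) * (16 * L) := by gcongr <;> linarith
  have h6 : Real.exp x * decay (1 / (32 * s)) ^ T ≤ Real.exp (-L) := by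
    calc Real.exp x * decay (1 / (32 * s)) ^ T
        ≤ Real.exp x * Real.exp (-(1 / (32 * s) * T / 2)) := by gcongr
      _ = Real.exp (x - 1 / (32 * s) * T / 2) := by rw [← Real.exp_add]; ring_nf
      _ ≤ Real.exp (-L) := by
        refine Real.exp_le_exp.2 ?_
        have : r * (s + k) * (16 * L) / (64 * s * ε ^ 2) =
          2 * (r * (s + k) * (16 * L) / (128 * s * ε ^ 2)) := by field_simp; norm_num
        linarith
  rw [h.exp_neg_log hN] at h6
  calc s * (Real.exp x * decay (1 / (32 * s)) ^ T) ≤ s * (δ / (r * s * k)) := by gcongr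
    _ = δ / (r * k) := by field_simp
    _ ≤ δ := div_le_self hδ.le (by nlinarith)

/-- Few visits in the data collection for one action are unlikely. -/
theorem screen_visits {T n : ℕ} (hn : 1 ≤ n)
    (hT : 8 * (16 * Real.log (r * s * k / δ)) * 2 ^ n * s ≤ T) :
    s * (Real.exp ((1 : ℕ) * 2 ^ n) * decay (1 / (32 * s)) ^ T) ≤ δ / r := by
  have h1 := h.one_le_s
  have hN := h.one_le_mul
  have hL := h.le_log hN
  refine le_trans ?_ h.mul_exp_two_log_le
  set L := Real.log (r * s * k / δ)
  have hp1 : 1 / (32 * s) ≤ 1 := by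
    rw [div_le_one (by positivity)]
    linarith
  have hd := decay_pow_le (p := 1 / (32 * s)) (by positivity) hp1 T
  -- With `2 ^ n ≥ 2` and `L ≥ 16` the net exponent `(2 * L - 1) * 2 ^ n` is at least `2 * L`. This
  -- is where `1 ≤ n` enters.
  have hB : (2 : ℝ) ≤ 2 ^ n := by
    calc (2 : ℝ) = 2 ^ 1 := by norm_num
      _ ≤ 2 ^ n := by gcongr; norm_num
  have h4 : 2 * L * 2 ^ n ≤ 1 / (32 * s) * T / 2 := by
    calc 2 * L * 2 ^ n = 1 / (32 * s) * (8 * (16 * L) * 2 ^ n * s) / 2 := by field_simp; norm_num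
      _ ≤ _ := by gcongr
  gcongr s * ?_
  calc Real.exp ((1 : ℕ) * 2 ^ n) * decay (1 / (32 * s)) ^ T
      ≤ Real.exp ((1 : ℕ) * 2 ^ n) * Real.exp (-(1 / (32 * s) * T / 2)) := by gcongr
    _ = Real.exp (2 ^ n - 1 / (32 * s) * T / 2) := by
        rw [← Real.exp_add]; push_cast; ring_nf
    _ ≤ Real.exp (-(2 * L)) := by
      refine Real.exp_le_exp.2 ?_
      nlinarith

/-- The deviation of the estimates in the data collection by half of the screening threshold. -/
theorem collect_noise (n : ℕ) :
    s * k * (2 * Real.exp (-(2 ^ n * ((√(16 * Real.log (r * s * k / δ) / 2 ^ n) / 2) ^ 2 / 2)))) ≤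
      2 * δ / r := by
  have hL := h.le_log h.one_le_mul
  refine le_trans (le_of_eq ?_) h.exp_two_log_le
  congr 3
  rw [div_pow, Real.sq_sqrt (by positivity)]
  field_simp
  ring_nf

/-- All arms are drawn in sufficiently large groups. -/
theorem collect_coupon {b : ℝ} {n m c : ℕ}
    (hn : (2 : ℝ) ^ n ≤ c * r * (s + k) / (16 * s * k * ε ^ 2))
    (hm : r * (s + k) * (16 * Real.log (r * s * k / δ)) / (256 * s * ε ^ 2 * 2 ^ n) ≤ m)
    (hbr : b ≤ r) :
    b * (1 - 1 / k) ^ (m * c) ≤ δ := by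
  have h1 := h.one_le_s
  have h2 := h.one_le_k
  have h3 := h.one_le_r
  have hε := h.eps_pos
  have hδ := h.delta_pos
  have hN := h.one_le_mul
  have hL := h.le_log hN
  set L := Real.log (r * s * k / δ) with hLdef
  -- The group makes at least `k * L` draws in total, and all of them miss a given arm with
  -- probability at most `exp (-L)`.
  have h4 : L ≤ m * c / k := by
    have hn' : (2 : ℝ) ^ n * (16 * s * k * ε ^ 2) ≤ c * r * (s + k) := by
      rwa [le_div_iff₀ (by positivity)] at hn
    calc L = L * (2 ^ n * (16 * s * k * ε ^ 2)) / (2 ^ n * (16 * s * k * ε ^ 2)) := by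
          field_simp
      _ ≤ L * (c * r * (s + k)) / (2 ^ n * (16 * s * k * ε ^ 2)) := by gcongr
      _ = r * (s + k) * (16 * L) / (256 * s * ε ^ 2 * 2 ^ n) * c / k := by field_simp; norm_num
      _ ≤ _ := by gcongr
  have hk0 : 0 ≤ 1 - 1 / k := by
    rw [sub_nonneg, div_le_one (by positivity)]
    exact h2
  have h5 : (1 - 1 / k) ^ (m * c) ≤ δ / (r * s * k) := by
    calc (1 - 1 / k) ^ (m * c) ≤ Real.exp (-(1 / k)) ^ (m * c) := by
          gcongr
          have := Real.add_one_le_exp (-(1 / k))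
          linarith
      _ = Real.exp (-(m * c / k)) := by rw [← Real.exp_nat_mul]; push_cast; ring_nf
      _ ≤ Real.exp (-L) := Real.exp_le_exp.2 (by linarith)
      _ = _ := h.exp_neg_log hN
  calc b * (1 - 1 / k) ^ (m * c) ≤ r * (δ / (r * s * k)) := by gcongr
    _ = δ / (s * k) := by field_simp
    _ ≤ δ := div_le_self hδ.le h.one_le_mul'

/-- The number of blocks per context. -/
theorem exists_blocks {n : ℕ} (hn : (2 : ℝ) ^ n ≤ 2 / ε ^ 2) : ∃ m : ℕ,
    m * (2 : ℝ) ^ n ≤ r * (s + k) * (16 * Real.log (r * s * k / δ)) / (128 * s * ε ^ 2) ∧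
    r * (s + k) * (16 * Real.log (r * s * k / δ)) / (256 * s * ε ^ 2 * 2 ^ n) ≤ m := by
  have h1 := h.one_le_s
  have h2 := h.one_le_k
  have h3 := h.one_le_r
  have hε := h.eps_pos
  have hL := h.le_log h.one_le_mul
  set L := Real.log (r * s * k / δ)
  set x := r * (s + k) * (16 * L) / (128 * s * ε ^ 2 * 2 ^ n) with hx
  have hx1 : 1 ≤ x := by
    rw [hx, le_div_iff₀ (by positivity)]
    have h4 : (2 : ℝ) ^ n * ε ^ 2 ≤ 2 := by rwa [le_div_iff₀ (by positivity)] at hn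
    calc 1 * (128 * s * ε ^ 2 * 2 ^ n) = 128 * s * (2 ^ n * ε ^ 2) := by ring
      _ ≤ 128 * s * 2 := by gcongr
      _ = 1 * (s + 0) * (16 * 16) := by ring
      _ ≤ _ := by gcongr; linarith
  -- As `x ≥ 1`, rounding down loses at most a factor of two.
  refine ⟨⌊x⌋₊, ?_, ?_⟩
  · have := Nat.floor_le (zero_le_one.trans hx1)
    calc (⌊x⌋₊ : ℝ) * 2 ^ n ≤ x * 2 ^ n := by gcongr
      _ = _ := by rw [hx]; field_simp
  · have h5 := Nat.lt_floor_add_one x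
    have h6 : (1 : ℝ) ≤ ⌊x⌋₊ := by exact_mod_cast (Nat.one_le_floor_iff x).2 hx1
    have : r * (s + k) * (16 * L) / (256 * s * ε ^ 2 * 2 ^ n) = x / 2 := by
      rw [hx]; field_simp; norm_num
    linarith

/-- Few visits in the final round robin are unlikely. -/
theorem roundRobin_visits {T : ℕ} {c : ℝ} (hc : 1 ≤ c)
    (hT : 4 * s * c / ε ^ 2 * Real.log (s * k / δ) ≤ T) :
    s * (Real.exp (c * Real.log (s * k / δ) / (32 * ε ^ 2)) * decay (1 / (32 * s)) ^ T) ≤ δ := by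
  have h1 := h.one_le_s
  have h2 := h.one_le_k
  have hε := h.eps_pos
  have hδ := h.delta_pos
  have hN := h.one_le_mul'
  have hL := h.le_log hN
  set L := Real.log (s * k / δ)
  have hp1 : 1 / (32 * s) ≤ 1 := by
    rw [div_le_one (by positivity)]
    linarith
  have hd := decay_pow_le (p := 1 / (32 * s)) (by positivity) hp1 T
  have h4 : c * L / (16 * ε ^ 2) ≤ 1 / (32 * s) * T / 2 := by
    calc c * L / (16 * ε ^ 2) = 1 / (32 * s) * (4 * s * c / ε ^ 2 * L) / 2 := by
          field_simp; norm_num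
      _ ≤ _ := by gcongr
  have h5 : L ≤ c * L / (32 * ε ^ 2) := by
    rw [le_div_iff₀ (by positivity)]
    have h6 := h.eps_sq_le
    nlinarith
  have h6 : Real.exp (c * L / (32 * ε ^ 2)) * decay (1 / (32 * s)) ^ T ≤ Real.exp (-L) := by
    calc Real.exp (c * L / (32 * ε ^ 2)) * decay (1 / (32 * s)) ^ T
        ≤ Real.exp (c * L / (32 * ε ^ 2)) * Real.exp (-(1 / (32 * s) * T / 2)) := by gcongr
      _ = Real.exp (c * L / (32 * ε ^ 2) - 1 / (32 * s) * T / 2) := by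
        rw [← Real.exp_add]; ring_nf
      _ ≤ Real.exp (-L) := by
        refine Real.exp_le_exp.2 ?_
        have : c * L / (16 * ε ^ 2) = 2 * (c * L / (32 * ε ^ 2)) := by field_simp; norm_num
        linarith
  rw [h.exp_neg_log hN] at h6
  calc s * (Real.exp (c * L / (32 * ε ^ 2)) * decay (1 / (32 * s)) ^ T)
      ≤ s * (δ / (s * k)) := by gcongr
    _ = δ / k := by field_simp
    _ ≤ δ := div_le_self hδ.le h2

/-- The accuracy `12 * ε` is large enough for the number of plays: `12 ^ 2 / (2 * 64) = 9 / 8`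
exceeds `1`. -/
theorem roundRobin_noise :
    s * k * (2 * Real.exp (-(Real.log (s * k / δ) / (64 * ε ^ 2) * ((12 * ε) ^ 2 / 2)))) ≤ 2 * δ := by
  have h1 := h.one_le_s
  have h2 := h.one_le_k
  have hε := h.eps_pos
  have hN := h.one_le_mul'
  have hL := h.le_log hN
  have h3 : Real.exp (-(Real.log (s * k / δ) / (64 * ε ^ 2) * ((12 * ε) ^ 2 / 2))) ≤ δ / (s * k) := by
    rw [← h.exp_neg_log hN]
    refine Real.exp_le_exp.2 ?_
    have : Real.log (s * k / δ) / (64 * ε ^ 2) * ((12 * ε) ^ 2 / 2) =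
      9 / 8 * Real.log (s * k / δ) := by field_simp; norm_num
    linarith
  calc _ ≤ s * k * (2 * (δ / (s * k))) := by gcongr
    _ = 2 * δ := by field_simp

/-- The required number of plays per arm is at least `1`, so one additional play at most doubles it.
-/
theorem roundRobin_plays {c : ℝ} (hc : 0 ≤ c) : (Real.log (s * k / δ) / (64 * ε ^ 2) + 1) * c ≤
    c * Real.log (s * k / δ) / (32 * ε ^ 2) := by
  have hε := h.eps_pos
  have hL := h.le_log h.one_le_mul'
  have h1 : 1 ≤ Real.log (s * k / δ) / (64 * ε ^ 2) := by
    rw [le_div_iff₀ (by positivity)]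
    have := h.eps_sq_le
    linarith
  have : c * Real.log (s * k / δ) / (32 * ε ^ 2) = c * (2 * (Real.log (s * k / δ) / (64 * ε ^ 2))) := by
    field_simp
    ring
  rw [this]
  nlinarith

theorem le_sqrt : 16 ≤ √(16 * Real.log (r * s * k / δ)) := by
  have hL := h.le_log h.one_le_mul
  exact Real.le_sqrt_of_sq_le (by linarith)

theorem two_pow_levels : 1 / ε ^ 2 ≤ (2 : ℝ) ^ ⌈Real.logb 2 (1 / ε ^ 2)⌉₊ := by
  have hε := h.eps_pos
  have : Real.logb 2 (1 / ε ^ 2) ≤ ⌈Real.logb 2 (1 / ε ^ 2)⌉₊ := Nat.le_ceil _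
  rwa [Real.logb_le_iff_le_rpow (by norm_num) (by positivity), Real.rpow_natCast] at this

theorem logb_pos : 0 < Real.logb 2 (1 / ε ^ 2) := by
  have hε := h.eps_pos
  refine Real.logb_pos (by norm_num) ?_
  rw [lt_div_iff₀ (by positivity)]
  linarith [h.eps_sq_le]

theorem two_pow_le {n : ℕ} (hn : n ≤ ⌈Real.logb 2 (1 / ε ^ 2)⌉₊) : (2 : ℝ) ^ n ≤ 2 / ε ^ 2 := by
  have hε := h.eps_pos
  have h1 := Nat.ceil_lt_add_one h.logb_pos.le
  have h2 : ((n : ℝ)) ≤ Real.logb 2 (1 / ε ^ 2) + 1 := le_trans (by exact_mod_cast hn) h1.le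
  calc (2 : ℝ) ^ n = (2 : ℝ) ^ (n : ℝ) := (Real.rpow_natCast _ _).symm
    _ ≤ (2 : ℝ) ^ (Real.logb 2 (1 / ε ^ 2) + 1) := by gcongr; norm_num
    _ = 2 / ε ^ 2 := by
      rw [Real.rpow_add (by norm_num), Real.rpow_logb (by norm_num) (by norm_num) (by positivity)]
      rw [Real.rpow_one]
      ring

/-- The accuracy that is reached for a group of `c` contexts. -/
theorem exists_level {c : ℝ} (hc : 0 < c) :
    1 ≤ ε * √(16 * Real.log (r * s * k / δ)) * (6 + 16 * s / (r * c)) ∨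
    ∃ n, 1 ≤ n ∧ n ≤ ⌈Real.logb 2 (1 / ε ^ 2)⌉₊ ∧
      (2 : ℝ) ^ n ≤ c * r * (s + k) / (16 * s * k * ε ^ 2) ∧
      2 * √(16 * Real.log (r * s * k / δ) / 2 ^ n) + 2 * (12 * ε) ≤
        ε * √(16 * Real.log (r * s * k / δ)) * (6 + 16 * s / (r * c)) := by
  classical
  have h1 := h.one_le_s
  have h2 := h.one_le_k
  have h3 := h.one_le_r
  have hε := h.eps_pos
  have hε8 := h.eps_le
  have hL := h.le_log h.one_le_mul
  have hsq := h.le_sqrt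
  set l := 16 * Real.log (r * s * k / δ) with hl
  set x := s / (r * c) with hx
  have hx0 : 0 < x := by positivity
  have hxe : 16 * s / (r * c) = 16 * x := by rw [hx]; ring
  rw [hxe]
  set q := c * r * (s + k) / (16 * s * k * ε ^ 2) with hq
  -- `q` bounds the block length `2 ^ n` for which the group still draws its arm; it is inversely
  -- related to the relative cost `x` of the group.
  have hqx : 1 ≤ q * (16 * ε ^ 2 * x) := by
    have : q * (16 * ε ^ 2 * x) = (s + k) / k := by
      rw [hq, hx]; field_simp
    rw [this, le_div_iff₀ (by positivity)]
    linarith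
  rcases lt_or_ge q 2 with hq2 | hq2
  -- Not even level `1` serves so small a group, but then its loss bound exceeds `1`, the largest
  -- possible gap.
  · left
    have h4 : 1 ≤ 32 * ε ^ 2 * x := by
      refine hqx.trans ?_
      have : 0 < 16 * ε ^ 2 * x := by positivity
      nlinarith
    calc (1 : ℝ) ≤ 32 * ε ^ 2 * x := h4
      _ = ε * 16 * (2 * ε * x) := by ring
      _ ≤ ε * √l * (6 + 16 * x) := by
        gcongr
        nlinarith
  · right
    have hlev1 : 1 ≤ ⌈Real.logb 2 (1 / ε ^ 2)⌉₊ := Nat.one_le_ceil_iff.2 h.logb_pos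
    set n := Nat.findGreatest (fun n => (2 : ℝ) ^ n ≤ q) ⌈Real.logb 2 (1 / ε ^ 2)⌉₊ with hn
    have hn1 : 1 ≤ n := Nat.le_findGreatest hlev1 (by simpa using hq2)
    have hnq : (2 : ℝ) ^ n ≤ q :=
      Nat.findGreatest_spec (P := fun n => (2 : ℝ) ^ n ≤ q) hlev1 (by simpa using hq2)
    have hnle : n ≤ ⌈Real.logb 2 (1 / ε ^ 2)⌉₊ := Nat.findGreatest_le _
    refine ⟨n, hn1, hnle, hnq, ?_⟩
    -- Either the largest admissible `n` is the last level, where `2 ^ n * ε ^ 2 ≥ 1`, or the next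
    -- level violates the bound `q`. In the second case `32 * x ≤ (2 + 8 * x) ^ 2` is used.
    have key : 1 ≤ 2 ^ n * (ε * (2 + 8 * x)) ^ 2 := by
      rcases hnle.eq_or_lt with heq | hlt
      · have h5 := h.two_pow_levels
        rw [← heq, div_le_iff₀ (by positivity)] at h5
        calc (1 : ℝ) ≤ 2 ^ n * ε ^ 2 := h5
          _ ≤ 2 ^ n * (ε * (2 + 8 * x)) ^ 2 := by
            gcongr
            nlinarith
      · have h5 : ¬ (2 : ℝ) ^ (n + 1) ≤ q :=
          Nat.findGreatest_is_greatest (P := fun n => (2 : ℝ) ^ n ≤ q) (Nat.lt_succ_self n) hlt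
        push Not at h5
        calc (1 : ℝ) ≤ q * (16 * ε ^ 2 * x) := hqx
          _ ≤ 2 ^ (n + 1) * (16 * ε ^ 2 * x) := by gcongr
          _ = 2 ^ n * (ε ^ 2 * (32 * x)) := by ring
          _ ≤ 2 ^ n * (ε * (2 + 8 * x)) ^ 2 := by
            rw [mul_pow]
            gcongr
            nlinarith
    have h6 : √(l / 2 ^ n) ≤ ε * (2 + 8 * x) * √l := by
      refine Real.sqrt_le_iff.2 ⟨by positivity, ?_⟩
      rw [mul_pow, Real.sq_sqrt (by positivity), div_le_iff₀ (by positivity)]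
      have : 0 ≤ l := by positivity
      nlinarith
    -- The term `24 * ε` is absorbed by `2 * ε * √l`, as `√l ≥ 16`.
    nlinarith

/-- The number of rounds of the three phases. -/
theorem budget {rn T T3 : ℕ} (hr : r = rn)
    (hT : T = ⌈r * (s + k) * (16 * Real.log (r * s * k / δ)) / ε ^ 2⌉₊)
    (hT3 : T3 = ⌈4 * s * ((⌈Real.logb 2 (1 / ε ^ 2)⌉₊ * rn : ℕ) : ℝ) / ε ^ 2 *
      Real.log (s * k / δ)⌉₊) :
    ((⌈Real.logb 2 (1 / ε ^ 2)⌉₊ * T +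
      (∑ n ∈ Finset.Icc 1 ⌈Real.logb 2 (1 / ε ^ 2)⌉₊,
        rn * ⌈8 * (16 * Real.log (r * s * k / δ)) * 2 ^ n * s⌉₊ + T3) : ℕ) : ℝ) ≤
      (40 * ⌈Real.logb 2 (1 / ε ^ 2)⌉₊ + 1024) * Real.log (r * s * k / δ) * (r * (s + k) / ε ^ 2) := by
  have h1 := h.one_le_s
  have h2 := h.one_le_k
  have h3 := h.one_le_r
  have hε := h.eps_pos
  have hδ := h.delta_pos
  have hε2 := h.eps_sq_le
  have hL := h.le_log h.one_le_mul
  have hL' := h.le_log h.one_le_mul'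
  have hLL : Real.log (s * k / δ) ≤ Real.log (r * s * k / δ) := by
    refine Real.log_le_log (by positivity) ?_
    gcongr
    nlinarith
  have hlev1 : 1 ≤ ⌈Real.logb 2 (1 / ε ^ 2)⌉₊ := Nat.one_le_ceil_iff.2 h.logb_pos
  have hpow := h.two_pow_le le_rfl
  set L := Real.log (r * s * k / δ)
  set lev := ⌈Real.logb 2 (1 / ε ^ 2)⌉₊
  have hlev1' : (1 : ℝ) ≤ lev := by exact_mod_cast hlev1
  have hinv : 1 ≤ 1 / ε ^ 2 := by
    rw [le_div_iff₀ (by positivity)]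
    linarith
  have ceil2 : ∀ x : ℝ, 1 ≤ x → (⌈x⌉₊ : ℝ) ≤ 2 * x := fun x hx => by
    have := Nat.ceil_lt_add_one (zero_le_one.trans hx)
    linarith
  have hT1 : (T : ℝ) ≤ 32 * L * (r * (s + k) / ε ^ 2) := by
    rw [hT]
    refine (ceil2 _ ?_).trans (le_of_eq (by ring))
    calc (1 : ℝ) ≤ 1 * (1 + 1) * (16 * 16) * 1 := by norm_num
      _ ≤ r * (s + k) * (16 * L) * (1 / ε ^ 2) := by gcongr
      _ = _ := by ring
  have hTn : ∀ n, ((⌈8 * (16 * L) * 2 ^ n * s⌉₊ : ℕ) : ℝ) ≤ 256 * L * s * 2 ^ n := by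
    intro n
    refine (ceil2 _ ?_).trans (le_of_eq (by ring))
    have : (1 : ℝ) ≤ 2 ^ n := one_le_pow₀ (by norm_num)
    calc (1 : ℝ) ≤ 8 * (16 * 16) * 1 * 1 := by norm_num
      _ ≤ _ := by gcongr
  -- The cost of screening grows geometrically with the level, so the last level, with `2 ^ lev ≤ 2
  -- / ε ^ 2`, determines it.
  have hsum : ∑ n ∈ Finset.Icc 1 lev, (2 : ℝ) ^ n ≤ 2 * 2 ^ lev := by
    have : ∀ N : ℕ, ∑ n ∈ Finset.Icc 1 N, (2 : ℝ) ^ n = 2 * 2 ^ N - 2 := by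
      intro N
      induction N with
      | zero => simp
      | succ N ih => rw [Finset.sum_Icc_succ_top (by omega), ih]; ring
    rw [this]
    linarith
  have hT2 : ((∑ n ∈ Finset.Icc 1 lev, rn * ⌈8 * (16 * L) * 2 ^ n * s⌉₊ : ℕ) : ℝ) ≤
      1024 * L * (r * s / ε ^ 2) := by
    push_cast
    calc ∑ n ∈ Finset.Icc 1 lev, (rn : ℝ) * (⌈8 * (16 * L) * 2 ^ n * s⌉₊ : ℝ)
        ≤ ∑ n ∈ Finset.Icc 1 lev, r * (256 * L * s * 2 ^ n) := by
          rw [hr]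
          gcongr with n _
          exact hTn n
      _ = r * (256 * L * s) * ∑ n ∈ Finset.Icc 1 lev, (2 : ℝ) ^ n := by
          rw [Finset.mul_sum]
          exact Finset.sum_congr rfl fun n _ => by ring
      _ ≤ r * (256 * L * s) * (2 * (2 / ε ^ 2)) := by
          gcongr
          exact hsum.trans (by gcongr)
      _ = _ := by ring
  have hT3' : (T3 : ℝ) ≤ 8 * lev * L * (r * s / ε ^ 2) := by
    rw [hT3]
    push_cast
    rw [← hr]
    refine (ceil2 _ ?_).trans ?_
    · calc (1 : ℝ) ≤ 4 * 1 * (1 * 1) * 1 * 16 := by norm_num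
        _ ≤ 4 * s * (lev * r) * (1 / ε ^ 2) * Real.log (s * k / δ) := by gcongr
        _ = _ := by ring
    · calc 2 * (4 * s * (lev * r) / ε ^ 2 * Real.log (s * k / δ))
          ≤ 2 * (4 * s * (lev * r) / ε ^ 2 * L) := by gcongr
        _ = _ := by ring
  have hss : r * s / ε ^ 2 ≤ r * (s + k) / ε ^ 2 := by gcongr; linarith
  push_cast at hT2 ⊢
  calc (lev : ℝ) * T + (∑ n ∈ Finset.Icc 1 lev, (rn : ℝ) * (⌈8 * (16 * L) * 2 ^ n * s⌉₊ : ℝ) + T3)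
      ≤ lev * (32 * L * (r * (s + k) / ε ^ 2)) + (1024 * L * (r * (s + k) / ε ^ 2) +
        8 * lev * L * (r * (s + k) / ε ^ 2)) := by
        gcongr
        · exact hT2.trans (by gcongr)
        · exact hT3'.trans (by gcongr)
    _ = _ := by ring

end Params

end AlmostUniform

end LumpableBandit

namespace LumpableBandit

open scoped ENNReal NNReal

/-! ### The guarantee on an almost uniform set of contexts -/

section Blocks

variable {S K : ℕ} [NeZero K] {A : Fin S → Fin K → ℝ} {ρ : Fin S → ℝ≥0}

/-- The accuracy of the learned policy at a context in a group of `c` contexts. -/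
noncomputable def blockLoss (s k r ε δ c : ℝ) : ℝ :=
  ε * √(16 * Real.log (r * s * k / δ)) * (6 + 16 * s / (r * c))

/-- The groups are the lumps within `X` that are large enough for level `n`. The failure splits into
`δ` for the visits, `2 * δ` for the noise and `δ` for the missed arms. -/
theorem cert_collect_all {X : Finset (Fin S)} (hρ : ∀ i, ρ i ≠ 0 → i ∈ X)
    (hp : ∀ i ∈ X, 1 / (32 * (X.card : ℝ)) * ∑ i, (ρ i : ℝ) ≤ ρ i) {r : ℕ} (g : Fin S → Fin r)
    {ε δ : ℝ} (h : Params X.card K r ε δ) (tgt : Fin r → Fin K) {n : ℕ}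
    (hn : n ≤ ⌈Real.logb 2 (1 / ε ^ 2)⌉₊) :
    Cert A ρ (fun _ st => (∀ q ∈ st.pairs, q.1 ∈ X ∧
        |st.est q - A q.1 q.2| < √(16 * Real.log (r * X.card * K / δ) / 2 ^ n) / 2) ∧
        ∀ b, (2 : ℝ) ^ n ≤ (X.filter fun i => g i = b).card * r * (X.card + K) /
          (16 * X.card * K * ε ^ 2) → ∃ i ∈ X, g i = b ∧ (i, tgt b) ∈ st.pairs)
      ⌈r * ((X.card : ℝ) + K) * (16 * Real.log (r * X.card * K / δ)) / ε ^ 2⌉₊ Set.univ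
      (fun _ : Unit => collect
        ⌈r * ((X.card : ℝ) + K) * (16 * Real.log (r * X.card * K / δ)) / ε ^ 2⌉₊ n none)
      fun _ => ENNReal.ofReal (4 * δ) := by
  classical
  have hε := h.eps_pos
  have hδ := h.delta_pos
  have hr := h.one_le_r
  have hL := h.le_log h.one_le_mul
  obtain ⟨m, hm1, hm2⟩ := h.exists_blocks (h.two_pow_le hn)
  set T := ⌈r * ((X.card : ℝ) + K) * (16 * Real.log (r * X.card * K / δ)) / ε ^ 2⌉₊
  have hp1 : 1 / (32 * (X.card : ℝ)) ≤ 1 := by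
    have := h.one_le_s
    rw [div_le_one (by positivity)]
    linarith
  have key := cert_collect (A := A) hρ hp1 hp
    (w := √(16 * Real.log (r * X.card * K / δ) / 2 ^ n) / 2) (by positivity) T n m none
    (Finset.univ.filter fun b : Fin r => (2 : ℝ) ^ n ≤ (X.filter fun i => g i = b).card * r *
      (X.card + K) / (16 * X.card * K * ε ^ 2)) (fun b => X.filter fun i => g i = b) tgt
    (fun b _ => Finset.filter_subset _ _) (Or.inl rfl)
  refine key.mono measurable_const le_rfl (fun _ h => h) (fun _ _ => rfl) ?_ fun _ _ => ?_
  · intro _ _ st hst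
    refine ⟨hst.accurate, fun b hb => ?_⟩
    obtain ⟨i, hi, hi'⟩ := hst.coupon b (by simpa using hb)
    obtain ⟨hiX, hib⟩ := Finset.mem_filter.1 hi
    exact ⟨i, hiX, hib, hi'⟩
  · refine ENNReal.ofReal_le_ofReal ?_
    have e1 := h.collect_visits (Nat.le_ceil _) hm1
    have e2 := h.collect_noise n
    have e3 : 2 * δ / r ≤ 2 * δ := div_le_self (by positivity) hr
    have e4 : ∑ b ∈ Finset.univ.filter (fun b : Fin r => (2 : ℝ) ^ n ≤
        (X.filter fun i => g i = b).card * r * (X.card + K) / (16 * X.card * K * ε ^ 2)),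
        (1 - 1 / (K : ℝ)) ^ (m * (X.filter fun i => g i = b).card) ≤ δ := by
      have e5 : ∀ b ∈ Finset.univ.filter (fun b : Fin r => (2 : ℝ) ^ n ≤
          (X.filter fun i => g i = b).card * r * (X.card + K) / (16 * X.card * K * ε ^ 2)),
          (1 - 1 / (K : ℝ)) ^ (m * (X.filter fun i => g i = b).card) ≤ δ / r := by
        intro b hb
        have := h.collect_coupon (b := r) (Finset.mem_filter.1 hb).2 hm2 le_rfl
        rw [le_div_iff₀ (by positivity), mul_comm]
        exact this
      refine (Finset.sum_le_card_nsmul _ _ _ e5).trans ?_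
      rw [nsmul_eq_mul]
      have : ((Finset.univ.filter (fun b : Fin r => (2 : ℝ) ^ n ≤
          (X.filter fun i => g i = b).card * r * (X.card + K) / (16 * X.card * K * ε ^ 2))).card : ℝ)
          ≤ r := by
        exact_mod_cast (Finset.card_le_univ _).trans (by simp)
      calc _ ≤ r * (δ / r) := by gcongr
        _ = δ := by field_simp
    linarith

/-- One block per context (`m = 1`) suffices, because the arm is prescribed. The failure `3 * δ / r`
is affordable in each of the `r` iterations at a level. -/
theorem cert_collect_one {X : Finset (Fin S)} (hρ : ∀ i, ρ i ≠ 0 → i ∈ X)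
    (hp : ∀ i ∈ X, 1 / (32 * (X.card : ℝ)) * ∑ i, (ρ i : ℝ) ≤ ρ i) {r ε δ : ℝ}
    (h : Params X.card K r ε δ) {n : ℕ} (hn : 1 ≤ n) (j : Fin K) :
    Cert A ρ (fun _ st => ∀ i ∈ X,
        |st.est (i, j) - A i j| < √(16 * Real.log (r * X.card * K / δ) / 2 ^ n) / 2)
      ⌈8 * (16 * Real.log (r * X.card * K / δ)) * 2 ^ n * X.card⌉₊ Set.univ
      (fun _ : Unit => collect ⌈8 * (16 * Real.log (r * X.card * K / δ)) * 2 ^ n * X.card⌉₊ n (some j))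
      fun _ => ENNReal.ofReal (3 * δ / r) := by
  have hL := h.le_log h.one_le_mul
  set T := ⌈8 * (16 * Real.log (r * X.card * K / δ)) * 2 ^ n * X.card⌉₊
  have hp1 : 1 / (32 * (X.card : ℝ)) ≤ 1 := by
    have := h.one_le_s
    rw [div_le_one (by positivity)]
    linarith
  have key := cert_collect (A := A) hρ hp1 hp
    (w := √(16 * Real.log (r * X.card * K / δ) / 2 ^ n) / 2) (by positivity) T n 1 (some j)
    (∅ : Finset Unit) (fun _ => ∅) (fun _ => j) (by simp) (Or.inr rfl)
  refine key.mono measurable_const le_rfl (fun _ h => h) (fun _ _ => rfl) ?_ fun _ _ => ?_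
  · intro _ _ st hst i hi
    exact (hst.accurate (i, j) (hst.single j rfl i (by simpa using hst.visits i hi))).2
  · refine ENNReal.ofReal_le_ofReal ?_
    have e1 := h.screen_visits hn (Nat.le_ceil _)
    have e2 := h.collect_noise n
    have e3 : 3 * δ / r = δ / r + 2 * δ / r := by ring
    simp only [Finset.sum_empty, add_zero]
    linarith

/-- The guarantee of the algorithm for almost uniform context distributions. -/
theorem cert_almostUniform {X : Finset (Fin S)} (hρ : ∀ i, ρ i ≠ 0 → i ∈ X)
    (hp : ∀ i ∈ X, 1 / (32 * (X.card : ℝ)) * ∑ i, (ρ i : ℝ) ≤ ρ i) {r : ℕ} {g : Fin S → Fin r}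
    (hg : ∀ i i', g i = g i' → ∀ j, A i j = A i' j) (hgap : ∀ i j j', A i j - A i j' ≤ 1)
    {ε δ : ℝ} (h : Params X.card K r ε δ) {fuel : ℕ} (hfuel : r ≤ fuel) {M : ℕ}
    (hM : (40 * ⌈Real.logb 2 (1 / ε ^ 2)⌉₊ + 1024) * Real.log (r * X.card * K / δ) *
      (r * ((X.card : ℝ) + K) / ε ^ 2) ≤ M) :
    Cert A ρ (fun _ π => ∀ i ∈ X, ∀ j, A i j - A i (π i) ≤
        blockLoss X.card K r ε δ (X.filter fun i' => g i' = g i).card) M Set.univ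
      (fun _ : Unit => almostUniform X.card r ε δ fuel)
      fun _ => ENNReal.ofReal (7 * (⌈Real.logb 2 (1 / ε ^ 2)⌉₊ + 1) * δ) := by
  classical
  have hε := h.eps_pos
  have hδ := h.delta_pos
  have hr := h.one_le_r
  have hs := h.one_le_s
  have hLpos := h.le_log h.one_le_mul
  -- Lumped contexts share their optimal arm, the target of the coupon argument.
  obtain ⟨tgt, htgt⟩ : ∃ tgt : Fin r → Fin K, ∀ i j, A i j ≤ A i (tgt (g i)) := by
    have : ∀ b : Fin r, ∃ j₀, ∀ i, g i = b → ∀ j, A i j ≤ A i j₀ := by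
      intro b
      by_cases hb : ∃ i, g i = b
      · obtain ⟨i₀, hi₀⟩ := hb
        obtain ⟨j₀, -, hj₀⟩ := Finset.exists_max_image Finset.univ (A i₀) Finset.univ_nonempty
        refine ⟨j₀, fun i hi j => ?_⟩
        rw [hg i i₀ (hi.trans hi₀.symm), hg i i₀ (hi.trans hi₀.symm)]
        exact hj₀ j (Finset.mem_univ _)
      · exact ⟨0, fun i hi => absurd ⟨i, hi⟩ hb⟩
    choose tgt htgt using this
    exact ⟨tgt, fun i j => htgt _ i rfl j⟩
  set lev := ⌈Real.logb 2 (1 / ε ^ 2)⌉₊ with hlev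
  set L := Real.log (r * X.card * K / δ) with hL
  set T := ⌈r * ((X.card : ℝ) + K) * (16 * L) / ε ^ 2⌉₊ with hT
  set T2 : ℕ → ℕ := fun n => ⌈8 * (16 * L) * 2 ^ n * X.card⌉₊ with hT2
  set thr : ℕ → ℝ := fun n => √(16 * L / 2 ^ n) with hthr
  set T3 : ℕ → ℕ := fun c => ⌈4 * X.card * (c : ℝ) / ε ^ 2 * Real.log (X.card * K / δ)⌉₊ with hT3
  set Good : ℕ → CollectState S K → Prop := fun n st => (∀ q ∈ st.pairs, q.1 ∈ X ∧
        |st.est q - A q.1 q.2| < thr n / 2) ∧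
        ∀ b, (2 : ℝ) ^ n ≤ (X.filter fun i => g i = b).card * r * (X.card + K) /
          (16 * X.card * K * ε ^ 2) → ∃ i ∈ X, g i = b ∧ (i, tgt b) ∈ st.pairs with hGood
  have c1 := cert_collectLevels (A := A) (ρ := ρ) T lev Good (ENNReal.ofReal (4 * δ))
    fun n _ hn => cert_collect_all hρ hp g h tgt hn
  have c2 := cert_screenLevels (A := A) (ρ := ρ) (X := X) hg T2 (thr := thr)
    (ENNReal.ofReal (3 * δ / r)) lev (fun n hn _ j => cert_collect_one hρ hp h hn j) hfuel
  have c2' := c2.comp (fun z : Unit × (ℕ → CollectState S K) => z.2) measurable_snd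
    (measurable_const (a := lev * (r * ENNReal.ofReal (3 * δ / r)))) le_rfl
    (Q' := {z | z.1 ∈ Set.univ ∧ ∀ n, 1 ≤ n → n ≤ lev → Good n (z.2 n)})
    (Post' := fun z W => W.card ≤ lev * r ∧ ∀ n, 1 ≤ n → n ≤ lev → ∀ q ∈ (z.2 n).pairs, ∃ j ∈ W,
        A q.1 q.2 - A q.1 j < 2 * thr n)
    (fun z hz => Or.inl fun n h1 h2 => (hz.2 n h1 h2).1) (fun _ _ => rfl) (fun _ _ _ h => h)
    (fun _ _ => le_rfl)
  have c3 := c2'.bind (Post' := fun _ π => ∀ i ∈ X, ∀ j, A i j - A i (π i) ≤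
      blockLoss X.card K r ε δ (X.filter fun i' => g i' = g i).card) (M' := T3 (lev * r))
    (w := ENNReal.ofReal (3 * δ))
    (k := fun z => if hW : z.2.Nonempty then
      roundRobin z.2 hW (T3 z.2.card) (fun _ => 0) (fun _ => 0) else .done fun _ => 0) ?_
  · have c4 := c1.bind (Post' := fun (_ : Unit) (π : Fin S → Fin K) => ∀ i ∈ X, ∀ j, A i j - A i (π i) ≤
      blockLoss X.card K r ε δ (X.filter fun i' => g i' = g i).card) c3
    have hbud := h.budget rfl hT (T3 := T3 (lev * r)) rfl
    refine c4.mono measurable_const ?_ (fun _ h => h) (fun _ _ => rfl) (fun _ _ _ h => h)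
      fun _ _ => ?_
    · have := hbud.trans hM
      exact Nat.cast_le.1 this
    · have e1 : (lev : ℝ≥0∞) * ENNReal.ofReal (4 * δ) = ENNReal.ofReal (lev * (4 * δ)) := by
        rw [ENNReal.ofReal_mul (p := (lev : ℝ)) (by positivity), ENNReal.ofReal_natCast]
      have e2 : (lev : ℝ≥0∞) * (r * ENNReal.ofReal (3 * δ / r)) = ENNReal.ofReal (lev * (3 * δ)) := by
        rw [ENNReal.ofReal_mul (p := (lev : ℝ)) (by positivity), ENNReal.ofReal_natCast,
          ← ENNReal.ofReal_natCast r,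
          ← ENNReal.ofReal_mul (by positivity)]
        congr 2
        field_simp
      rw [e1, e2, ← ENNReal.ofReal_add (by positivity) (by positivity),
        ← ENNReal.ofReal_add (by positivity) (by positivity)]
      refine ENNReal.ofReal_le_ofReal ?_
      have : 0 ≤ (lev : ℝ) * δ := by positivity
      nlinarith
  · refine Cert.cases measurable_const Prod.snd measurable_snd fun W => ?_
    -- At the level given by `exists_level` some context of the lump of `i` has its optimal arm in
    -- the data set. Screening keeps an arm nearly as good at that context, and hence at `i`.
    have choice : ∀ f : ℕ → CollectState S K, (∀ n, 1 ≤ n → n ≤ lev → Good n (f n)) →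
        (∀ n, 1 ≤ n → n ≤ lev → ∀ q ∈ (f n).pairs, ∃ j ∈ W, A q.1 q.2 - A q.1 j < 2 * thr n) →
        ∀ i ∈ X, 1 ≤ blockLoss X.card K r ε δ (X.filter fun i' => g i' = g i).card ∨
          ∃ j' ∈ W, ∀ j, A i j - A i j' + 2 * (12 * ε) ≤
            blockLoss X.card K r ε δ (X.filter fun i' => g i' = g i).card := by
      intro f hf hW i hi
      have hc : 0 < ((X.filter fun i' => g i' = g i).card : ℝ) := by
        have hne : (X.filter fun i' => g i' = g i).Nonempty := ⟨i, Finset.mem_filter.2 ⟨hi, rfl⟩⟩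
        exact_mod_cast hne.card_pos
      rcases h.exists_level hc with h1 | ⟨n, hn1, hn2, hn3, hn4⟩
      · exact Or.inl h1
      · right
        obtain ⟨i', hi', hgi', hpair⟩ := (hf n hn1 hn2).2 (g i) hn3
        obtain ⟨j', hj', hlt⟩ := hW n hn1 hn2 _ hpair
        refine ⟨j', hj', fun j => ?_⟩
        simp only at hlt
        rw [hg i' i hgi', hg i' i hgi'] at hlt
        have := htgt i j
        unfold blockLoss
        simp only [hthr] at hlt
        linarith
    by_cases hWne : W.Nonempty
    · by_cases hcard : W.card ≤ lev * r
      swap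
      · refine Cert.fail measurable_const ?_
        rintro z ⟨⟨-, h1, -⟩, rfl⟩
        exact absurd h1 hcard
      have hWc : (1 : ℝ) ≤ W.card := by exact_mod_cast hWne.card_pos
      have hL3 := h.le_log h.one_le_mul'
      have c5 := cert_roundRobin (A := A) (ρ := ρ) (X := X) (p := 1 / (32 * (X.card : ℝ)))
        (w := 12 * ε) (M := W.card * Real.log (X.card * K / δ) / (32 * ε ^ 2))
        (n₀ := Real.log (X.card * K / δ) / (64 * ε ^ 2))
        (by rw [div_le_one (by positivity)]; linarith) hp (by positivity)
        (div_pos (by linarith) (by positivity)) W hWne (h.roundRobin_plays (by positivity))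
        (T3 W.card)
      refine c5.comp (fun _ => ()) measurable_const measurable_const ?_ (fun _ _ => Or.inl trivial)
        ?_ ?_ fun _ _ => ?_
      · simp only [hT3]
        refine Nat.ceil_le_ceil ?_
        have : 0 ≤ Real.log (X.card * K / δ) := by linarith
        gcongr
      · rintro z ⟨-, rfl⟩
        simp [hWne]
      · rintro z ⟨⟨⟨-, hf⟩, -, hW⟩, rfl⟩ π hπ i hi j
        rcases choice z.1.2 hf hW i hi with h1 | ⟨j', hj', h1⟩
        · exact (hgap i j (π i)).trans h1
        · have := hπ i hi j' hj'
          have := h1 j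
          linarith
      · refine ENNReal.ofReal_le_ofReal ?_
        have e1 := h.roundRobin_visits hWc (Nat.le_ceil _)
        have e2 := h.roundRobin_noise
        simp only [hT3]
        linarith
    -- With no candidates, the loss bound is at least `1` at all contexts of `X`, so the arbitrary
    -- policy is good enough.
    · refine Cert.done measurable_const (fun _ _ => 0) measurable_const ?_ ?_
      · rintro z ⟨-, rfl⟩
        simp [hWne]
      · rintro z ⟨⟨⟨-, hf⟩, -, hW⟩, rfl⟩
        refine Or.inl fun i hi j => ?_
        rcases choice z.1.2 hf hW i hi with h1 | ⟨j', hj', h1⟩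
        · exact (hgap i j _).trans h1
        · exact absurd ⟨j', hj'⟩ hWne

end Blocks

end LumpableBandit

namespace LumpableBandit

open scoped ENNReal NNReal

/-! ### Estimation of the context distribution -/

section Observe

variable {S K : ℕ} [NeZero K] {A : Fin S → Fin K → ℝ} {ν : Fin S → ℝ≥0}

/-- The potential of many visits of a context of probability `p`. -/
noncomputable def crowdPot (M p : ℝ) (T k : ℕ) : ℝ≥0∞ :=
  ENNReal.ofReal (Real.exp (k - M) * (1 + p * (Real.exp 1 - 1)) ^ T)

theorem stepLE_crowdPot (act : Fin K → Fin S → Fin K) (i₀ : Fin S)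
    (hν : ∑ i, (ν i : ℝ) = 1) (M : ℝ) (T k : ℕ) (k' : Fin S → ℕ)
    (hk : ∀ i, k' i = if i = i₀ then k + 1 else k) :
    StepLE A ν act (fun _ i _ => crowdPot M (ν i₀) T (k' i)) (crowdPot M (ν i₀) (T + 1) k) := by
  have he : 0 ≤ Real.exp 1 - 1 := by linarith [Real.add_one_le_exp (1 : ℝ)]
  refine (stepLE_visit act (Real.exp_pos 1).le ?_ (crowdPot M (ν i₀) T k) (i₀ := i₀)
    (p := ν i₀)).mono (fun u i y _ => ?_) ?_
  · rw [hν]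
    simp
  · rw [hk]
    split_ifs
    · unfold crowdPot
      rw [← ENNReal.ofReal_mul (Real.exp_pos _).le, ← mul_assoc, ← Real.exp_add]
      push_cast
      ring_nf
      rfl
    · rfl
  · unfold crowdPot
    rw [← ENNReal.ofReal_mul (by positivity)]
    refine ENNReal.ofReal_le_ofReal (le_of_eq ?_)
    ring

/-- As `exp 1 - 1 ≤ 2`, the growth over `J` rounds is at most `exp (2 * J * p)`, which uses up half
of the exponent `M`. -/
theorem crowdPot_zero_le {M p : ℝ} (hp : 0 ≤ p) {J : ℕ} (hM : 4 * (J * p) ≤ M) :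
    crowdPot M p J 0 ≤ ENNReal.ofReal (Real.exp (-(M / 2))) := by
  have he : 0 ≤ Real.exp 1 - 1 := by linarith [Real.add_one_le_exp (1 : ℝ)]
  have he2 : Real.exp 1 - 1 ≤ 2 := by linarith [Real.exp_one_lt_d9]
  refine ENNReal.ofReal_le_ofReal ?_
  calc Real.exp ((0 : ℕ) - M) * (1 + p * (Real.exp 1 - 1)) ^ J
      ≤ Real.exp ((0 : ℕ) - M) * Real.exp (p * 2) ^ J := by
        gcongr
        have := Real.add_one_le_exp (p * 2)
        nlinarith
    _ = Real.exp (2 * (J * p) - M) := by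
        rw [← Real.exp_nat_mul, ← Real.exp_add]
        push_cast
        ring_nf
    _ ≤ Real.exp (-(M / 2)) := Real.exp_le_exp.2 (by linarith)

/-- The counts `cnt` of `J` independent contexts of law `ν` are accurate up to a constant factor for
all contexts with at least of order `Λ` visits. -/
structure CountsGood (ν : Fin S → ℝ≥0) (J : ℕ) (Λ : ℝ) (cnt : Fin S → ℕ) : Prop where
  le_total : ∀ i, cnt i ≤ J
  lower : ∀ i, 8 * Λ ≤ J * ν i → J * ν i / 4 ≤ cnt i
  upper : ∀ i, 2 * Λ ≤ cnt i → (cnt i : ℝ) ≤ 4 * (J * ν i)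

/-- A context counted in `lower` falls short with probability at most `exp (-(J * ν i / 4))`, where
`J * ν i ≥ 8 * Λ`. For `upper` the threshold `max (2 * Λ) (4 * (J * ν i))` fails with probability at
most `exp (-Λ)`. -/
theorem cert_observe (hν : ∑ i, (ν i : ℝ) = 1) (J : ℕ) {Λ : ℝ} (hΛ : 0 ≤ Λ) :
    Cert A ν (fun _ => CountsGood ν J Λ) J Set.univ
      (fun _ : Unit => observe (K := K) J fun _ => 0)
      fun _ => ENNReal.ofReal (2 * (S * Real.exp (-Λ))) := by
  classical
  have hν1 : ∀ i, (ν i : ℝ) ≤ 1 := fun i => by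
    rw [← hν]
    exact Finset.single_le_sum (f := fun i => (ν i : ℝ)) (fun i _ => (ν i).coe_nonneg)
      (Finset.mem_univ i)
  set many : Finset (Fin S) := Finset.univ.filter fun i => 8 * Λ ≤ J * ν i with hmany
  set k : Fin S → ℝ := fun i => max (2 * Λ) (4 * (J * ν i)) with hk
  -- The last term encodes the deterministic bound on the counts. It depends on the number of
  -- remaining rounds, so it is a potential rather than part of the invariant, and it is zero at the
  -- start.
  set V : ℕ → (Fin S → ℕ) → ℝ≥0∞ := fun T cnt =>
    ((∑ i ∈ many, visitPot (J * ν i / 4) (decay (ν i)) T (cnt i)) +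
      ∑ i, crowdPot (k i) (ν i) T (cnt i)) + if ∀ i, cnt i + T ≤ J then 0 else 1 with hV
  have key := Cert.loop (A := A) (ρ := ν) (fun T cnt => observe (K := K) T cnt) (fun cnt => cnt)
    measurable_id (fun _ _ _ => 0) measurable_const
    (fun z => Function.update z.1 z.2.2.1 (z.1 z.2.2.1 + 1))
    ((measurable_of_countable fun z : (Fin S → ℕ) × Fin S => Function.update z.1 z.2 (z.1 z.2 + 1)).comp
      (f := fun z : (Fin S → ℕ) × Fin K × Fin S × ℝ => (z.1, z.2.2.1)) (by fun_prop))
    (fun _ => rfl) (fun _ _ => rfl) Set.univ V (fun T => measurable_of_countable _)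
    (CountsGood ν J Λ) ?_ (fun _ _ _ _ _ _ _ => Or.inl trivial) ?_ J
  · refine key.comp (fun _ => fun _ => 0) measurable_const measurable_const le_rfl
      (fun _ _ => Or.inl trivial) (fun _ _ => rfl) (fun _ _ _ h => h) fun _ _ => ?_
    have e1 : ∑ i ∈ many, visitPot (J * ν i / 4) (decay (ν i)) J 0 ≤
        S * ENNReal.ofReal (Real.exp (-Λ)) := by
      refine (Finset.sum_le_card_nsmul _ _ (ENNReal.ofReal (Real.exp (-Λ))) fun i hi => ?_).trans ?_
      · have h8 := (Finset.mem_filter.1 hi).2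
        refine ENNReal.ofReal_le_ofReal ?_
        calc Real.exp (J * ν i / 4 - (0 : ℕ)) * decay (ν i) ^ J
            ≤ Real.exp (J * ν i / 4 - (0 : ℕ)) * Real.exp (-(ν i * J / 2)) := by
              gcongr
              exact decay_pow_le (ν i).coe_nonneg (hν1 i) J
          _ = Real.exp (-(J * ν i / 4)) := by
              rw [← Real.exp_add]
              push_cast
              ring_nf
          _ ≤ _ := Real.exp_le_exp.2 (by linarith)
      · rw [nsmul_eq_mul]
        gcongr
        simpa using Finset.card_le_univ many
    have e2 : ∑ i, crowdPot (k i) (ν i) J 0 ≤ S * ENNReal.ofReal (Real.exp (-Λ)) := by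
      refine (Finset.sum_le_card_nsmul _ _ (ENNReal.ofReal (Real.exp (-Λ))) fun i _ => ?_).trans ?_
      · refine (crowdPot_zero_le (ν i).coe_nonneg (le_max_right _ _)).trans ?_
        refine ENNReal.ofReal_le_ofReal (Real.exp_le_exp.2 ?_)
        have := le_max_left (2 * Λ) (4 * (J * ν i))
        linarith
      · simp [nsmul_eq_mul]
    have e3 : ENNReal.ofReal (2 * (S * Real.exp (-Λ))) =
        S * ENNReal.ofReal (Real.exp (-Λ)) + S * ENNReal.ofReal (Real.exp (-Λ)) := by
      rw [two_mul, ENNReal.ofReal_add (by positivity) (by positivity),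
        ENNReal.ofReal_mul (by positivity), ENNReal.ofReal_natCast]
    rw [e3]
    have e4 : ∀ i : Fin S, 0 + J ≤ J := fun _ => (zero_add J).le
    simp only [hV, if_pos e4, add_zero]
    exact add_le_add e1 e2
  · intro cnt _
    by_cases h0 : ∀ i, cnt i + 0 ≤ J
    swap
    · right
      simp only [hV, if_neg h0]
      exact le_add_self
    by_cases h1 : ∀ i, 8 * Λ ≤ J * ν i → J * ν i / 4 ≤ cnt i
    swap
    · right
      push Not at h1
      obtain ⟨i, hi, hlt⟩ := h1
      refine le_trans ?_ ((le_self_add : _ ≤ _ + _).trans le_self_add)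
      refine le_trans ?_ (Finset.single_le_sum (f := fun i => visitPot (J * ν i / 4) (decay (ν i)) 0
        (cnt i)) (fun _ _ => zero_le) (Finset.mem_filter.2 ⟨Finset.mem_univ i, hi⟩))
      exact one_le_visitPot hlt.le
    by_cases h2 : ∀ i, 2 * Λ ≤ cnt i → (cnt i : ℝ) ≤ 4 * (J * ν i)
    · exact Or.inl ⟨h0, h1, h2⟩
    · right
      push Not at h2
      obtain ⟨i, hi, hlt⟩ := h2
      refine le_trans ?_ ((le_add_self : _ ≤ _ + _).trans le_self_add)
      refine le_trans ?_ (Finset.single_le_sum (f := fun i => crowdPot (k i) (ν i) 0 (cnt i))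
        (fun _ _ => zero_le) (Finset.mem_univ i))
      unfold crowdPot
      rw [pow_zero, mul_one, ENNReal.one_le_ofReal]
      refine Real.one_le_exp (sub_nonneg.2 (max_le hi hlt.le))
  · intro T cnt _
    have hupd : ∀ i i₀ : Fin S, Function.update cnt i (cnt i + 1) i₀ =
        if i = i₀ then cnt i₀ + 1 else cnt i₀ := by
      intro i i₀
      by_cases h : i = i₀
      · subst h; simp
      · simp [h, Function.update_of_ne (Ne.symm h)]
    refine StepLE.add (StepLE.add (StepLE.sum _ (fun i₀ _ => ?_) ?_) (StepLE.sum _ (fun i₀ _ => ?_) ?_) ?_)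
      (StepLE.of_forall ?_) ?_
    · exact stepLE_visitPot (fun _ _ => 0) (hν1 i₀) (by rw [hν, mul_one]) _ T (cnt i₀)
        (fun _ i => Function.update cnt i (cnt i + 1) i₀) fun _ i => hupd i i₀
    · intro _ _ _ _
      dsimp only
      exact measurable_const
    · exact stepLE_crowdPot (fun _ _ => 0) i₀ hν _ T (cnt i₀)
        (fun i => Function.update cnt i (cnt i + 1) i₀) fun i => hupd i i₀
    · intro _ _ _ _
      dsimp only
      exact measurable_const
    · intro _ _
      dsimp only
      exact measurable_const
    · intro u i _ μ _ _
      refine (lintegral_mono (g := fun _ => if ∀ i, cnt i + (T + 1) ≤ J then 0 else 1)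
        fun y => ?_).trans (by rw [lintegral_const, measure_univ, mul_one])
      dsimp only
      by_cases h : ∀ i, cnt i + (T + 1) ≤ J
      · rw [if_pos h, if_pos]
        intro i₀
        have := h i₀
        rw [hupd]
        split_ifs <;> omega
      · rw [if_neg h]
        split_ifs <;> simp
    · intro _ _
      dsimp only
      exact measurable_const

end Observe

end LumpableBandit

namespace LumpableBandit

open scoped ENNReal NNReal

/-! ### Certificates without a guarantee -/

section Unconditional

variable {S K : ℕ} [NeZero K] {A : Fin S → Fin K → ℝ} {ρ : Fin S → ℝ≥0}

/-- The family `p` of programs is measurable and stops within `M` rounds. -/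
def Runs {α : Type} [MeasurableSpace α] {β : Type} [MeasurableSpace β] (A : Fin S → Fin K → ℝ)
    (ρ : Fin S → ℝ≥0) (M : ℕ) (p : β → Prog S K α) : Prop :=
  Cert A ρ (fun _ _ => True) M Set.univ p fun _ => 0

variable {α β γ : Type} [MeasurableSpace α] [MeasurableSpace β] [MeasurableSpace γ] {M M' : ℕ}

omit [NeZero K] in
theorem Runs.comp {p : β → Prog S K α} (h : Runs A ρ M p) {f : γ → β} (hf : Measurable f) :
    Runs A ρ M fun c => p (f c) :=
  Cert.comp h f hf measurable_const le_rfl (fun _ _ => Or.inl trivial) (fun _ _ => rfl)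
    (fun _ _ _ h => h) fun _ _ => le_rfl

omit [NeZero K] in
theorem Runs.done {a : β → α} (ha : Measurable a) : Runs A ρ M fun b => .done (a b) :=
  Cert.done measurable_const a ha (fun _ _ => rfl) fun _ _ => Or.inl trivial

omit [NeZero K] in
theorem Runs.cases {D : Type} [Countable D] [MeasurableSpace D] [DiscreteMeasurableSpace D]
    {p : D → β → Prog S K α} (h : ∀ d, Runs A ρ M (p d)) {g : β → D} (hg : Measurable g) :
    Runs A ρ M fun b => p (g b) b := by
  refine Cert.cases measurable_const g hg fun d => ?_
  refine (h d).mono measurable_const le_rfl (fun _ _ => trivial) ?_ (fun _ _ _ h => h)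
    fun _ _ => le_rfl
  rintro b ⟨-, rfl⟩
  rfl

theorem Runs.bind {p : β → Prog S K α} (h : Runs A ρ M p) {k : β × α → Prog S K γ}
    (hk : Runs A ρ M' k) : Runs A ρ (M + M') fun b => (p b).bind fun a => k (b, a) := by
  have hk' : Cert A ρ (fun (_ : β × α) (_ : γ) => True) M'
      {z | z.1 ∈ Set.univ ∧ True} k fun _ => 0 :=
    Cert.mono hk measurable_const le_rfl (fun _ _ => trivial) (fun _ _ => rfl) (fun _ _ _ h => h)
      fun _ _ => le_rfl
  exact (Cert.bind (Post' := fun _ _ => True) h hk').mono measurable_const le_rfl (fun _ h => h)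
    (fun _ _ => rfl) (fun _ _ _ h => h) fun _ _ => by simp

theorem runs_collect (T n : ℕ) (𝒦 : Option (Fin K)) :
    Runs A ρ T fun _ : β => collect (S := S) T n 𝒦 := by
  have hact : Measurable fun (st : CollectState S K) (u : Fin K) (i : Fin S) => st.arm 𝒦 u i :=
    measurable_pi_lambda _ fun u => measurable_pi_lambda _ fun i =>
      CollectState.measurable_arm 𝒦 u i
  have : Runs A ρ T fun st => collectFrom n 𝒦 T st :=
    Cert.loop (A := A) (ρ := ρ) (collectFrom n 𝒦) id measurable_id
      (fun (st : CollectState S K) u i => st.arm 𝒦 u i) hact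
      (fun z => z.1.update n z.2.2.1 (z.1.arm 𝒦 z.2.1 z.2.2.1) z.2.2.2)
      (CollectState.measurable_step n 𝒦) (fun _ => rfl) (fun _ _ => rfl) Set.univ (fun _ _ => 0)
      (fun _ => measurable_const) (fun _ => True) (fun _ _ => Or.inl trivial)
      (fun _ _ _ _ _ _ _ => Or.inl trivial) (fun _ _ _ => StepLE.const _ _) T
  exact this.comp measurable_const

theorem runs_collectLevels (T n : ℕ) : Runs A ρ (n * T)
    fun _ : β => collectLevels (S := S) (K := K) T n := by
  have := cert_collectLevels (A := A) (ρ := ρ) T n (fun _ _ => True) 0 fun k _ _ =>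
    runs_collect (A := A) (ρ := ρ) T k none
  have h : Runs A ρ (n * T) fun _ : Unit => collectLevels (S := S) (K := K) T n :=
    this.mono measurable_const le_rfl (fun _ h => h) (fun _ _ => rfl) (fun _ _ _ _ => trivial)
      fun _ _ => by simp
  exact h.comp (f := fun _ => ()) measurable_const

theorem runs_screen (T n : ℕ) (thr : ℝ) (fuel : ℕ) :
    ∀ (D : Finset (Fin S × Fin K)) (W : Finset (Fin K)),
      Runs A ρ (fuel * T) fun est => screen T n thr est fuel D W := by
  classical
  induction fuel with
  | zero => exact fun _ _ => Runs.done measurable_const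
  | succ fuel ih =>
    intro D W
    by_cases hD : D.Nonempty
    swap
    · have hD0 : D = ∅ := by simpa using hD
      subst hD0
      have : (fun est => screen T n thr est (fuel + 1) (∅ : Finset (Fin S × Fin K)) W) =
          fun _ => .done W := by
        funext est
        simp [screen]
        rfl
      rw [this]
      exact Runs.done measurable_const
    have hm : ∀ b : Fin S × Fin K, Measurable fun z : (Fin S × Fin K → ℝ) × CollectState S K =>
        D.filter fun q => thr ≤ |z.2.est (q.1, b.2) - z.1 b| := by
      intro b
      refine measurable_filter_finset D (measurable_pi_lambda _ fun q =>
        measurableSet_setOfPred.1 (measurableSet_le measurable_const ?_))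
      have e1 : Measurable fun z : (Fin S × Fin K → ℝ) × CollectState S K =>
        z.2.est (q.1, b.2) := by fun_prop
      have e2 : Measurable fun z : (Fin S × Fin K → ℝ) × CollectState S K => z.1 b := by fun_prop
      exact measurable_norm.comp (e1.sub e2)
    have h1 : ∀ b : Fin S × Fin K, Runs A ρ ((fuel + 1) * T) fun est : Fin S × Fin K → ℝ =>
        (collect T n (some b.2)).bind fun d => screen T n thr est fuel
          (D.filter fun q => thr ≤ |d.est (q.1, b.2) - est b|) (insert b.2 W) := by
      intro b
      have h2 := Runs.cases (fun D' => (ih D' (insert b.2 W)).comp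
        (measurable_fst (α := Fin S × Fin K → ℝ) (β := CollectState S K))) (hm b)
      have h3 := (runs_collect (A := A) (ρ := ρ) (β := Fin S × Fin K → ℝ) T n (some b.2)).bind h2
      rw [add_mul, one_mul, add_comm]
      exact h3
    have h2 := Runs.cases h1 (measurable_argmaxOn D hD)
    have : (fun est => screen T n thr est (fuel + 1) D W) = fun est =>
        (collect T n (some (argmaxOn D hD est).2)).bind fun d => screen T n thr est fuel
          (D.filter fun q => thr ≤ |d.est (q.1, (argmaxOn D hD est).2) - est (argmaxOn D hD est)|)
          (insert (argmaxOn D hD est).2 W) := by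
      funext est
      rw [screen, dif_pos hD]
      congr!
    rw [this]
    exact h2

theorem runs_screenLevels (T : ℕ → ℕ) (thr : ℕ → ℝ) (fuel n : ℕ) :
    ∃ M, Runs A ρ M fun f : ℕ → CollectState S K => screenLevels T thr fuel f n := by
  induction n with
  | zero => exact ⟨0, Runs.done measurable_const⟩
  | succ n ih =>
    obtain ⟨M, h⟩ := ih
    have hm : Measurable fun z : (ℕ → CollectState S K) × Finset (Fin K) =>
        ((z.1 (n + 1)).pairs, z.2) := by fun_prop
    have he : Measurable fun z : (ℕ → CollectState S K) × Finset (Fin K) =>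
        (z.1 (n + 1)).est := by fun_prop
    have h2 := Runs.cases (fun d : Finset (Fin S × Fin K) × Finset (Fin K) =>
      (runs_screen (A := A) (ρ := ρ) (T (n + 1)) (n + 1) (thr (n + 1)) fuel d.1 d.2).comp he) hm
    exact ⟨_, h.bind h2⟩

theorem runs_roundRobin (W : Finset (Fin K)) (hW : W.Nonempty) (T : ℕ) :
    Runs A ρ T fun _ : β => roundRobin (S := S) W hW T (fun _ => 0) fun _ => 0 := by
  have h : Runs A ρ T fun s : (Fin S × Fin K → ℕ) × (Fin S × Fin K → ℝ) => roundRobin W hW T s.1 s.2 :=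
    Cert.loop_roundRobin W hW Set.univ (fun _ _ => 0) (fun _ => measurable_const) (fun _ => True)
      (fun _ _ => Or.inl trivial) (fun _ _ _ _ _ _ _ => Or.inl trivial)
      (fun _ _ _ => StepLE.const _ _) T
  exact h.comp (f := fun _ => (fun _ => 0, fun _ => 0)) measurable_const

/-- For an empty bucket, or one whose accuracy is too coarse for `Params`, no guarantee is needed,
but the algorithm goes on afterwards. Sequential composition then still requires a certificate, with
its measurability and its bound on the number of rounds. -/
theorem runs_almostUniform (s r : ℕ) (ε δ : ℝ) (fuel : ℕ) :
    ∃ M, Runs A ρ M fun _ : Unit => almostUniform (S := S) (K := K) s r ε δ fuel := by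
  classical
  set lev := ⌈Real.logb 2 (1 / ε ^ 2)⌉₊
  set lg := 16 * Real.log (r * s * K / δ)
  set T := ⌈r * (s + K) * lg / ε ^ 2⌉₊
  set T3 : ℕ → ℕ := fun c => ⌈4 * s * (c : ℝ) / ε ^ 2 * Real.log (s * K / δ)⌉₊
  obtain ⟨M, h2⟩ := runs_screenLevels (A := A) (ρ := ρ) (fun n => ⌈8 * lg * 2 ^ n * s⌉₊)
    (fun n => √(lg / 2 ^ n)) fuel lev
  have h3 := Runs.cases (A := A) (ρ := ρ) (M := Finset.univ.sup fun W : Finset (Fin K) => T3 W.card)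
    (p := fun W (_ : (Unit × (ℕ → CollectState S K)) × Finset (Fin K)) => if hW : W.Nonempty then
      roundRobin (S := S) W hW (T3 W.card) (fun _ => 0) (fun _ => 0) else .done fun _ => 0)
    (fun W => by
      by_cases hW : W.Nonempty
      · simp only [hW, dif_pos]
        have := Finset.le_sup (f := fun W : Finset (Fin K) => T3 W.card) (Finset.mem_univ W)
        exact Cert.mono (runs_roundRobin W hW (T3 W.card)) measurable_const this (fun _ h => h)
          (fun _ _ => rfl) (fun _ _ _ h => h) fun _ _ => le_rfl
      · simp only [hW, dif_neg, not_false_eq_true]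
        exact Runs.done measurable_const)
    (measurable_snd)
  exact ⟨_, (runs_collectLevels (A := A) (ρ := ρ) (β := Unit) T lev).bind
    ((h2.comp measurable_snd).bind h3)⟩

/-- A window for an arbitrary run. -/
theorem runs_restrict_almostUniform {ν : Fin S → ℝ≥0} (hν : ∑ i, (ν i : ℝ) = 1)
    (X : Finset (Fin S)) (s r : ℕ) (ε δ : ℝ) (fuel N : ℕ) : Runs A ν N
      fun _ : Unit => (almostUniform (S := S) (K := K) s r ε δ fuel).restrict X N := by
  obtain ⟨M, h⟩ := runs_almostUniform (A := A) (ρ := fun i => if i ∈ X then ν i else 0) s r ε δ fuel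
  unfold Runs at h
  have hν' : ∑ i, (ν i : ℝ≥0∞) = 1 := by
    rw [← ENNReal.ofNNReal_finsetSum]
    exact_mod_cast hν
  -- With `c := True` a run cut off by the window is acceptable, so the potential of the window can
  -- be zero.
  exact (Cert.restrict (measurable_of_countable _) X (fun _ _ => 0) (c := True) (Or.inl trivial) hν'
    (fun _ _ => by simp) h N).mono measurable_const le_rfl (fun _ h => h) (fun _ _ => rfl)
    (fun _ _ _ _ => trivial) fun _ _ => by simp

end Unconditional

/-! ### The buckets -/

section Buckets

variable {S K : ℕ} [NeZero K] {A : Fin S → Fin K → ℝ} {ν : Fin S → ℝ≥0}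

/-- Chernoff's bound for the number of rounds with context in `X`: the potential is `exp M * decay p
^ N`, with `N` rounds left in the window, `M` rounds possibly still needed and `p` the probability
of `X`. It is preserved exactly in expectation, and is at least `1` if the window ends early. -/
theorem cert_restrict (hν : ∑ i, (ν i : ℝ) = 1) (X : Finset (Fin S)) {p : Prog S K (Fin S → Fin K)}
    {Post : (Fin S → Fin K) → Prop} {M : ℕ} {v : ℝ≥0∞}
    (h : Cert A (fun i => if i ∈ X then ν i else 0) (fun _ => Post) M Set.univ (fun _ : Unit => p)
      fun _ => v) (N : ℕ) :
    Cert A ν (fun _ o => ∃ a, o = some a ∧ Post a) N Set.univ (fun _ : Unit => p.restrict X N)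
      fun _ => v + ENNReal.ofReal (Real.exp M * decay (∑ i ∈ X, (ν i : ℝ)) ^ N) := by
  have hν' : ∑ i, (ν i : ℝ≥0∞) = 1 := by
    rw [← ENNReal.ofNNReal_finsetSum]
    exact_mod_cast hν
  have hX1 : ∑ i ∈ X, (ν i : ℝ) ≤ 1 := by
    rw [← hν]
    exact Finset.sum_le_univ_sum_of_nonneg fun i => (ν i).coe_nonneg
  have hd := (decay_pos hX1).le
  have hcoe : ∀ Y : Finset (Fin S), ∑ i ∈ Y, (ν i : ℝ≥0∞) = ENNReal.ofReal (∑ i ∈ Y, (ν i : ℝ)) := by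
    intro Y
    rw [ENNReal.ofReal_sum_of_nonneg fun i _ => (ν i).coe_nonneg]
    exact Finset.sum_congr rfl fun i _ => ENNReal.ofReal_coe_nnreal.symm
  have hcompl : ∑ i ∈ Xᶜ, (ν i : ℝ) = 1 - ∑ i ∈ X, (ν i : ℝ) := by
    rw [← hν, ← Finset.sum_add_sum_compl X]
    ring
  refine (Cert.restrict (measurable_of_countable _) X (fun N M => ENNReal.ofReal (Real.exp M *
    decay (∑ i ∈ X, (ν i : ℝ)) ^ N)) (c := False) (Or.inr fun M => ?_) hν' (fun N M => ?_) h N).mono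
    measurable_const le_rfl (fun _ h => h) (fun _ _ => rfl) (fun _ _ o ho => ?_) fun _ _ => le_rfl
  · rw [pow_zero, mul_one, ENNReal.one_le_ofReal]
    exact Real.one_le_exp (by positivity)
  · have h0 : 0 ≤ ∑ i ∈ X, (ν i : ℝ) := Finset.sum_nonneg fun i _ => (ν i).coe_nonneg
    rw [hcoe, hcoe, hcompl, ← ENNReal.ofReal_mul h0, ← ENNReal.ofReal_mul (by linarith),
      ← ENNReal.ofReal_add (by positivity)
        (mul_nonneg (by linarith) (by positivity))]
    refine ENNReal.ofReal_le_ofReal (le_of_eq ?_)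
    have e : Real.exp M = Real.exp ((M + 1 : ℕ) : ℝ) * Real.exp (-1) := by
      rw [← Real.exp_add]
      push_cast
      ring_nf
    rw [e, pow_succ]
    unfold decay
    ring
  · simpa using ho

/-- Compared with an arbitrary policy, `π` loses at most `B` on the contexts in `X`. -/
def LossLE (A : Fin S → Fin K → ℝ) (ν : Fin S → ℝ≥0) (X : Finset (Fin S)) (B : ℝ)
    (π : Fin S → Fin K) : Prop :=
  ∀ π' : Fin S → Fin K, ∑ i ∈ X, (ν i : ℝ) * (A i (π' i) - A i (π i)) ≤ B

omit [NeZero K] in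
theorem LossLE.congr {X : Finset (Fin S)} {B : ℝ} {π π' : Fin S → Fin K} (h : LossLE A ν X B π)
    (hπ : ∀ i ∈ X, π' i = π i) : LossLE A ν X B π' := by
  intro π''
  rw [Finset.sum_congr rfl fun i hi => by rw [hπ i hi]]
  exact h π''

theorem cert_learnBuckets (r : ℕ) (ε δ : ℝ) (N : ℕ) (νhat : Fin S → ℝ) (B : ℝ) (φ : ℝ≥0∞) (n : ℕ)
    (h : ∀ l < n, Cert A ν (fun _ o => LossLE A ν (bucket νhat l) B (o.getD fun _ => 0)) N Set.univ
      (fun _ : Unit => (almostUniform (bucket νhat l).card r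
        (ε * √(2 / ∑ i ∈ bucket νhat l, νhat i)) δ N).restrict (bucket νhat l) N) fun _ => φ) :
    Cert A ν (fun _ π => ∀ l < n, LossLE A ν (bucket νhat l) B π) (n * N) Set.univ
      (fun _ : Unit => learnBuckets r ε δ N νhat n) fun _ => n * φ := by
  classical
  induction n with
  | zero =>
    exact Cert.done measurable_const (fun _ _ => 0) measurable_const (fun _ _ => rfl)
      fun _ _ => Or.inl fun l h => by omega
  | succ n ih =>
    have h1 := ih fun l hl => h l (by omega)
    have h2 := (h n (by omega)).comp (fun _ : Unit × (Fin S → Fin K) => ()) measurable_const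
      (measurable_const (a := φ)) le_rfl
      (Q' := {z | z.1 ∈ Set.univ ∧ ∀ l < n, LossLE A ν (bucket νhat l) B z.2})
      (Post' := fun _ o => LossLE A ν (bucket νhat n) B (o.getD fun _ => 0))
      (fun _ _ => Or.inl trivial) (fun _ _ => rfl) (fun _ _ _ h => h) (fun _ _ => le_rfl)
    have h3 := h2.bind (Post' := fun _ π => ∀ l < n + 1, LossLE A ν (bucket νhat l) B π) (M' := 0)
      (w := 0) (k := fun z => .done fun i => if i ∈ bucket νhat n then z.2.getD (fun _ => 0) i
        else z.1.2 i)
      (Cert.done measurable_const (fun z i => if i ∈ bucket νhat n then z.2.getD (fun _ => 0) i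
        else z.1.2 i)
        ((measurable_of_countable fun d : (Fin S → Fin K) × Option (Fin S → Fin K) => fun i =>
          if i ∈ bucket νhat n then d.2.getD (fun _ => 0) i else d.1 i).comp
          (f := fun z : (Unit × (Fin S → Fin K)) × Option (Fin S → Fin K) => (z.1.2, z.2))
          (by fun_prop)) (fun _ _ => rfl) (by
          rintro z ⟨⟨-, hz⟩, hz'⟩
          refine Or.inl fun l hl => ?_
          rcases Nat.lt_succ_iff_lt_or_eq.1 hl with hl | rfl
          -- Different buckets are disjoint, so gluing in a new policy leaves the earlier buckets
          -- untouched.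
          · refine (hz l hl).congr fun i hi => if_neg fun hi' => ?_
            have h4 := (Finset.mem_filter.1 hi).2.1
            have h5 := (Finset.mem_filter.1 hi').2.2
            have h6 : (1 / 2 : ℝ) ^ n ≤ (1 / 2) ^ (l + 1) :=
              pow_le_pow_of_le_one (by norm_num) (by norm_num) hl
            linarith
          · exact LossLE.congr hz' fun i hi => if_pos hi))
    simp only [add_zero] at h3
    refine (h1.bind h3).mono measurable_const (by rw [add_mul, one_mul]) (fun _ h => h)
      (fun _ _ => ?_) (fun _ _ _ h => h) fun _ _ => ?_
    · rw [learnBuckets]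
      congr!
    · push_cast
      rw [add_mul, one_mul]

end Buckets

end LumpableBandit

namespace LumpableBandit

open scoped ENNReal NNReal

/-! ### The guarantee on one bucket -/

section Bucket

variable {S K : ℕ} [NeZero K] {A : Fin S → Fin K → ℝ} {ν : Fin S → ℝ≥0}

/-- A lump with `c` contexts in `X` contributes `c * (1 / c) = 1`, and a lump that misses `X`
nothing. -/
theorem sum_inv_card_filter_le {r : ℕ} (g : Fin S → Fin r) (X : Finset (Fin S)) :
    ∑ i ∈ X, (1 : ℝ) / ((X.filter fun i' => g i' = g i).card : ℝ) ≤ r := by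
  rw [← Finset.sum_fiberwise X g]
  calc ∑ b, ∑ i ∈ X with g i = b, (1 : ℝ) / ((X.filter fun i' => g i' = g i).card : ℝ)
      ≤ ∑ _b : Fin r, (1 : ℝ) := by
        refine Finset.sum_le_sum fun b _ => ?_
        rw [Finset.sum_congr rfl fun i hi => by rw [(Finset.mem_filter.1 hi).2]]
        rw [Finset.sum_const, nsmul_eq_mul, mul_one_div]
        exact div_self_le_one _
    _ = r := by simp

-- Small lumps may be learned badly, but there are only `r` of them: `s / (r * c)` sums up to at
-- most `s`, so the average of `6 + 16 * s / (r * c)` is at most `22`.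
omit [NeZero K] in
theorem sum_blockLoss_le {r : ℕ} (g : Fin S → Fin r) {X : Finset (Fin S)} {ε δ : ℝ}
    (h : Params X.card K r ε δ) :
    ∑ i ∈ X, blockLoss X.card K r ε δ (X.filter fun i' => g i' = g i).card ≤
      X.card * (22 * (ε * √(16 * Real.log (r * X.card * K / δ)))) := by
  have hε := h.eps_pos
  have hr := h.one_le_r
  have h1 := sum_inv_card_filter_le g X
  have e : ∀ i, blockLoss X.card K r ε δ (X.filter fun i' => g i' = g i).card =
      ε * √(16 * Real.log (r * X.card * K / δ)) * 6 + ε * √(16 * Real.log (r * X.card * K / δ)) *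
        (16 * X.card / r) * (1 / ((X.filter fun i' => g i' = g i).card : ℝ)) := by
    intro i
    unfold blockLoss
    rw [mul_add, ← div_div, mul_assoc _ (16 * (X.card : ℝ) / r), mul_one_div]
  simp_rw [e]
  rw [Finset.sum_add_distrib, Finset.sum_const, nsmul_eq_mul, ← Finset.mul_sum]
  set q := ε * √(16 * Real.log (r * X.card * K / δ))
  calc X.card * (q * 6) + q * (16 * X.card / r) *
        ∑ i ∈ X, 1 / ((X.filter fun i' => g i' = g i).card : ℝ)
      ≤ X.card * (q * 6) + q * (16 * X.card / r) * r := by gcongr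
    _ = X.card * (22 * q) := by field_simp; ring

variable {r ε δ h : ℝ}

/-- The window is long enough for the run on a bucket of estimated weight `h`. -/
theorem window_budget {s S k N : ℝ} {p : ℝ} (hpar : Params s k r (ε * √(2 / h)) δ) (hsS : s ≤ S)
    (hε : 0 < ε) (hh : 0 < h) (hh4 : h ≤ 4) (hp : h / 4 ≤ p)
    (hN : 524 * Real.log (r * S * k / δ) * (1 + 2 * Real.logb 2 (1 / ε)) ^ 2 *
      (r * (S + k) / ε ^ 2) ≤ N) :
    (⌈Real.logb 2 (1 / (ε * √(2 / h)) ^ 2)⌉₊ : ℝ) ≤ 2 * Real.logb 2 (1 / ε) + 2 ∧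
    (⌈(40 * ⌈Real.logb 2 (1 / (ε * √(2 / h)) ^ 2)⌉₊ + 1024) * Real.log (r * s * k / δ) *
      (r * (s + k) / (ε * √(2 / h)) ^ 2)⌉₊ : ℝ) ≤ p * N / 4 ∧
    Real.log (r * S * k / δ) ≤ p * N / 4 := by
  have h1 := hpar.one_le_s
  have h2 := hpar.one_le_k
  have h3 := hpar.one_le_r
  have hδ := hpar.delta_pos
  have hl := hpar.le_log hpar.one_le_mul
  have hsq : (ε * √(2 / h)) ^ 2 = 2 * ε ^ 2 / h := by
    rw [mul_pow, Real.sq_sqrt (by positivity)]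
    ring
  have hle := hpar.eps_sq_le
  have hlev := Nat.ceil_lt_add_one hpar.logb_pos.le
  have hlev0 := hpar.logb_pos
  rw [hsq] at hle hlev hlev0 ⊢
  have hinv : 1 / (2 * ε ^ 2 / h) = h / (2 * ε ^ 2) := by field_simp
  have h64 : 64 ≤ h / (2 * ε ^ 2) := by
    rw [← hinv, le_div_iff₀ (by positivity)]
    linarith
  have h32 : 32 ≤ 1 / ε ^ 2 := by
    have : h / (2 * ε ^ 2) ≤ 4 / (2 * ε ^ 2) := by gcongr
    have e : 4 / (2 * ε ^ 2) = 2 * (1 / ε ^ 2) := by field_simp; norm_num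
    linarith
  have hm : Real.logb 2 (1 / ε ^ 2) = 2 * Real.logb 2 (1 / ε) := by
    rw [show 1 / ε ^ 2 = (1 / ε) ^ 2 by field_simp, Real.logb_pow]
    norm_num
  -- Accuracy at most `1 / 8` with `h ≤ 4` forces `1 / ε ^ 2 ≥ 32`.
  have hm5 : 5 ≤ 2 * Real.logb 2 (1 / ε) := by
    rw [← hm, Real.le_logb_iff_rpow_le (by norm_num) (by positivity)]
    refine le_trans (le_of_eq ?_) h32
    norm_num
  have hle2 : Real.logb 2 (1 / (2 * ε ^ 2 / h)) ≤ 2 * Real.logb 2 (1 / ε) + 1 := by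
    have e : Real.logb 2 (1 / ε ^ 2 * 2) = Real.logb 2 (1 / ε ^ 2) + 1 := by
      rw [Real.logb_mul (by positivity) (by norm_num), Real.logb_self_eq_one (by norm_num)]
    rw [← hm, ← e, hinv]
    refine Real.logb_le_logb_of_le (by norm_num) (by positivity) ?_
    rw [div_le_iff₀ (by positivity)]
    field_simp
    linarith
  have hll : Real.log (r * s * k / δ) ≤ Real.log (r * S * k / δ) := by
    refine Real.log_le_log (by positivity) ?_
    gcongr
  set lev : ℝ := (⌈Real.logb 2 (1 / (2 * ε ^ 2 / h))⌉₊ : ℝ)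
  set m := 2 * Real.logb 2 (1 / ε)
  set L := Real.log (r * S * k / δ)
  have hS : 1 ≤ S := h1.trans hsS
  have hL16 : 16 ≤ L := hl.trans hll
  have hp0 : 0 ≤ p := le_trans (by positivity) hp
  set R := h * (r * (S + k) / ε ^ 2) with hR
  have hR1 : 1 ≤ R := by
    calc (1 : ℝ) ≤ 2 * (1 * (1 + 1)) * 64 := by norm_num
      _ ≤ 2 * (r * (S + k)) * (h / (2 * ε ^ 2)) := by gcongr
      _ = R := by rw [hR]; field_simp
  -- From `p ≥ h / 4` the window yields `524 / 16 > 32` times `(1 + m) ^ 2 * (L * R)`.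
  have hpN : 32 * (1 + m) ^ 2 * (L * R) ≤ p * N / 4 := by
    calc 32 * (1 + m) ^ 2 * (L * R) ≤ h / 4 * (524 * L * (1 + m) ^ 2 * (r * (S + k) / ε ^ 2)) / 4 := by
          have : h / 4 * (524 * L * (1 + m) ^ 2 * (r * (S + k) / ε ^ 2)) / 4 =
            524 / 16 * (1 + m) ^ 2 * (L * R) := by rw [hR]; ring
          rw [this]
          have : 0 ≤ L * R := by nlinarith
          gcongr
          norm_num
      _ ≤ p * N / 4 := by gcongr
  have hLR : 1 ≤ L * R := by nlinarith
  refine ⟨by linarith, ?_, ?_⟩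
  · have hx0 : 0 ≤ (40 * lev + 1024) * Real.log (r * s * k / δ) * (r * (s + k) / (2 * ε ^ 2 / h)) := by
      have : 0 ≤ lev := Nat.cast_nonneg _
      positivity
    have hc := Nat.ceil_lt_add_one hx0
    have hx : (40 * lev + 1024) * Real.log (r * s * k / δ) * (r * (s + k) / (2 * ε ^ 2 / h)) ≤
        (20 * m + 552) * (L * R) := by
      calc _ ≤ (40 * (m + 2) + 1024) * L * (r * (S + k) / (2 * ε ^ 2 / h)) := by
            have : 0 ≤ lev := Nat.cast_nonneg _
            gcongr
            linarith
        _ = (20 * m + 552) * (L * R) := by rw [hR]; field_simp; ring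
    -- One unit of `553` pays for rounding up. The inequality needs `m ≥ 5`.
    have : (20 * m + 553) * (L * R) ≤ 32 * (1 + m) ^ 2 * (L * R) := by
      gcongr
      nlinarith
    linarith
  · refine le_trans ?_ hpN
    have : 1 ≤ 32 * (1 + m) ^ 2 := by nlinarith
    nlinarith

-- The accuracy is tuned so that the weight cancels: `h * √(2 / h) = √(2 * h)`, below `2.84` for `h
-- ≤ 4`. The constant `2000` covers `8 * 22 * 2.84 * 4`.
omit [NeZero K] in
theorem lossLE_of_blockLoss {r : ℕ} (g : Fin S → Fin r) {X : Finset (Fin S)}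
    (hpar : Params X.card K r (ε * √(2 / h)) δ) (hε : 0 < ε) (hh : 0 < h) (hh4 : h ≤ 4)
    (hν : ∀ i ∈ X, (ν i : ℝ) ≤ 8 * h / X.card) {π : Fin S → Fin K}
    (hπ : ∀ i ∈ X, ∀ j, A i j - A i (π i) ≤
      blockLoss X.card K r (ε * √(2 / h)) δ (X.filter fun i' => g i' = g i).card) :
    LossLE A ν X (2000 * ε * √(Real.log (r * S * K / δ))) π := by
  intro π'
  have h1 := hpar.one_le_s
  have h2 := hpar.one_le_k
  have h3 := hpar.one_le_r
  have hδ := hpar.delta_pos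
  have hll : Real.log (r * X.card * K / δ) ≤ Real.log (r * S * K / δ) := by
    refine Real.log_le_log (by positivity) ?_
    gcongr
    simpa using Finset.card_le_univ X
  have hsqrt : √(16 * Real.log (r * X.card * K / δ)) ≤ 4 * √(Real.log (r * S * K / δ)) := by
    rw [Real.sqrt_mul (by norm_num), show √(16 : ℝ) = 4 by
      rw [show (16 : ℝ) = 4 ^ 2 by norm_num]; exact Real.sqrt_sq (by norm_num)]
    gcongr
  have hy : h * √(2 / h) ≤ 284 / 100 := by
    have h0 : 0 ≤ h * √(2 / h) := by positivity
    have : (h * √(2 / h)) ^ 2 = 2 * h := by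
      rw [mul_pow, Real.sq_sqrt (by positivity)]
      field_simp
    nlinarith
  have hbl : ∀ i, 0 ≤ blockLoss X.card K r (ε * √(2 / h)) δ (X.filter fun i' => g i' = g i).card := by
    intro i
    unfold blockLoss
    positivity
  calc ∑ i ∈ X, (ν i : ℝ) * (A i (π' i) - A i (π i))
      ≤ ∑ i ∈ X, 8 * h / X.card *
        blockLoss X.card K r (ε * √(2 / h)) δ (X.filter fun i' => g i' = g i).card := by
        refine Finset.sum_le_sum fun i hi => ?_
        calc _ ≤ (ν i : ℝ) * blockLoss X.card K r (ε * √(2 / h)) δ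
              (X.filter fun i' => g i' = g i).card :=
              mul_le_mul_of_nonneg_left (hπ i hi _) (ν i).coe_nonneg
          _ ≤ _ := mul_le_mul_of_nonneg_right (hν i hi) (hbl i)
    _ ≤ 8 * h / X.card * (X.card * (22 * (ε * √(2 / h) *
          √(16 * Real.log (r * X.card * K / δ))))) := by
        rw [← Finset.mul_sum]
        gcongr
        exact sum_blockLoss_le g hpar
    _ = 176 * ε * (h * √(2 / h)) * √(16 * Real.log (r * X.card * K / δ)) := by field_simp; ring
    _ ≤ 176 * ε * (284 / 100) * (4 * √(Real.log (r * S * K / δ))) := by gcongr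
    _ ≤ 2000 * ε * √(Real.log (r * S * K / δ)) := by
        have : 0 ≤ ε * √(Real.log (r * S * K / δ)) := by positivity
        linarith

/-- The guarantee for a bucket `X` of estimated weight `h`. -/
theorem cert_bucket (hν : ∑ i, (ν i : ℝ) = 1) {r : ℕ} {g : Fin S → Fin r}
    (hg : ∀ i i', g i = g i' → ∀ j, A i j = A i' j) (hgap : ∀ i j j', A i j - A i j' ≤ 1)
    (hpar : Params S K r (1 / 8) δ) {X : Finset (Fin S)} (hh : 0 < h)
    (hlow : h / 4 ≤ ∑ i ∈ X, (ν i : ℝ)) (hupp : ∑ i ∈ X, (ν i : ℝ) ≤ 4 * h)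
    (hunif : ∀ i ∈ X, 1 / (32 * (X.card : ℝ)) * ∑ i ∈ X, (ν i : ℝ) ≤ ν i)
    (hmax : ∀ i ∈ X, (ν i : ℝ) ≤ 8 * h / X.card) (hε : 0 < ε) (hε1 : ε ≤ 1) {N : ℕ}
    (hN : 524 * Real.log (r * S * K / δ) * (1 + 2 * Real.logb 2 (1 / ε)) ^ 2 *
      (r * ((S : ℝ) + K) / ε ^ 2) ≤ N) :
    Cert A ν (fun _ o => LossLE A ν X (2000 * ε * √(Real.log (r * S * K / δ)))
        (o.getD fun _ => 0)) N Set.univ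
      (fun _ : Unit => (almostUniform X.card r (ε * √(2 / h)) δ N).restrict X N)
      fun _ => ENNReal.ofReal ((7 * (2 * Real.logb 2 (1 / ε) + 3) + 1) * δ) := by
  classical
  have hX1 : ∑ i ∈ X, (ν i : ℝ) ≤ 1 := by
    rw [← hν]
    exact Finset.sum_le_univ_sum_of_nonneg fun i => (ν i).coe_nonneg
  have hX0 : 0 < ∑ i ∈ X, (ν i : ℝ) := lt_of_lt_of_le (by positivity) hlow
  have hXne : X.Nonempty := by
    rw [Finset.nonempty_iff_ne_empty]
    rintro rfl
    simp at hX0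
  have hS := hpar.one_le_s
  have hK := hpar.one_le_k
  have hr := hpar.one_le_r
  have hδ := hpar.delta_pos
  have hL := hpar.le_log hpar.one_le_mul
  have hm0 : 0 ≤ Real.logb 2 (1 / ε) := Real.logb_nonneg (by norm_num) (by
    rw [le_div_iff₀ hε]; linarith)
  rcases le_or_gt (ε * √(2 / h)) (1 / 8) with hsmall | hbig
  · have hpar' : Params X.card K r (ε * √(2 / h)) δ :=
      ⟨by exact_mod_cast hXne.card_pos, hK, hr, by positivity, hsmall, hδ, hpar.delta_le⟩
    have hXS : (X.card : ℝ) ≤ S := by simpa using Finset.card_le_univ X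
    have hh4 : h ≤ 4 := by linarith
    obtain ⟨hb1, hb2, hb3⟩ := window_budget hpar' hXS hε hh hh4 hlow hN
    have hsum : ∑ i, ((if i ∈ X then ν i else 0 : ℝ≥0) : ℝ) = ∑ i ∈ X, (ν i : ℝ) := by
      simp [Finset.sum_ite_mem, apply_ite]
    -- `N` also serves as the fuel of the screening loops, which need `r` iterations.
    have hrN : r ≤ N := by
      have : (r : ℝ) ≤ N := by
        refine le_trans ?_ hN
        calc (r : ℝ) = 1 * 1 * 1 ^ 2 * (r * 1 / 1) := by ring
          _ ≤ 524 * Real.log (r * S * K / δ) * (1 + 2 * Real.logb 2 (1 / ε)) ^ 2 *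
              (r * ((S : ℝ) + K) / ε ^ 2) := by
            gcongr
            · linarith
            · linarith
            · linarith
            · linarith
            · exact pow_le_one₀ hε.le hε1
      exact_mod_cast this
    have c1 := cert_almostUniform (A := A) (ρ := fun i => if i ∈ X then ν i else 0) (X := X)
      (fun i hi => by by_contra h; simp [h] at hi)
      (fun i hi => by rw [hsum]; simpa [hi] using hunif i hi) hg hgap hpar' hrN
      (M := ⌈(40 * ⌈Real.logb 2 (1 / (ε * √(2 / h)) ^ 2)⌉₊ + 1024) *
        Real.log (r * X.card * K / δ) * (r * ((X.card : ℝ) + K) / (ε * √(2 / h)) ^ 2)⌉₊)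
      (Nat.le_ceil _)
    refine (cert_restrict hν X c1 N).mono measurable_const le_rfl (fun _ h => h) (fun _ _ => rfl)
      ?_ fun _ _ => ?_
    · rintro _ - o ⟨π, rfl, hπ⟩
      exact lossLE_of_blockLoss g hpar' hε hh hh4 hmax hπ
    · rw [← ENNReal.ofReal_add (by positivity) (mul_nonneg (Real.exp_pos _).le
        (pow_nonneg (decay_pos hX1).le _))]
      refine ENNReal.ofReal_le_ofReal ?_
      have e1 : Real.exp (⌈(40 * ⌈Real.logb 2 (1 / (ε * √(2 / h)) ^ 2)⌉₊ + 1024) *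
          Real.log (r * X.card * K / δ) * (r * ((X.card : ℝ) + K) / (ε * √(2 / h)) ^ 2)⌉₊ : ℝ) *
          decay (∑ i ∈ X, (ν i : ℝ)) ^ N ≤ δ := by
        -- The run needs at most half of the exponent that the window provides, and the other half
        -- is at least the logarithm.
        calc _ ≤ Real.exp ((∑ i ∈ X, (ν i : ℝ)) * N / 4) *
              Real.exp (-((∑ i ∈ X, (ν i : ℝ)) * N / 2)) := by
              refine mul_le_mul (Real.exp_le_exp.2 hb2) (decay_pow_le hX0.le hX1 N)
                (pow_nonneg (decay_pos hX1).le _) (Real.exp_pos _).le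
          _ = Real.exp (-((∑ i ∈ X, (ν i : ℝ)) * N / 4)) := by
              rw [← Real.exp_add]
              ring_nf
          _ ≤ Real.exp (-Real.log (r * S * K / δ)) := Real.exp_le_exp.2 (by linarith)
          _ = δ / (r * S * K) := hpar.exp_neg_log hpar.one_le_mul
          _ ≤ δ := div_le_self hδ.le hpar.one_le_mul
      have e2 : 7 * ((⌈Real.logb 2 (1 / (ε * √(2 / h)) ^ 2)⌉₊ : ℝ) + 1) * δ ≤
          7 * (2 * Real.logb 2 (1 / ε) + 3) * δ := by
        refine mul_le_mul_of_nonneg_right ?_ hδ.le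
        linarith
      linarith
  -- Accuracy above `1 / 8` means `h ≤ 128 * ε ^ 2`. The bucket then has probability at most `512 *
  -- ε ^ 2`, and gaps are at most `1`, so every policy qualifies.
  · refine Cert.mono (runs_restrict_almostUniform hν X X.card r (ε * √(2 / h)) δ N N)
      measurable_const le_rfl (fun _ h => h) (fun _ _ => rfl) (fun _ _ o _ π' => ?_)
      fun _ _ => zero_le
    have hsq : (ε * √(2 / h)) ^ 2 = 2 * ε ^ 2 / h := by
      rw [mul_pow, Real.sq_sqrt (by positivity)]
      ring
    have hh128 : h ≤ 128 * ε ^ 2 := by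
      have : 1 / 64 ≤ 2 * ε ^ 2 / h := by
        rw [← hsq]
        nlinarith
      rw [le_div_iff₀ hh] at this
      linarith
    have hsqrt : 4 ≤ √(Real.log (r * S * K / δ)) := Real.le_sqrt_of_sq_le (by linarith)
    calc ∑ i ∈ X, (ν i : ℝ) * (A i (π' i) - A i (o.getD (fun _ => 0) i))
        ≤ ∑ i ∈ X, (ν i : ℝ) * 1 := Finset.sum_le_sum fun i _ =>
          mul_le_mul_of_nonneg_left (hgap _ _ _) (ν i).coe_nonneg
      _ ≤ 512 * ε ^ 2 := by
          simp only [mul_one]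
          linarith
      _ ≤ 512 * ε := by nlinarith
      _ ≤ 2000 * ε * √(Real.log (r * S * K / δ)) := by nlinarith

end Bucket

end LumpableBandit

namespace LumpableBandit

open scoped ENNReal NNReal

/-! ### General context distributions -/

section General

variable {S K : ℕ} {A : Fin S → Fin K → ℝ} {ν : Fin S → ℝ≥0}

theorem disjoint_bucket (νhat : Fin S → ℝ) {l l' : ℕ} (h : l < l') :
    Disjoint (bucket νhat l) (bucket νhat l') := by
  classical
  refine Finset.disjoint_left.2 fun i hi hi' => ?_
  have h4 := (Finset.mem_filter.1 hi).2.1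
  have h5 := (Finset.mem_filter.1 hi').2.2
  have h6 : (1 / 2 : ℝ) ^ l' ≤ (1 / 2) ^ (l + 1) :=
    pow_le_pow_of_le_one (by norm_num) (by norm_num) h
  linarith

theorem half_pow_le {x : ℝ} (hx : 0 < x) : (1 / 2 : ℝ) ^ ⌈Real.logb 2 x⌉₊ ≤ 1 / x := by
  have h1 : x ≤ 2 ^ ⌈Real.logb 2 x⌉₊ := by
    have : Real.logb 2 x ≤ ⌈Real.logb 2 x⌉₊ := Nat.le_ceil _
    rwa [Real.logb_le_iff_le_rpow (by norm_num) hx, Real.rpow_natCast] at this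
  rw [one_div_pow]
  exact one_div_le_one_div_of_le hx h1

theorem le_half_pow {x : ℝ} (hx : 0 < x) {l : ℕ} (hl : l < ⌈Real.logb 2 x⌉₊) :
    1 / (2 * x) ≤ (1 / 2 : ℝ) ^ (l + 1) := by
  have h1 : (2 : ℝ) ^ l ≤ x := by
    have := (Nat.lt_ceil.1 hl).le
    rwa [Real.le_logb_iff_rpow_le (by norm_num) hx, Real.rpow_natCast] at this
  rw [one_div_pow]
  refine one_div_le_one_div_of_le (by positivity) ?_
  rw [pow_succ]
  linarith

variable {J : ℕ} {Λ ε : ℝ} {cnt : Fin S → ℕ}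

/-- In the first `⌈log₂ (S / ε)⌉` buckets the estimated probability exceeds `ε / (2 * S)`, which for
this `J` means at least `2 * Λ` visits, so `upper` applies. For the second bound, `lower` applies
unless `J * ν i < 8 * Λ`, and then the number of visits is large enough by itself. -/
theorem CountsGood.close (h : CountsGood ν J Λ cnt) (hΛ : 0 < Λ) (hε : 0 < ε)
    (hJ : 4 * S / ε * Λ ≤ J) {i : Fin S} {l : ℕ} (hl : l < ⌈Real.logb 2 (S / ε)⌉₊)
    (hi : i ∈ bucket (fun i => (cnt i : ℝ) / J) l) :
    (cnt i : ℝ) / J ≤ 4 * ν i ∧ (ν i : ℝ) ≤ 4 * (cnt i / J) := by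
  classical
  have hS : (0 : ℝ) < S := by exact_mod_cast i.pos
  have hJ0 : (0 : ℝ) < J := lt_of_lt_of_le (by positivity) hJ
  have h1 := (Finset.mem_filter.1 hi).2.1
  have h2 := le_half_pow (x := S / ε) (by positivity) hl
  have h3 : 2 * Λ ≤ cnt i := by
    have h4 := h2.trans h1.le
    rw [le_div_iff₀ hJ0] at h4
    refine le_trans ?_ h4
    calc 2 * Λ = 1 / (2 * (S / ε)) * (4 * S / ε * Λ) := by field_simp; norm_num
      _ ≤ _ := by gcongr
  constructor
  · rw [div_le_iff₀ hJ0]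
    linarith [h.upper i h3]
  · rw [← mul_div_assoc, le_div_iff₀ hJ0]
    rcases le_or_gt (8 * Λ) (J * ν i) with h5 | h5
    · linarith [h.lower i h5]
    · linarith

/-- A context of probability above `4 * ε / S` has `J * ν i ≥ 16 * Λ`, so by `lower` its estimate
exceeds `ε / S`. The buckets used cover all estimates in this range. -/
theorem CountsGood.rare (h : CountsGood ν J Λ cnt) (hΛ : 0 < Λ) (hε : 0 < ε)
    (hJ : 4 * S / ε * Λ ≤ J) {i : Fin S}
    (hi : ∀ l < ⌈Real.logb 2 (S / ε)⌉₊, i ∉ bucket (fun i => (cnt i : ℝ) / J) l) :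
    (ν i : ℝ) ≤ 4 * ε / S := by
  classical
  have hS : (0 : ℝ) < S := by exact_mod_cast i.pos
  have hJ0 : (0 : ℝ) < J := lt_of_lt_of_le (by positivity) hJ
  by_contra! hlt
  have h8 : 16 * Λ ≤ J * ν i := by
    calc 16 * Λ = 4 * S / ε * Λ * (4 * ε / S) := by field_simp; norm_num
      _ ≤ J * ν i := by gcongr
  have h1 := h.lower i (by linarith)
  have h2 : ε / S < cnt i / J := by
    have : 4 * ε / S = 4 * (ε / S) := by ring
    rw [lt_div_iff₀ hJ0]
    nlinarith
  have h3 : (cnt i : ℝ) / J ≤ 1 := by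
    rw [div_le_one hJ0]
    exact_mod_cast h.le_total i
  obtain ⟨l, hl1, hl2⟩ := exists_nat_pow_near_of_lt_one (lt_trans (by positivity) h2) h3
    (y := (1 / 2 : ℝ)) (by norm_num) (by norm_num)
  refine hi l ?_ (Finset.mem_filter.2 ⟨Finset.mem_univ i, hl1, hl2⟩)
  by_contra! hle
  have h4 : (1 / 2 : ℝ) ^ l ≤ (1 / 2) ^ ⌈Real.logb 2 (S / ε)⌉₊ :=
    pow_le_pow_of_le_one (by norm_num) (by norm_num) hle
  have h5 := half_pow_le (x := S / ε) (by positivity)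
  rw [one_div_div] at h5
  linarith

/-- The context distribution is almost uniform on the buckets. -/
theorem bucket_almostUniform {νhat : Fin S → ℝ} {l : ℕ} (hX : (bucket νhat l).Nonempty)
    (h : ∀ i ∈ bucket νhat l, νhat i ≤ 4 * ν i ∧ (ν i : ℝ) ≤ 4 * νhat i) :
    0 < ∑ i ∈ bucket νhat l, νhat i ∧
    (∑ i ∈ bucket νhat l, νhat i) / 4 ≤ ∑ i ∈ bucket νhat l, (ν i : ℝ) ∧
    ∑ i ∈ bucket νhat l, (ν i : ℝ) ≤ 4 * ∑ i ∈ bucket νhat l, νhat i ∧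
    (∀ i ∈ bucket νhat l, 1 / (32 * ((bucket νhat l).card : ℝ)) *
      ∑ i ∈ bucket νhat l, (ν i : ℝ) ≤ ν i) ∧
    ∀ i ∈ bucket νhat l, (ν i : ℝ) ≤ 8 * (∑ i ∈ bucket νhat l, νhat i) / (bucket νhat l).card := by
  classical
  set X := bucket νhat l
  have hc : (0 : ℝ) < X.card := by exact_mod_cast hX.card_pos
  have ha : (0 : ℝ) < (1 / 2) ^ (l + 1) := by positivity
  have h2a : (1 / 2 : ℝ) ^ l = 2 * (1 / 2) ^ (l + 1) := by rw [pow_succ]; ring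
  have hlow : ∀ i ∈ X, (1 / 2 : ℝ) ^ (l + 1) ≤ νhat i := fun i hi => (Finset.mem_filter.1 hi).2.1.le
  have hupp : ∀ i ∈ X, νhat i ≤ 2 * (1 / 2 : ℝ) ^ (l + 1) := fun i hi => by
    rw [← h2a]
    exact (Finset.mem_filter.1 hi).2.2
  set a : ℝ := (1 / 2) ^ (l + 1)
  have h1 : X.card * a ≤ ∑ i ∈ X, νhat i := by
    rw [← nsmul_eq_mul]
    exact Finset.card_nsmul_le_sum _ _ _ hlow
  have h2 : ∑ i ∈ X, (ν i : ℝ) ≤ X.card * (8 * a) := by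
    rw [← nsmul_eq_mul]
    exact Finset.sum_le_card_nsmul _ _ _ fun i hi => by linarith [hupp i hi, (h i hi).2]
  refine ⟨lt_of_lt_of_le (by positivity) h1, ?_, ?_, fun i hi => ?_, fun i hi => ?_⟩
  · rw [Finset.sum_div]
    exact Finset.sum_le_sum fun i hi => by linarith [(h i hi).1]
  · rw [Finset.mul_sum]
    exact Finset.sum_le_sum fun i hi => (h i hi).2
  -- With `a = 2 ^ (-l - 1)`, probabilities in the bucket lie between `a / 4` and `8 * a`. Their
  -- ratio is the factor `32`.
  · calc 1 / (32 * (X.card : ℝ)) * ∑ i ∈ X, (ν i : ℝ)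
        ≤ 1 / (32 * (X.card : ℝ)) * (X.card * (8 * a)) := by gcongr
      _ = a / 4 := by field_simp; norm_num
      _ ≤ ν i := by linarith [hlow i hi, (h i hi).1]
  · rw [le_div_iff₀ hc]
    nlinarith [hupp i hi, (h i hi).2]

/-- The guarantee of the algorithm for general context distributions. -/
theorem cert_generalAlgorithm [NeZero K] (hν : ∑ i, (ν i : ℝ) = 1) {r : ℕ} {g : Fin S → Fin r}
    (hg : ∀ i i', g i = g i' → ∀ j, A i j = A i' j) (hgap : ∀ i j j', A i j - A i j' ≤ 1)
    {δ : ℝ} (hpar : Params S K r (1 / 8) δ) (hε : 0 < ε) (hε1 : ε ≤ 1) :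
    ∃ M, Cert A ν (fun _ π => ∀ π' : Fin S → Fin K, ∑ i, (ν i : ℝ) * (A i (π' i) - A i (π i)) ≤
        ⌈Real.logb 2 (S / ε)⌉₊ * (2000 * ε * √(Real.log (r * S * K / δ))) + 4 * ε) M Set.univ
      (fun _ : Unit => generalAlgorithm S K r ε δ) fun _ => ENNReal.ofReal
        ((2 + ⌈Real.logb 2 (S / ε)⌉₊ * (7 * (2 * Real.logb 2 (1 / ε) + 3) + 1)) * δ) := by
  classical
  have hS := hpar.one_le_s
  have hδ := hpar.delta_pos
  have hm0 : 0 ≤ Real.logb 2 (1 / ε) := Real.logb_nonneg (by norm_num) (by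
    rw [le_div_iff₀ hε]; linarith)
  have hΛ : 0 < Real.log (S / δ) := by linarith [hpar.le_log hS]
  have hexp := hpar.exp_neg_log hS
  set Λ := Real.log (S / δ) with hΛdef
  set J := ⌈4 * S / ε * Λ⌉₊ with hJ
  set L := ⌈Real.logb 2 (S / ε)⌉₊ with hLdef
  set N := ⌈524 * Real.log (r * S * K / δ) * (1 + 2 * Real.logb 2 (1 / ε)) ^ 2
    * (r * (S + K) / ε ^ 2)⌉₊ with hN
  set B := 2000 * ε * √(Real.log (r * S * K / δ)) with hB
  set f := (7 * (2 * Real.logb 2 (1 / ε) + 3) + 1) * δ with hf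
  have hJle : 4 * S / ε * Λ ≤ J := Nat.le_ceil _
  have c1 := cert_observe (A := A) hν J hΛ.le
  have c2 := c1.bind (Post' := fun (_ : Unit) (π : Fin S → Fin K) => ∀ π' : Fin S → Fin K,
      ∑ i, (ν i : ℝ) * (A i (π' i) - A i (π i)) ≤ L * B + 4 * ε) (M' := L * N)
    (w := L * ENNReal.ofReal f)
    (k := fun z => learnBuckets r ε δ N (fun i => (z.2 i : ℝ) / J) L) ?_
  · refine ⟨_, c2.mono measurable_const le_rfl (fun _ h => h) (fun _ _ => rfl) (fun _ _ _ h => h)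
      fun _ _ => ?_⟩
    rw [← ENNReal.ofReal_natCast L, ← ENNReal.ofReal_mul (by positivity),
      ← ENNReal.ofReal_add (by positivity) (by positivity)]
    refine ENNReal.ofReal_le_ofReal (le_of_eq ?_)
    rw [hexp, hf]
    field_simp
  -- The buckets and accuracies depend on the counts only, so the rest is analysed for fixed counts.
  · refine Cert.cases measurable_const Prod.snd measurable_snd fun cnt => ?_
    by_cases hgood : CountsGood ν J Λ cnt
    swap
    · refine Cert.fail measurable_const ?_
      rintro z ⟨⟨-, hz⟩, rfl⟩
      exact absurd hz hgood
    have c3 := cert_learnBuckets (A := A) (ν := ν) r ε δ N (fun i => (cnt i : ℝ) / J) B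
      (ENNReal.ofReal f) L fun l hl => ?_
    · refine c3.comp (fun _ => ()) measurable_const measurable_const le_rfl
        (fun _ _ => Or.inl trivial) ?_ ?_ fun _ _ => le_rfl
      · rintro z ⟨-, rfl⟩
        rfl
      · rintro z ⟨-, rfl⟩ π hπ π'
        set X : ℕ → Finset (Fin S) := bucket fun i => (z.2 i : ℝ) / J
        have hdisj : Set.PairwiseDisjoint (Finset.range L : Set ℕ) X := by
          intro l _ l' _ hll
          rcases lt_or_gt_of_ne hll with h | h
          · exact disjoint_bucket _ h
          · exact (disjoint_bucket _ h).symm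
        rw [← Finset.sum_add_sum_compl ((Finset.range L).biUnion X)]
        refine add_le_add ?_ ?_
        · rw [Finset.sum_biUnion hdisj]
          refine (Finset.sum_le_card_nsmul _ _ B fun l hl =>
            hπ l (Finset.mem_range.1 hl) π').trans ?_
          rw [nsmul_eq_mul, Finset.card_range]
        -- Outside the buckets there are at most `S` contexts, each of probability at most `4 * ε /
        -- S`; this is the additional loss `4 * ε`.
        · have h1 : ∀ i ∈ ((Finset.range L).biUnion X)ᶜ,
              (ν i : ℝ) * (A i (π' i) - A i (π i)) ≤ 4 * ε / S := by
            intro i hi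
            have h2 : (ν i : ℝ) ≤ 4 * ε / S := hgood.rare hΛ hε hJle fun l hl hmem => by
              rw [Finset.mem_compl, Finset.mem_biUnion] at hi
              exact hi ⟨l, Finset.mem_range.2 hl, hmem⟩
            have h3 := mul_le_mul_of_nonneg_left (hgap i (π' i) (π i)) (ν i).coe_nonneg
            linarith
          refine (Finset.sum_le_card_nsmul _ _ _ h1).trans ?_
          rw [nsmul_eq_mul]
          have h2 : ((((Finset.range L).biUnion X)ᶜ).card : ℝ) ≤ S := by
            simpa using Finset.card_le_univ (((Finset.range L).biUnion X)ᶜ)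
          calc _ ≤ S * (4 * ε / S) := by gcongr
            _ = 4 * ε := by field_simp
    · rcases (bucket (fun i => (cnt i : ℝ) / J) l).eq_empty_or_nonempty with hX | hX
      · refine Cert.mono (runs_restrict_almostUniform hν _ _ _ _ δ N N) measurable_const le_rfl
          (fun _ h => h) (fun _ _ => rfl) (fun _ _ o _ π' => ?_) fun _ _ => zero_le
        rw [hX, Finset.sum_empty]
        positivity
      · obtain ⟨h1, h2, h3, h4, h5⟩ := bucket_almostUniform (ν := ν) hX
          fun i hi => hgood.close hΛ hε hJle hl hi
        exact cert_bucket hν hg hgap hpar h1 h2 h3 h4 h5 hε hε1 (Nat.le_ceil _)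

end General

/-! ### The number of samples -/

section Samples

variable {S K : ℕ} {α β : Type}

theorem Prog.samples_bind (p : Prog S K α) (f : α → Prog S K β) (w : ℕ → Obs S K) :
    ∃ a w', (p.bind f).samples w = p.samples w + (f a).samples w' := by
  induction p generalizing w with
  | done a => exact ⟨a, w, (zero_add _).symm⟩
  | round act next ih =>
    obtain ⟨a, w', h⟩ := ih (w 0).seed (w 0).ctx (w 0).reward fun t => w (t + 1)
    refine ⟨a, w', ?_⟩
    simp only [Prog.bind, Prog.samples, h]
    omega

theorem Prog.samples_restrict [NeZero K] (X : Finset (Fin S)) (N : ℕ) :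
    ∀ (p : Prog S K α) (w : ℕ → Obs S K), (p.restrict X N).samples w = N := by
  induction N with
  | zero => intro p w; cases p <;> rfl
  | succ N ih =>
    intro p w
    cases p with
    | done a => simp only [Prog.restrict, Prog.samples, ih]
    | round act next =>
      simp only [Prog.restrict, Prog.samples]
      split_ifs <;> rw [ih]

theorem samples_observe [NeZero K] (J : ℕ) :
    ∀ (cnt : Fin S → ℕ) (w : ℕ → Obs S K), (observe J cnt).samples w = J := by
  induction J with
  | zero => exact fun _ _ => rfl
  | succ J ih => intro cnt w; simp only [observe, Prog.samples, ih]

theorem samples_learnBuckets [NeZero K] (r : ℕ) (ε δ : ℝ) (N : ℕ) (νhat : Fin S → ℝ) (n : ℕ)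
    (w : ℕ → Obs S K) : (learnBuckets r ε δ N νhat n).samples w = n * N := by
  induction n generalizing w with
  | zero => rw [zero_mul]; rfl
  | succ n ih =>
    simp only [learnBuckets]
    obtain ⟨π, w', h⟩ := Prog.samples_bind (learnBuckets r ε δ N νhat n) (fun π =>
      ((almostUniform (bucket νhat n).card r (ε * √(2 / ∑ i ∈ bucket νhat n, νhat i)) δ N).restrict
        (bucket νhat n) N).bind fun ρ => .done fun i =>
          if i ∈ bucket νhat n then ρ.getD (fun _ => 0) i else π i) w
    obtain ⟨ρ, w'', h'⟩ := Prog.samples_bind ((almostUniform (K := K) (bucket νhat n).card r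
      (ε * √(2 / ∑ i ∈ bucket νhat n, νhat i)) δ N).restrict (bucket νhat n) N) (fun ρ =>
        .done fun i => if i ∈ bucket νhat n then ρ.getD (fun _ => 0) i else π i) w'
    refine Eq.trans ?_ (h.trans ?_)
    · rfl
    · rw [h', ih, Prog.samples_restrict, add_mul, one_mul]
      rfl

/-- The windows have fixed length whatever happens in them, so the bound on the samples holds surely
and costs no probability. -/
theorem samples_generalAlgorithm [NeZero K] (r : ℕ) (ε δ : ℝ) (w : ℕ → Obs S K) :
    (generalAlgorithm S K r ε δ).samples w = ⌈4 * S / ε * Real.log (S / δ)⌉₊ +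
      ⌈Real.logb 2 (S / ε)⌉₊ * ⌈524 * Real.log (r * S * K / δ) * (1 + 2 * Real.logb 2 (1 / ε)) ^ 2
        * (r * (S + K) / ε ^ 2)⌉₊ := by
  obtain ⟨cnt, w', h⟩ := Prog.samples_bind
    (observe (S := S) (K := K) ⌈4 * S / ε * Real.log (S / δ)⌉₊ fun _ => 0)
    (fun cnt => learnBuckets r ε δ ⌈524 * Real.log (r * S * K / δ) *
      (1 + 2 * Real.logb 2 (1 / ε)) ^ 2 * (r * (S + K) / ε ^ 2)⌉₊
      (fun i => cnt i / (⌈4 * S / ε * Real.log (S / δ)⌉₊ : ℕ)) ⌈Real.logb 2 (S / ε)⌉₊) w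
  refine Eq.trans rfl (h.trans ?_)
  rw [samples_observe, samples_learnBuckets]

end Samples

end LumpableBandit

namespace LumpableBandit

open scoped ENNReal NNReal

/-! ### The theorem -/

section Main

/-- `61 = 16 + 45`: the inequality `log x ≤ x - 1` is applied to `46` and, twice, to `1 + l`. -/
theorem log_div_confidence_le {n δ l : ℝ} (hn : 0 < n) (hδ : 0 < δ) (hl : 0 ≤ l) :
    Real.log (n / (δ / (46 * Real.exp 16 * (1 + l) ^ 2))) ≤
      Real.log n + Real.log (1 / δ) + (61 + 2 * l) := by
  have e : n / (δ / (46 * Real.exp 16 * (1 + l) ^ 2)) =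
      n * (1 / δ) * (46 * (Real.exp 16 * ((1 + l) * (1 + l)))) := by
    field_simp
  have h1 := Real.log_le_sub_one_of_pos (show 0 < 1 + l by linarith)
  have h2 := Real.log_le_sub_one_of_pos (show (0 : ℝ) < 46 by norm_num)
  rw [e, Real.log_mul (by positivity) (by positivity), Real.log_mul (by positivity) (by positivity),
    Real.log_mul (by positivity) (by positivity), Real.log_mul (by positivity) (by positivity),
    Real.log_mul (by positivity) (by positivity), Real.log_exp]
  linarith

/-- The windows dominate, as `S / ε ≤ r * (S + K) / ε ^ 2` makes the initial observation cheap. The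
constants come from `524 * 61 * 3 ^ 2 = 287676`, increased by one for rounding and doubled by `L ≤ 2
* (1 + l)`. -/
theorem sample_bound {S K r ε l d Λ lg m L : ℝ} (hS : 1 ≤ S) (hK : 1 ≤ K) (hr : 1 ≤ r)
    (hε : 0 < ε) (hε1 : ε ≤ 1) (hl : 0 ≤ l) (hd : 0 ≤ d) (hΛ0 : 0 ≤ Λ)
    (hΛ : Λ ≤ 61 * ((1 + l) * (1 + d))) (hlg0 : 0 ≤ lg) (hlg : lg ≤ 61 * ((1 + l) * (1 + d)))
    (hm0 : 0 ≤ m) (hm : 2 * m ≤ 3 * l) (hL : L ≤ 2 * (1 + l)) :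
    (⌈4 * S / ε * Λ⌉₊ : ℝ) + L * (⌈524 * lg * (1 + 2 * m) ^ 2 * (r * (S + K) / ε ^ 2)⌉₊ : ℝ) ≤
      600000 * (1 + l) ^ 4 * (r * (S + K) * (1 + d) / ε ^ 2) := by
  set R := r * (S + K) / ε ^ 2 with hR
  set D := 1 + d with hD
  have hD1 : 1 ≤ D := by linarith
  have hR1 : S / ε ≤ R := by
    have : S / ε = 1 * (S + 0) / (1 * ε) := by ring
    rw [hR, this, pow_two]
    gcongr
    linarith
  have hSε1 : 1 ≤ S / ε := by rw [le_div_iff₀ hε]; linarith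
  have hQ : 1 ≤ (1 + l) * D * R := by
    calc (1 : ℝ) = 1 * 1 * 1 := by norm_num
      _ ≤ (1 + l) * D * R := by gcongr <;> linarith
  have hR0 : 0 < R := by linarith
  have hJ : (⌈4 * S / ε * Λ⌉₊ : ℝ) ≤ 245 * ((1 + l) * D * R) := by
    have h1 : 4 * S / ε * Λ ≤ 244 * ((1 + l) * D * R) := by
      calc 4 * S / ε * Λ = 4 * (S / ε) * Λ := by ring
        _ ≤ 4 * R * (61 * ((1 + l) * D)) := by gcongr
        _ = _ := by ring
    have h2 : 0 ≤ 4 * S / ε * Λ := by positivity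
    have := Nat.ceil_lt_add_one h2
    linarith
  have hN : (⌈524 * lg * (1 + 2 * m) ^ 2 * R⌉₊ : ℝ) ≤ 287677 * (1 + l) ^ 2 * ((1 + l) * D * R) := by
    have h1 : 524 * lg * (1 + 2 * m) ^ 2 * R ≤ 287676 * (1 + l) ^ 2 * ((1 + l) * D * R) := by
      calc 524 * lg * (1 + 2 * m) ^ 2 * R
          ≤ 524 * (61 * ((1 + l) * D)) * (3 * (1 + l)) ^ 2 * R := by
            gcongr
            linarith
        _ = _ := by ring
    have h2 : 0 ≤ 524 * lg * (1 + 2 * m) ^ 2 * R := by positivity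
    have h3 : 1 ≤ (1 + l) ^ 2 := one_le_pow₀ (by linarith)
    have h4 : 1 ≤ (1 + l) ^ 2 * ((1 + l) * D * R) := one_le_mul_of_one_le_of_one_le h3 hQ
    have := Nat.ceil_lt_add_one h2
    linarith
  have h3 : 1 ≤ (1 + l) ^ 3 := one_le_pow₀ (by linarith)
  calc (⌈4 * S / ε * Λ⌉₊ : ℝ) + L * (⌈524 * lg * (1 + 2 * m) ^ 2 * R⌉₊ : ℝ)
      ≤ 245 * ((1 + l) * D * R) + 2 * (1 + l) * (287677 * (1 + l) ^ 2 * ((1 + l) * D * R)) := by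
        gcongr
    _ = (245 + 575354 * (1 + l) ^ 3) * ((1 + l) * D * R) := by ring
    _ ≤ 600000 * (1 + l) ^ 3 * ((1 + l) * D * R) := by
        gcongr
        linarith
    _ = 600000 * (1 + l) ^ 4 * (r * (S + K) * D / ε ^ 2) := by rw [hR]; ring

/-- The numerical facts behind the choice of the confidence parameter. -/
theorem confidence_bounds {S K r ε δ : ℝ} (hS : 1 ≤ S) (hK : 1 ≤ K) (hr : 1 ≤ r) (hε : 0 < ε)
    (hε1 : ε ≤ 1) (hδ : 0 < δ) (hδ1 : δ < 1) {δ' : ℝ}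
    (hδ' : δ' = δ / (46 * Real.exp 16 * (1 + Real.log (r * S * K / ε)) ^ 2)) :
    Params S K r (1 / 8) δ' ∧
    (2 + ⌈Real.logb 2 (S / ε)⌉₊ * (7 * (2 * Real.logb 2 (1 / ε) + 3) + 1)) * δ' ≤ δ ∧
    ⌈Real.logb 2 (S / ε)⌉₊ * (2000 * ε * √(Real.log (r * S * K / δ'))) + 4 * ε ≤
      600000 * (1 + Real.log (r * S * K / (ε * δ))) ^ 4 * ε ∧
    (⌈4 * S / ε * Real.log (S / δ')⌉₊ + ⌈Real.logb 2 (S / ε)⌉₊ *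
      ⌈524 * Real.log (r * S * K / δ') * (1 + 2 * Real.logb 2 (1 / ε)) ^ 2
        * (r * (S + K) / ε ^ 2)⌉₊ : ℝ) ≤
      600000 * (1 + Real.log (r * S * K / ε)) ^ 4 *
        (r * (S + K) * (1 + Real.log (1 / δ)) / ε ^ 2) := by
  have hn : 1 ≤ r * S * K := by
    calc (1 : ℝ) = 1 * 1 * 1 := by norm_num
      _ ≤ r * S * K := by gcongr
  have hnε : 1 ≤ r * S * K / ε := by
    rw [le_div_iff₀ hε]
    linarith
  have hl0 : 0 ≤ Real.log (r * S * K / ε) := Real.log_nonneg hnε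
  have hn_le : Real.log (r * S * K) ≤ Real.log (r * S * K / ε) :=
    Real.log_le_log (by positivity) (le_div_self (by positivity) hε hε1)
  have hSn : S ≤ r * S * K := by
    calc S = 1 * S * 1 := by ring
      _ ≤ r * S * K := by gcongr
  have hSε_le : Real.log (S / ε) ≤ Real.log (r * S * K / ε) :=
    Real.log_le_log (by positivity) (by gcongr)
  have hε_le : Real.log (1 / ε) ≤ Real.log (r * S * K / ε) :=
    Real.log_le_log (by positivity) (by gcongr)
  have hε0 : 0 ≤ Real.log (1 / ε) := Real.log_nonneg (by rw [le_div_iff₀ hε]; linarith)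
  have hSε0 : 0 ≤ Real.log (S / ε) := Real.log_nonneg (by rw [le_div_iff₀ hε]; linarith)
  have hd0 : 0 ≤ Real.log (1 / δ) := Real.log_nonneg (by rw [le_div_iff₀ hδ]; linarith)
  have hY : Real.log (r * S * K / (ε * δ)) = Real.log (r * S * K / ε) + Real.log (1 / δ) := by
    rw [← Real.log_mul (by positivity) (by positivity)]
    congr 1
    field_simp
  set l := Real.log (r * S * K / ε) with hl
  set d := Real.log (1 / δ) with hd
  have hexp16 : 1 ≤ Real.exp 16 := Real.one_le_exp (by norm_num)
  have hden : 46 * Real.exp 16 ≤ 46 * Real.exp 16 * (1 + l) ^ 2 := by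
    have : 1 ≤ (1 + l) ^ 2 := one_le_pow₀ (by linarith)
    have : 0 < 46 * Real.exp 16 := by positivity
    nlinarith
  have hδ'0 : 0 < δ' := by rw [hδ']; positivity
  have hpar : Params S K r (1 / 8) δ' := by
    refine ⟨hS, hK, hr, by norm_num, le_rfl, hδ'0, ?_⟩
    rw [hδ', Real.exp_neg, div_le_iff₀ (by positivity)]
    calc δ ≤ (Real.exp 16)⁻¹ * Real.exp 16 := by
          rw [inv_mul_cancel₀ (by positivity)]
          exact hδ1.le
      _ ≤ (Real.exp 16)⁻¹ * (46 * Real.exp 16 * (1 + l) ^ 2) := by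
          gcongr
          linarith
  have hlog : Real.log (r * S * K / δ') ≤ 61 * ((1 + l) * (1 + d)) ∧
      Real.log (r * S * K / δ') ≤ 61 * (1 + (l + d)) := by
    have h3 := log_div_confidence_le (n := r * S * K) (by positivity) hδ hl0
    rw [← hδ'] at h3
    have h4 := mul_nonneg hl0 hd0
    constructor <;> linarith
  have hlogS : Real.log (S / δ') ≤ Real.log (r * S * K / δ') :=
    Real.log_le_log (by positivity) (by gcongr)
  have hlog16 := hpar.le_log hpar.one_le_mul
  have hlogS16 := hpar.le_log hS
  -- Binary logarithms are replaced by natural ones, at the cost of `3 / 2 ≥ 1 / log 2`.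
  have hlb : ∀ x : ℝ, 0 ≤ Real.log x → 0 ≤ Real.logb 2 x ∧ Real.logb 2 x ≤ 3 / 2 * Real.log x := by
    intro x hx
    have h2 : 2 / 3 ≤ Real.log 2 := by linarith [Real.log_two_gt_d9]
    have h3 : 0 < Real.log 2 := by linarith
    refine ⟨div_nonneg hx h3.le, ?_⟩
    rw [Real.logb, div_le_iff₀ h3]
    nlinarith
  obtain ⟨hb0, hb1⟩ := hlb _ hε0
  obtain ⟨hc0, hc1⟩ := hlb _ hSε0
  have hL : (⌈Real.logb 2 (S / ε)⌉₊ : ℝ) ≤ 2 * (1 + l) := by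
    have := Nat.ceil_lt_add_one hc0
    linarith
  set L : ℝ := (⌈Real.logb 2 (S / ε)⌉₊ : ℝ)
  have hL0 : 0 ≤ L := Nat.cast_nonneg _
  set m := Real.logb 2 (1 / ε)
  set lg := Real.log (r * S * K / δ') with hlg
  refine ⟨hpar, ?_, ?_, ?_⟩
  -- This is the origin of `46` and of the exponent `2` in the confidence parameter; the factor `exp
  -- 16` is there for `Params.delta_le`.
  · have h1 : 2 + L * (7 * (2 * m + 3) + 1) ≤ 46 * (1 + l) ^ 2 := by
      calc 2 + L * (7 * (2 * m + 3) + 1) ≤ 2 * (1 + l) ^ 2 + 2 * (1 + l) * (22 * (1 + l)) := by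
            gcongr
            · nlinarith
            · linarith
        _ = 46 * (1 + l) ^ 2 := by ring
    rw [hδ', ← mul_div_assoc, div_le_iff₀ (by positivity), mul_comm]
    have h2 : 46 * (1 + l) ^ 2 ≤ 46 * Real.exp 16 * (1 + l) ^ 2 := by
      gcongr
      linarith
    gcongr
    linarith
  · rw [hY]
    set Y := 1 + (l + d) with hYdef
    have hY1 : 1 ≤ Y := by linarith
    have hsq : √lg ≤ 61 * Y := by
      refine le_trans ?_ hlog.2
      rw [Real.sqrt_le_left (by linarith)]
      nlinarith
    have hL' : L ≤ 2 * Y := by linarith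
    have h2 : 1 ≤ Y ^ 4 := one_le_pow₀ hY1
    have h4 : Y ^ 2 ≤ Y ^ 4 := pow_le_pow_right₀ hY1 (by norm_num)
    calc L * (2000 * ε * √lg) + 4 * ε ≤ 2 * Y * (2000 * ε * (61 * Y)) + 4 * ε := by gcongr
      _ = (244000 * Y ^ 2 + 4) * ε := by ring
      _ ≤ 600000 * Y ^ 4 * ε := by
          gcongr
          linarith
  · exact sample_bound hS hK hr hε hε1 hl0 hd0 (by linarith)
      (hlogS.trans hlog.1)
      (by linarith) hlog.1 hb0 (by linarith) hL

theorem isEpsOptimal_of_loss {S K : ℕ} {A : Fin S → Fin K → ℝ} {ν : PMF (Fin S)} {b ε : ℝ}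
    {π : Fin S → Fin K} (h : ∀ π' : Fin S → Fin K,
      ∑ i, ((ν i).toNNReal : ℝ) * (A i (π' i) - A i (π i)) ≤ b) (hb : b ≤ ε) :
    IsEpsOptimal A ν ε π := by
  intro π'
  have := h π'
  simp only [mul_sub, Finset.sum_sub_distrib] at this
  unfold value
  simp only [ENNReal.coe_toNNReal_eq_toReal] at this
  linarith

theorem sum_toNNReal_pmf {S : ℕ} (ν : PMF (Fin S)) : ∑ i, ((ν i).toNNReal : ℝ) = 1 := by
  have h := ν.tsum_coe
  rw [tsum_fintype] at h
  simp only [ENNReal.coe_toNNReal_eq_toReal]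
  rw [← ENNReal.toReal_sum fun i _ => ν.apply_ne_top i, h, ENNReal.toReal_one]

end Main

end LumpableBandit

open LumpableBandit in
theorem theorem2 :
    ∃ (c C : ℝ) (q p : ℕ), 1 ≤ c ∧ 0 < C ∧
      ∀ (S K r : ℕ) [NeZero K] (A : Fin S → Fin K → ℝ) (ν : PMF (Fin S)),
        Lumpable r A → (∀ i j j', A i j - A i j' ≤ 1) →
      ∀ (ε δ : ℝ), 0 < ε → ε ≤ 1 → 0 < δ → δ < 1 →
      ∀ alg : Prog S K (Fin S → Fin K),
        alg = generalAlgorithm S K r ε (δ / (c * (1 + Real.log (r * S * K / ε)) ^ q)) →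
      ∀ {Ω : Type*} [MeasurableSpace Ω] (P : Measure Ω) [IsProbabilityMeasure P]
        (u : ℕ → Ω → Fin K) (i : ℕ → Ω → Fin S) (y : ℕ → Ω → ℝ),
        IsInteraction P A ν alg u i y →
        ENNReal.ofReal (1 - δ) ≤ P {x |
          IsEpsOptimal A ν (C * (1 + Real.log (r * S * K / (ε * δ))) ^ p * ε)
            (alg.result (path u i y x)) ∧
          (alg.samples (path u i y x) : ℝ) ≤
            C * (1 + Real.log (r * S * K / ε)) ^ p * (r * (S + K) * (1 + Real.log (1 / δ)) / ε ^ 2)}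
    := by
  refine ⟨46 * Real.exp 16, 600000, 2, 4, ?_, by norm_num, ?_⟩
  · linarith [Real.one_le_exp (show (0 : ℝ) ≤ 16 by norm_num)]
  intro S K r _ A ν ⟨g, hg⟩ hgap ε δ hε hε1 hδ hδ1 alg halg Ω _ P _ u i y hI
  -- The existence of `ν` rules out `S = 0`, and the lumping map then rules out `r = 0`.
  obtain ⟨i₀, -⟩ := ν.support_nonempty
  have hS : (1 : ℝ) ≤ S := by exact_mod_cast i₀.pos
  have hK : (1 : ℝ) ≤ K := by exact_mod_cast NeZero.one_le
  have hr : (1 : ℝ) ≤ r := by exact_mod_cast (g i₀).pos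
  obtain ⟨hpar, hfail, hopt, hsamples⟩ := confidence_bounds hS hK hr hε hε1 hδ hδ1 rfl
  subst halg
  obtain ⟨M, hcert⟩ := cert_generalAlgorithm (sum_toNNReal_pmf ν) hg hgap hpar hε hε1
  obtain ⟨E, hE, hsub, hPE⟩ := Cert.measure_le hI hcert
  calc ENNReal.ofReal (1 - δ) = 1 - ENNReal.ofReal δ := by
        rw [ENNReal.ofReal_sub _ hδ.le, ENNReal.ofReal_one]
    _ ≤ 1 - P E := by
        gcongr
        exact hPE.trans (ENNReal.ofReal_le_ofReal hfail)
    -- Complements are taken of the measurable event `E`, since the event of the theorem need not be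
    -- measurable.
    _ = P Eᶜ := (prob_compl_eq_one_sub hE).symm
    _ ≤ _ := by
        refine measure_mono fun x hx => ⟨?_, ?_⟩
        · exact isEpsOptimal_of_loss (not_imp_comm.1 (hsub x) hx) hopt
        · rw [samples_generalAlgorithm]
          push_cast
          exact hsamples
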